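/- Let $m(T)$ denote the number of matchings of maximal cardinality (maximum matchings) of a finite tree $T$, and call $T$ optimal if it maximises $m$ over all trees of the same order. A vertex of $T$ is of type $A$ if some maximum matching does not cover it, and of type $B$ otherwise. A leaf is a vertex of degree $1$. For $c_0,\dots,c_k\ge 0$ let $\mathrm{Cat}(c_0,c_1,\dots,c_k)$ be the tree obtained from a path $v_0v_1\cdots v_{2k}$ by attaching $c_i$ new leaves to $v_{2i}$ for $0\le i\le k$. Let $\mathcal S$ be the set of the following twelve trees (up to isomorphism), the subscript being the order: $T_2^*=\mathrm{Cat}(1)$, $T_3^*=\mathrm{Cat}(2)$, $T_5^*=\mathrm{Cat}(4)$, $T_{6,1}^*=\mathrm{Cat}(5)$, $T_{6,2}^*=\mathrm{Cat}(2,1)$, $T_8^*=\mathrm{Cat}(3,2)$, $T_9^*=\mathrm{Cat}(3,3)$, $T_{10}^*=\mathrm{Cat}(2,1,2)$, $T_{12}^*=\mathrm{Cat}(3,2,2)$, $T_{13}^*=\mathrm{Cat}(3,2,3)$, $T_{16}^*=\mathrm{Cat}(3,2,2,2)$, $T_{20}^*=\mathrm{Cat}(3,2,2,2,2)$. Let $T$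 be an optimal tree with $T\notin\mathcal S$, of order different from $1$ and $4$. Then $T$ satisfies the following local conditions: (LC1) the two classes of the bipartition of $T$ are precisely the set of vertices of type $A$ and the set of vertices of type $B$; (LC2) each vertex of type $A$ has degree $1$ or $2$; (LC3) each vertex of type $B$ has degree at least $3$; (LC4) each vertex of degree $3$ is adjacent to at least two leaves; (LC5) each vertex has degree at most $4$; (LC6) no vertex is adjacent to three (or more) leaves. -/

import Mathlib

namespace OptimalTree

variable {V : Type*}

/-- A matching of maximal cardinality (a maximum matching) of `G`. -/
def IsMaximumMatching (G : SimpleGraph V) (M : G.Subgraph) : Prop :=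
  M.IsMatching ∧ ∀ M' : G.Subgraph, M'.IsMatching → M'.edgeSet.ncard ≤ M.edgeSet.ncard

/-- The number `m(G)` of maximum matchings of `G`. -/
noncomputable def numMaximumMatchings (G : SimpleGraph V) : ℕ :=
  {M : G.Subgraph | IsMaximumMatching G M}.ncard

/-- `G` is an optimal tree: it is a tree, and it maximises the number of maximum matchings over all
trees of the same order (every such tree is isomorphic to one on the same vertex set). -/
def IsOptimalTree (G : SimpleGraph V) : Prop :=
  G.IsTree ∧ ∀ H : SimpleGraph V, H.IsTree → numMaximumMatchings H ≤ numMaximumMatchings G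

/-- A vertex is of type A if some maximum matching does not cover it. -/
def IsTypeA (G : SimpleGraph V) (v : V) : Prop :=
  ∃ M : G.Subgraph, IsMaximumMatching G M ∧ v ∉ M.verts

/-- A vertex is of type B if it is not of type A. -/
def IsTypeB (G : SimpleGraph V) (v : V) : Prop :=
  ¬ IsTypeA G v

/-- The vertices of type A and the vertices of type B are the two classes of a bipartition of `G`
(which is the only one if `G` is a tree). -/
def BipartitionCondition (G : SimpleGraph V) : Prop :=
  G.IsBipartiteWith {v | IsTypeA G v} {v | IsTypeB G v}

section LocalConditions

variable [Fintype V] (G : SimpleGraph V) [DecidableRel G.Adj]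

/-- The number of leaves (vertices of degree 1) adjacent to `v`. -/
def numAdjacentLeaves (v : V) : ℕ :=
  ((G.neighborFinset v).filter (fun w => G.degree w = 1)).card

/-- The local conditions LC1 to LC6. -/
structure LocalConditions : Prop where
  lc1 : BipartitionCondition G
  lc2 : ∀ v, IsTypeA G v → G.degree v = 1 ∨ G.degree v = 2
  lc3 : ∀ v, IsTypeB G v → 3 ≤ G.degree v
  lc4 : ∀ v, G.degree v = 3 → 2 ≤ numAdjacentLeaves G v
  lc5 : ∀ v, G.degree v ≤ 4
  lc6 : ∀ v, ¬ 3 ≤ numAdjacentLeaves G v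

end LocalConditions

/-- The graph on `{0, …, n - 1}` with the edges listed in `l`. -/
def ofEdges (n : ℕ) (l : List (ℕ × ℕ)) : SimpleGraph (Fin n) :=
  SimpleGraph.fromRel (fun i j => (i.val, j.val) ∈ l)

/-- The path of order 2. -/
def T2 : SimpleGraph (Fin 2) := ofEdges 2 [(0, 1)]

/-- The path of order 3. -/
def T3 : SimpleGraph (Fin 3) := ofEdges 3 [(0, 1), (0, 2)]

/-- The star of order 5. -/
def T5 : SimpleGraph (Fin 5) := ofEdges 5 [(0, 1), (0, 2), (0, 3), (0, 4)]

/-- The star of order 6. -/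
def T6₁ : SimpleGraph (Fin 6) := ofEdges 6 [(0, 1), (0, 2), (0, 3), (0, 4), (0, 5)]

/-! The other exceptional trees are caterpillars: a path `0, 1, …, 2k`, with leaves attached only at
the vertices `0, 2, …, 2k` of the path. -/

/-- Path of order 3; 2 and 1 leaves attached. -/
def T6₂ : SimpleGraph (Fin 6) := ofEdges 6 [(0, 1), (1, 2), (0, 3), (0, 4), (2, 5)]

/-- Path of order 3; 3 and 2 leaves attached. -/
def T8 : SimpleGraph (Fin 8) :=
  ofEdges 8 [(0, 1), (1, 2), (0, 3), (0, 4), (0, 5), (2, 6), (2, 7)]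

/-- Path of order 3; 3 and 3 leaves attached. -/
def T9 : SimpleGraph (Fin 9) :=
  ofEdges 9 [(0, 1), (1, 2), (0, 3), (0, 4), (0, 5), (2, 6), (2, 7), (2, 8)]

/-- Path of order 5; 2, 1 and 2 leaves attached. -/
def T10 : SimpleGraph (Fin 10) :=
  ofEdges 10 [(0, 1), (1, 2), (2, 3), (3, 4), (0, 5), (0, 6), (2, 7), (4, 8), (4, 9)]

/-- Path of order 5; 3, 2 and 2 leaves attached. -/
def T12 : SimpleGraph (Fin 12) :=
  ofEdges 12 [(0, 1), (1, 2), (2, 3), (3, 4), (0, 5), (0, 6), (0, 7), (2, 8), (2, 9),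
    (4, 10), (4, 11)]

/-- Path of order 5; 3, 2 and 3 leaves attached. -/
def T13 : SimpleGraph (Fin 13) :=
  ofEdges 13 [(0, 1), (1, 2), (2, 3), (3, 4), (0, 5), (0, 6), (0, 7), (2, 8), (2, 9),
    (4, 10), (4, 11), (4, 12)]

/-- Path of order 7; 3, 2, 2 and 2 leaves attached. -/
def T16 : SimpleGraph (Fin 16) :=
  ofEdges 16 [(0, 1), (1, 2), (2, 3), (3, 4), (4, 5), (5, 6), (0, 7), (0, 8), (0, 9),
    (2, 10), (2, 11), (4, 12), (4, 13), (6, 14), (6, 15)]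

/-- Path of order 9; 3, 2, 2, 2 and 2 leaves attached. -/
def T20 : SimpleGraph (Fin 20) :=
  ofEdges 20 [(0, 1), (1, 2), (2, 3), (3, 4), (4, 5), (5, 6), (6, 7), (7, 8),
    (0, 9), (0, 10), (0, 11), (2, 12), (2, 13), (4, 14), (4, 15), (6, 16), (6, 17),
    (8, 18), (8, 19)]

/-- The finite set of the twelve exceptional trees. -/
def exceptionalTrees : Set (Σ n : ℕ, SimpleGraph (Fin n)) :=
  {⟨2, T2⟩, ⟨3, T3⟩, ⟨5, T5⟩, ⟨6, T6₁⟩, ⟨6, T6₂⟩, ⟨8, T8⟩, ⟨9, T9⟩, ⟨10, T10⟩, ⟨12, T12⟩,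
    ⟨13, T13⟩, ⟨16, T16⟩, ⟨20, T20⟩}

/-- `G` belongs, up to isomorphism, to the set of exceptional trees. -/
def IsExceptional (G : SimpleGraph V) : Prop :=
  ∃ E ∈ exceptionalTrees, Nonempty (G ≃g E.2)

end OptimalTree

-- Maximum matchings are read off the matching polynomial: its degree is the size of a maximum
-- matching and its leading coefficient is their number. For rooted trees, the polynomials `P` (all
-- matchings) and `Q` (root uncovered) satisfy a two-term recursion when two trees are joined by an
-- edge at their roots, and the root has type A exactly when the two degrees agree.
--
-- In an optimal tree of order other than 2 no edge joins two vertices of the same type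
-- (`Opt.rootA_iff`). An edge between two vertices of type B lies in no maximum matching, and
-- rehanging one side at a vertex of type A strictly increases the count; if neither side has such a
-- vertex, the tree has just one maximum matching and the star beats it. An edge between two
-- vertices of type A leads, by rerooting, to an edge of the first kind. Hence the types form the
-- bipartition, and the maximum matchings are those that cover all of B. They are counted by the
-- integer recursion `S`, `Z`. For any tree with any 2-colouring, `S` is a lower bound for the
-- number of maximum matchings (`S_le_num`), so every rearrangement of the branches of an optimal
-- tree that keeps the order yields an inequality (`Rep.S_le`). All other conditions follow by
-- combining such inequalities; the exceptional trees are the cases of equality and the small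
-- survivors.
--
-- Degrees. A vertex of type B of degree two can be removed by merging its two neighbours, and
-- equality forces `T6₂` (`Rep.not_pair`). A vertex of type A with three branches, two of them free
-- of such vertices, is excluded by three rearrangements along a path to an outermost vertex of type
-- B (`Rep.false_of_branch`, `branch_inequality`).
--
-- Ratios. Once the vertices of type A have degree at most two, a branch matters to the rest only
-- through its size, its factor `Sa` and its ratio `rho`, and a nontrivial branch has ratio s/(1+s),
-- with s the sum of the ratios above it. The value of the tree is bilinear in the ratio sums at the
-- two ends of a path, so moving or exchanging branches between the ends gives balance inequalities
-- (`Rep.mul_sg_le`, `Rep.rho_add_le`, `Rep.rho_add_le_of_lt`).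
--
-- Degree at most four. If some vertex of type B has degree three with two leaves (a fork), balance
-- confines all ratios at a vertex of degree five to a narrow interval, and this is contradictory
-- (`Rep.false_of_forkAt`). If there is no fork, all but one of the branches at an outermost vertex
-- of degree at least five are chains, whose ratios exceed √3 - 1, and local exchanges finish
-- (`Rep.false_of_chains`).
--
-- Leaves. Three leaves at a vertex force a caterpillar to grow from it (`Rep.spine_step`); it stops
-- at an exceptional tree or is beaten by an explicit competitor (`Rep.not_spine`). A vertex of type
-- B of degree three with at most one leaf forces a rigid structure on the whole tree. Its value is
-- then bounded in terms of the order, and explicit competitors beat this bound except for `T10`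
-- (`SRep.bound_of_bushy`, `exists_large`, `Rep.not_small`).

namespace OptimalTree

open Polynomial SimpleGraph

/-! ### Matching polynomials -/

section MatchingPolynomial

variable {α β : Type*}

/-- A set of pairwise disjoint edges of `G`, none of which meets `W`. -/
def IsMatchingSet (G : SimpleGraph α) (W : Set α) (M : Finset (Sym2 α)) : Prop :=
  (∀ e ∈ M, e ∈ G.edgeSet) ∧ (∀ e ∈ M, ∀ f ∈ M, ∀ v, v ∈ e → v ∈ f → e = f) ∧
    ∀ e ∈ M, ∀ v ∈ e, v ∉ W

open Classical in
/-- The sets of pairwise disjoint edges avoiding `W`. -/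
noncomputable def matchingSets [Fintype α] (G : SimpleGraph α) (W : Set α) :
    Finset (Finset (Sym2 α)) :=
  Finset.univ.filter (IsMatchingSet G W)

/-- The generating polynomial of the matchings avoiding `W`. -/
noncomputable def matchingPoly [Fintype α] (G : SimpleGraph α) (W : Set α) : ℕ[X] :=
  ∑ M ∈ matchingSets G W, X ^ M.card

lemma mem_matchingSets [Fintype α] {G : SimpleGraph α} {W : Set α} {M : Finset (Sym2 α)} :
    M ∈ matchingSets G W ↔ IsMatchingSet G W M := by
  simp [matchingSets]

/-- The disjoint union of two sets of vertices. -/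
def sumSet (W : Set α) (U : Set β) : Set (α ⊕ β) := {x | Sum.elim (· ∈ W) (· ∈ U) x}

@[simp] lemma inl_mem_sumSet {W : Set α} {U : Set β} {x : α} :
    (Sum.inl x : α ⊕ β) ∈ sumSet W U ↔ x ∈ W := Iff.rfl

@[simp] lemma inr_mem_sumSet {W : Set α} {U : Set β} {x : β} :
    (Sum.inr x : α ⊕ β) ∈ sumSet W U ↔ x ∈ U := Iff.rfl

/-- Two graphs joined by an edge between `a` and `b`. -/
def joinGraph (G : SimpleGraph α) (H : SimpleGraph β) (a : α) (b : β) : SimpleGraph (α ⊕ β) :=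
  (G ⊕g H) ⊔ edge (Sum.inl a) (Sum.inr b)

@[simp] lemma joinGraph_adj_inl_inl {G : SimpleGraph α} {H : SimpleGraph β} {a : α} {b : β}
    {x y : α} : (joinGraph G H a b).Adj (Sum.inl x) (Sum.inl y) ↔ G.Adj x y := by
  simp [joinGraph, edge_adj]

@[simp] lemma joinGraph_adj_inr_inr {G : SimpleGraph α} {H : SimpleGraph β} {a : α} {b : β}
    {x y : β} : (joinGraph G H a b).Adj (Sum.inr x) (Sum.inr y) ↔ H.Adj x y := by
  simp [joinGraph, edge_adj]

@[simp] lemma joinGraph_adj_inl_inr {G : SimpleGraph α} {H : SimpleGraph β} {a : α} {b : β}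
    {x : α} {y : β} : (joinGraph G H a b).Adj (Sum.inl x) (Sum.inr y) ↔ x = a ∧ y = b := by
  simp [joinGraph, edge_adj]

@[simp] lemma joinGraph_adj_inr_inl {G : SimpleGraph α} {H : SimpleGraph β} {a : α} {b : β}
    {x : α} {y : β} : (joinGraph G H a b).Adj (Sum.inr y) (Sum.inl x) ↔ x = a ∧ y = b := by
  rw [SimpleGraph.adj_comm, joinGraph_adj_inl_inr]

/-- The edges on the left of an edge set of a disjoint union. -/
noncomputable def leftEdges (M : Finset (Sym2 (α ⊕ β))) : Finset (Sym2 α) :=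
  M.preimage (Sym2.map Sum.inl) ((Sym2.map.injective Sum.inl_injective).injOn)

/-- The edges on the right of an edge set of a disjoint union. -/
noncomputable def rightEdges (M : Finset (Sym2 (α ⊕ β))) : Finset (Sym2 β) :=
  M.preimage (Sym2.map Sum.inr) ((Sym2.map.injective Sum.inr_injective).injOn)

@[simp] lemma mem_leftEdges {M : Finset (Sym2 (α ⊕ β))} {e : Sym2 α} :
    e ∈ leftEdges M ↔ Sym2.map Sum.inl e ∈ M := by simp [leftEdges]

@[simp] lemma mem_rightEdges {M : Finset (Sym2 (α ⊕ β))} {e : Sym2 β} :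
    e ∈ rightEdges M ↔ Sym2.map Sum.inr e ∈ M := by simp [rightEdges]

lemma map_inl_ne_map_inr (e : Sym2 α) (f : Sym2 β) :
    Sym2.map (Sum.inl : α → α ⊕ β) e ≠ Sym2.map Sum.inr f := by
  induction e with | _ x y => induction f with | _ z w => simp

lemma map_inl_ne_mk (e : Sym2 α) (a : α) (b : β) :
    Sym2.map (Sum.inl : α → α ⊕ β) e ≠ s(Sum.inl a, Sum.inr b) := by
  induction e with | _ x y => simp

lemma map_inr_ne_mk (e : Sym2 β) (a : α) (b : β) :
    Sym2.map (Sum.inr : β → α ⊕ β) e ≠ s(Sum.inl a, Sum.inr b) := by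
  induction e with | _ x y => simp

lemma map_inl_mem_joinGraph {G : SimpleGraph α} {H : SimpleGraph β} {a : α} {b : β} {e : Sym2 α} :
    Sym2.map Sum.inl e ∈ (joinGraph G H a b).edgeSet ↔ e ∈ G.edgeSet := by
  induction e with | _ x y => simp

lemma map_inr_mem_joinGraph {G : SimpleGraph α} {H : SimpleGraph β} {a : α} {b : β} {e : Sym2 β} :
    Sym2.map Sum.inr e ∈ (joinGraph G H a b).edgeSet ↔ e ∈ H.edgeSet := by
  induction e with | _ x y => simp

lemma mem_joinGraph_edgeSet {G : SimpleGraph α} {H : SimpleGraph β} {a : α} {b : β}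
    {e : Sym2 (α ⊕ β)} (he : e ∈ (joinGraph G H a b).edgeSet) :
    (∃ f, Sym2.map Sum.inl f = e) ∨ (∃ f, Sym2.map Sum.inr f = e) ∨
      e = s(Sum.inl a, Sum.inr b) := by
  induction e with
  | _ x y =>
    rcases x with x | x <;> rcases y with y | y
    · exact Or.inl ⟨s(x, y), rfl⟩
    · simp only [mem_edgeSet, joinGraph_adj_inl_inr] at he
      simp [he.1, he.2]
    · simp only [mem_edgeSet, joinGraph_adj_inr_inl] at he
      simp [he.1, he.2, Sym2.eq_swap]
    · exact Or.inr (Or.inl ⟨s(x, y), rfl⟩)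

/-- The union of an edge set on the left and one on the right. -/
def unionEdges [DecidableEq α] [DecidableEq β] (M : Finset (Sym2 α)) (N : Finset (Sym2 β)) : Finset (Sym2 (α ⊕ β)) :=
  M.image (Sym2.map Sum.inl) ∪ N.image (Sym2.map Sum.inr)

lemma card_unionEdges [DecidableEq α] [DecidableEq β] (M : Finset (Sym2 α)) (N : Finset (Sym2 β)) :
    (unionEdges M N).card = M.card + N.card := by
  rw [unionEdges, Finset.card_union_of_disjoint,
    Finset.card_image_of_injective _ (Sym2.map.injective Sum.inl_injective),
    Finset.card_image_of_injective _ (Sym2.map.injective Sum.inr_injective)]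
  rw [Finset.disjoint_left]
  rintro e h1 h2
  obtain ⟨f, -, rfl⟩ := Finset.mem_image.1 h1
  obtain ⟨g, -, h⟩ := Finset.mem_image.1 h2
  exact map_inl_ne_map_inr _ _ h.symm

lemma map_inl_mem_unionEdges [DecidableEq α] [DecidableEq β] {M : Finset (Sym2 α)} {N : Finset (Sym2 β)} {e : Sym2 α} :
    Sym2.map Sum.inl e ∈ unionEdges M N ↔ e ∈ M := by
  simp only [unionEdges, Finset.mem_union, Finset.mem_image]
  constructor
  · rintro (⟨f, hf, h⟩ | ⟨f, hf, h⟩)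
    · rwa [← Sym2.map.injective Sum.inl_injective h]
    · exact absurd h.symm (map_inl_ne_map_inr _ _)
  · exact fun h => Or.inl ⟨e, h, rfl⟩

lemma map_inr_mem_unionEdges [DecidableEq α] [DecidableEq β] {M : Finset (Sym2 α)} {N : Finset (Sym2 β)} {e : Sym2 β} :
    Sym2.map Sum.inr e ∈ unionEdges M N ↔ e ∈ N := by
  simp only [unionEdges, Finset.mem_union, Finset.mem_image]
  constructor
  · rintro (⟨f, hf, h⟩ | ⟨f, hf, h⟩)
    · exact absurd h (map_inl_ne_map_inr _ _)
    · rwa [← Sym2.map.injective Sum.inr_injective h]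
  · exact fun h => Or.inr ⟨e, h, rfl⟩

lemma mk_notMem_unionEdges [DecidableEq α] [DecidableEq β] {M : Finset (Sym2 α)} {N : Finset (Sym2 β)} {a : α} {b : β} :
    s(Sum.inl a, Sum.inr b) ∉ unionEdges M N := by
  simp only [unionEdges, Finset.mem_union, Finset.mem_image]
  rintro (⟨f, hf, h⟩ | ⟨f, hf, h⟩)
  · exact map_inl_ne_mk _ _ _ h
  · exact map_inr_ne_mk _ _ _ h

lemma unionEdges_leftEdges_rightEdges [DecidableEq α] [DecidableEq β] {G : SimpleGraph α} {H : SimpleGraph β} {a : α} {b : β}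
    {M : Finset (Sym2 (α ⊕ β))} (hM : ∀ e ∈ M, e ∈ (joinGraph G H a b).edgeSet) :
    unionEdges (leftEdges M) (rightEdges M) = M.erase s(Sum.inl a, Sum.inr b) := by
  ext e
  by_cases he : e ∈ (joinGraph G H a b).edgeSet
  · rcases mem_joinGraph_edgeSet he with ⟨f, rfl⟩ | ⟨f, rfl⟩ | rfl
    · simp [map_inl_mem_unionEdges, map_inl_ne_mk]
    · simp [map_inr_mem_unionEdges, map_inr_ne_mk]
    · simp [mk_notMem_unionEdges]
  · have h1 : e ∉ M := fun h => he (hM e h)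
    simp only [Finset.mem_erase, h1, and_false, iff_false]
    intro h
    simp only [unionEdges, Finset.mem_union, Finset.mem_image, mem_leftEdges, mem_rightEdges] at h
    rcases h with ⟨f, hf, rfl⟩ | ⟨f, hf, rfl⟩ <;> exact h1 hf

lemma IsMatchingSet.leftEdges {G : SimpleGraph α} {H : SimpleGraph β} {a : α} {b : β}
    {W : Set α} {U : Set β} {M : Finset (Sym2 (α ⊕ β))}
    (hM : IsMatchingSet (joinGraph G H a b) (sumSet W U) M) :
    IsMatchingSet G W (leftEdges M) := by
  obtain ⟨h1, h2, h3⟩ := hM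
  refine ⟨fun e he => map_inl_mem_joinGraph.1 (h1 _ (mem_leftEdges.1 he)), ?_, ?_⟩
  · intro e he f hf v hve hvf
    exact Sym2.map.injective Sum.inl_injective (h2 _ (mem_leftEdges.1 he) _ (mem_leftEdges.1 hf)
      (Sum.inl v) (Sym2.mem_map.2 ⟨v, hve, rfl⟩) (Sym2.mem_map.2 ⟨v, hvf, rfl⟩))
  · intro e he v hv
    exact h3 _ (mem_leftEdges.1 he) (Sum.inl v) (Sym2.mem_map.2 ⟨v, hv, rfl⟩)

lemma IsMatchingSet.rightEdges {G : SimpleGraph α} {H : SimpleGraph β} {a : α} {b : β}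
    {W : Set α} {U : Set β} {M : Finset (Sym2 (α ⊕ β))}
    (hM : IsMatchingSet (joinGraph G H a b) (sumSet W U) M) :
    IsMatchingSet H U (rightEdges M) := by
  obtain ⟨h1, h2, h3⟩ := hM
  refine ⟨fun e he => map_inr_mem_joinGraph.1 (h1 _ (mem_rightEdges.1 he)), ?_, ?_⟩
  · intro e he f hf v hve hvf
    exact Sym2.map.injective Sum.inr_injective (h2 _ (mem_rightEdges.1 he) _ (mem_rightEdges.1 hf)
      (Sum.inr v) (Sym2.mem_map.2 ⟨v, hve, rfl⟩) (Sym2.mem_map.2 ⟨v, hvf, rfl⟩))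
  · intro e he v hv
    exact h3 _ (mem_rightEdges.1 he) (Sum.inr v) (Sym2.mem_map.2 ⟨v, hv, rfl⟩)

lemma IsMatchingSet.unionEdges [DecidableEq α] [DecidableEq β] {G : SimpleGraph α} {H : SimpleGraph β} {a : α} {b : β}
    {W : Set α} {U : Set β} {M : Finset (Sym2 α)} {N : Finset (Sym2 β)}
    (hM : IsMatchingSet G W M) (hN : IsMatchingSet H U N) :
    IsMatchingSet (joinGraph G H a b) (sumSet W U) (unionEdges M N) := by
  have key : ∀ e ∈ OptimalTree.unionEdges M N, (∃ f ∈ M, Sym2.map Sum.inl f = e) ∨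
      (∃ f ∈ N, Sym2.map Sum.inr f = e) := by
    intro e he
    simpa [OptimalTree.unionEdges] using he
  refine ⟨?_, ?_, ?_⟩
  · intro e he
    rcases key e he with ⟨f, hf, rfl⟩ | ⟨f, hf, rfl⟩
    · exact map_inl_mem_joinGraph.2 (hM.1 f hf)
    · exact map_inr_mem_joinGraph.2 (hN.1 f hf)
  · intro e he e' he' v hv hv'
    rcases key e he with ⟨f, hf, rfl⟩ | ⟨f, hf, rfl⟩ <;>
      rcases key e' he' with ⟨f', hf', rfl⟩ | ⟨f', hf', rfl⟩ <;>
      obtain ⟨x, hx, rfl⟩ := Sym2.mem_map.1 hv <;>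
      obtain ⟨y, hy, hxy⟩ := Sym2.mem_map.1 hv'
    · rw [hM.2.1 f hf f' hf' x hx (Sum.inl_injective hxy ▸ hy)]
    · simp at hxy
    · simp at hxy
    · rw [hN.2.1 f hf f' hf' x hx (Sum.inr_injective hxy ▸ hy)]
  · intro e he v hv
    rcases key e he with ⟨f, hf, rfl⟩ | ⟨f, hf, rfl⟩ <;>
      obtain ⟨x, hx, rfl⟩ := Sym2.mem_map.1 hv
    · exact hM.2.2 f hf x hx
    · exact hN.2.2 f hf x hx

lemma sum_matchingSets_notMem [DecidableEq α] [DecidableEq β] [Fintype α] [Fintype β] (G : SimpleGraph α) (H : SimpleGraph β)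
    (a : α) (b : β) (W : Set α) (U : Set β) :
    ∑ M ∈ (matchingSets (joinGraph G H a b) (sumSet W U)).filter
      (fun M => s(Sum.inl a, Sum.inr b) ∉ M), (X : ℕ[X]) ^ M.card =
      matchingPoly G W * matchingPoly H U := by
  rw [matchingPoly, matchingPoly, Finset.sum_mul_sum, ← Finset.sum_product']
  refine Finset.sum_nbij' (fun M => (leftEdges M, rightEdges M)) (fun p => unionEdges p.1 p.2)
    ?_ ?_ ?_ ?_ ?_
  · intro M hM
    rw [Finset.mem_filter, mem_matchingSets] at hM
    exact Finset.mem_product.2 ⟨mem_matchingSets.2 hM.1.leftEdges, mem_matchingSets.2 hM.1.rightEdges⟩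
  · rintro ⟨M, N⟩ h
    rw [Finset.mem_product, mem_matchingSets, mem_matchingSets] at h
    rw [Finset.mem_filter, mem_matchingSets]
    exact ⟨h.1.unionEdges h.2, mk_notMem_unionEdges⟩
  · intro M hM
    rw [Finset.mem_filter, mem_matchingSets] at hM
    simp only
    rw [unionEdges_leftEdges_rightEdges hM.1.1, Finset.erase_eq_of_notMem hM.2]
  · rintro ⟨M, N⟩ h
    ext e
    · simp [map_inl_mem_unionEdges]
    · simp [map_inr_mem_unionEdges]
  · intro M hM
    rw [Finset.mem_filter, mem_matchingSets] at hM
    simp only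
    rw [← pow_add, ← card_unionEdges, unionEdges_leftEdges_rightEdges hM.1.1,
      Finset.erase_eq_of_notMem hM.2]

lemma sum_matchingSets_mem [DecidableEq α] [DecidableEq β] [Fintype α] [Fintype β] (G : SimpleGraph α) (H : SimpleGraph β)
    (a : α) (b : β) (W : Set α) (U : Set β) (ha : a ∉ W) (hb : b ∉ U) :
    ∑ M ∈ (matchingSets (joinGraph G H a b) (sumSet W U)).filter
      (fun M => s(Sum.inl a, Sum.inr b) ∈ M), (X : ℕ[X]) ^ M.card =
      X * (matchingPoly G (insert a W) * matchingPoly H (insert b U)) := by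
  rw [matchingPoly, matchingPoly, Finset.sum_mul_sum, ← Finset.sum_product', Finset.mul_sum]
  refine Finset.sum_nbij' (fun M => (leftEdges M, rightEdges M))
    (fun p => insert s(Sum.inl a, Sum.inr b) (unionEdges p.1 p.2)) ?_ ?_ ?_ ?_ ?_
  · intro M hM
    rw [Finset.mem_filter, mem_matchingSets] at hM
    have hL := hM.1.leftEdges
    have hR := hM.1.rightEdges
    refine Finset.mem_product.2 ⟨mem_matchingSets.2 ⟨hL.1, hL.2.1, ?_⟩,
      mem_matchingSets.2 ⟨hR.1, hR.2.1, ?_⟩⟩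
    · intro e he v hv
      rintro (rfl | hvW)
      · exact map_inl_ne_mk e v b (hM.1.2.1 _ (mem_leftEdges.1 he) _ hM.2 (Sum.inl v)
          (Sym2.mem_map.2 ⟨v, hv, rfl⟩) (by simp))
      · exact hL.2.2 e he v hv hvW
    · intro e he v hv
      rintro (rfl | hvW)
      · exact map_inr_ne_mk e a v (hM.1.2.1 _ (mem_rightEdges.1 he) _ hM.2 (Sum.inr v)
          (Sym2.mem_map.2 ⟨v, hv, rfl⟩) (by simp))
      · exact hR.2.2 e he v hv hvW
  · rintro ⟨M, N⟩ h
    rw [Finset.mem_product, mem_matchingSets, mem_matchingSets] at h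
    obtain ⟨hM, hN⟩ := h
    rw [Finset.mem_filter, mem_matchingSets]
    have hM' : IsMatchingSet G W M := ⟨hM.1, hM.2.1, fun e he v hv hW => hM.2.2 e he v hv
      (Set.mem_insert_of_mem _ hW)⟩
    have hN' : IsMatchingSet H U N := ⟨hN.1, hN.2.1, fun e he v hv hW => hN.2.2 e he v hv
      (Set.mem_insert_of_mem _ hW)⟩
    have hu := hM'.unionEdges (a := a) (b := b) hN'
    have key : ∀ e ∈ unionEdges M N, ∀ v, v ∈ e → v ∉ s(Sum.inl a, Sum.inr b) := by
      intro e he v hv hv'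
      simp only [unionEdges, Finset.mem_union, Finset.mem_image] at he
      rcases he with ⟨f, hf, rfl⟩ | ⟨f, hf, rfl⟩ <;>
        obtain ⟨x, hx, rfl⟩ := Sym2.mem_map.1 hv <;> simp at hv'
      · exact hM.2.2 f hf x hx (by simp [hv'])
      · exact hN.2.2 f hf x hx (by simp [hv'])
    refine ⟨⟨?_, ?_, ?_⟩, Finset.mem_insert_self _ _⟩
    · intro e he
      rcases Finset.mem_insert.1 he with rfl | he
      · simp
      · exact hu.1 e he
    · intro e he f hf v hve hvf
      rcases Finset.mem_insert.1 he with rfl | he <;> rcases Finset.mem_insert.1 hf with rfl | hf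
      · rfl
      · exact absurd hve (key f hf v hvf)
      · exact absurd hvf (key e he v hve)
      · exact hu.2.1 e he f hf v hve hvf
    · intro e he v hv
      rcases Finset.mem_insert.1 he with rfl | he
      · rcases Sym2.mem_iff.1 hv with rfl | rfl
        · exact ha
        · exact hb
      · exact hu.2.2 e he v hv
  · intro M hM
    rw [Finset.mem_filter, mem_matchingSets] at hM
    simp only
    rw [unionEdges_leftEdges_rightEdges hM.1.1, Finset.insert_erase hM.2]
  · rintro ⟨M, N⟩ h
    ext e
    · simp [map_inl_mem_unionEdges, map_inl_ne_mk]
    · simp [map_inr_mem_unionEdges, map_inr_ne_mk]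
  · intro M hM
    rw [Finset.mem_filter, mem_matchingSets] at hM
    simp only
    rw [← pow_add, ← card_unionEdges, unionEdges_leftEdges_rightEdges hM.1.1, ← pow_succ',
      Finset.card_erase_add_one hM.2]

end MatchingPolynomial

section JoinPolynomial

variable {α β : Type*} [Fintype α] [Fintype β]

/-- A matching either omits the joining edge and splits into two independent matchings, or uses it,
and then both its ends are forbidden to the rest. -/
lemma matchingPoly_joinGraph_of_notMem (G : SimpleGraph α) (H : SimpleGraph β)
    (a : α) (b : β) (W : Set α) (U : Set β) (ha : a ∉ W) (hb : b ∉ U) :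
    matchingPoly (joinGraph G H a b) (sumSet W U) = matchingPoly G W * matchingPoly H U +
      X * (matchingPoly G (insert a W) * matchingPoly H (insert b U)) := by
  classical
  rw [matchingPoly.eq_def (joinGraph G H a b), ← Finset.sum_filter_add_sum_filter_not
    (matchingSets (joinGraph G H a b) _) (fun M => s(Sum.inl a, Sum.inr b) ∉ M),
    sum_matchingSets_notMem]
  simp only [not_not]
  rw [sum_matchingSets_mem G H a b W U ha hb]

lemma matchingPoly_joinGraph_of_mem (G : SimpleGraph α) (H : SimpleGraph β)
    (a : α) (b : β) (W : Set α) (U : Set β) (ha : a ∈ W) :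
    matchingPoly (joinGraph G H a b) (sumSet W U) = matchingPoly G W * matchingPoly H U := by
  classical
  rw [← sum_matchingSets_notMem G H a b, matchingPoly, Finset.filter_true_of_mem]
  intro M hM h
  exact (mem_matchingSets.1 hM).2.2 _ h (Sum.inl a) (by simp) ha

end JoinPolynomial

end OptimalTree

namespace OptimalTree

open Polynomial SimpleGraph

-- Maximum matchings and types of vertices in terms of matching polynomials

section MaximumMatchings

variable {α β : Type*} [Fintype α] [Fintype β]

lemma coeff_matchingPoly (G : SimpleGraph α) (W : Set α) (k : ℕ) :
    (matchingPoly G W).coeff k = ((matchingSets G W).filter (fun M => M.card = k)).card := by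
  classical
  rw [matchingPoly, finsetSum_coeff, Finset.card_filter]
  refine Finset.sum_congr rfl fun M _ => ?_
  rw [coeff_X_pow]
  simp only [eq_comm]

lemma empty_mem_matchingSets (G : SimpleGraph α) (W : Set α) : ∅ ∈ matchingSets G W :=
  mem_matchingSets.2 ⟨by simp, by simp, by simp⟩

lemma card_le_natDegree_matchingPoly {G : SimpleGraph α} {W : Set α} {M : Finset (Sym2 α)}
    (hM : M ∈ matchingSets G W) : M.card ≤ (matchingPoly G W).natDegree := by
  apply le_natDegree_of_ne_zero
  rw [coeff_matchingPoly]
  exact (Finset.card_pos.2 ⟨M, by simp [hM]⟩).ne'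

lemma matchingPoly_ne_zero (G : SimpleGraph α) (W : Set α) : matchingPoly G W ≠ 0 := by
  intro h
  have h1 := coeff_matchingPoly G W 0
  rw [h, coeff_zero] at h1
  exact (Finset.card_pos.2 ⟨∅, by simp [empty_mem_matchingSets]⟩).ne h1

lemma exists_card_eq_natDegree (G : SimpleGraph α) (W : Set α) :
    ∃ M ∈ matchingSets G W, M.card = (matchingPoly G W).natDegree := by
  have h : (matchingPoly G W).coeff (matchingPoly G W).natDegree ≠ 0 :=
    leadingCoeff_ne_zero.2 (matchingPoly_ne_zero G W)
  rw [coeff_matchingPoly] at h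
  obtain ⟨M, hM⟩ := Finset.card_pos.1 (Nat.pos_of_ne_zero h)
  exact ⟨M, (Finset.mem_filter.1 hM).1, (Finset.mem_filter.1 hM).2⟩

open Classical in
lemma IsMatching.isMatchingSet {G : SimpleGraph α} {M : G.Subgraph} (hM : M.IsMatching) :
    IsMatchingSet G ∅ M.edgeSet.toFinset := by
  refine ⟨fun e he => M.edgeSet_subset (by simpa using he), ?_, by simp⟩
  intro e he f hf v hve hvf
  obtain ⟨x, rfl⟩ := Sym2.mem_iff_exists.1 hve
  obtain ⟨y, rfl⟩ := Sym2.mem_iff_exists.1 hvf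
  simp only [Set.mem_toFinset, Subgraph.mem_edgeSet] at he hf
  rw [hM.eq_of_adj_left he hf]

/-- The subgraph formed by a set of edges. -/
def edgesSubgraph {G : SimpleGraph α} {M : Finset (Sym2 α)} (hM : ∀ e ∈ M, e ∈ G.edgeSet) :
    G.Subgraph where
  verts := {v | ∃ e ∈ M, v ∈ e}
  Adj v w := s(v, w) ∈ M
  adj_sub h := hM _ h
  edge_vert {v w} h := ⟨s(v, w), h, by simp⟩
  symm := ⟨fun v w h => by rwa [Sym2.eq_swap]⟩

lemma edgesSubgraph_isMatching {G : SimpleGraph α} {W : Set α} {M : Finset (Sym2 α)}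
    (hM : IsMatchingSet G W M) : (edgesSubgraph hM.1).IsMatching := by
  rintro v ⟨e, he, hve⟩
  obtain ⟨w, rfl⟩ := Sym2.mem_iff_exists.1 hve
  refine ⟨w, he, fun y hy => ?_⟩
  have := hM.2.1 _ he _ hy v (by simp) (by simp)
  exact (Sym2.congr_right.1 this).symm

lemma edgesSubgraph_edgeSet {G : SimpleGraph α} {M : Finset (Sym2 α)}
    (hM : ∀ e ∈ M, e ∈ G.edgeSet) : (edgesSubgraph hM).edgeSet = M := by
  ext e
  induction e with | _ x y => simp [edgesSubgraph]

lemma isMaximumMatching_iff {G : SimpleGraph α} {M : G.Subgraph} :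
    IsMaximumMatching G M ↔ M.IsMatching ∧ M.edgeSet.ncard = (matchingPoly G ∅).natDegree := by
  classical
  have key : ∀ M' : G.Subgraph, M'.IsMatching → M'.edgeSet.ncard ≤ (matchingPoly G ∅).natDegree := by
    intro M' h
    rw [Set.ncard_eq_toFinset_card']
    exact card_le_natDegree_matchingPoly (mem_matchingSets.2 (IsMatching.isMatchingSet h))
  refine and_congr_right fun hM => ⟨fun h => le_antisymm (key M hM) ?_, fun h M' hM' => ?_⟩
  · obtain ⟨N, hN, hc⟩ := exists_card_eq_natDegree G ∅
    have hN' := mem_matchingSets.1 hN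
    have := h _ (edgesSubgraph_isMatching hN')
    rwa [edgesSubgraph_edgeSet, Set.ncard_coe_finset, hc] at this
  · rw [h]
    exact key M' hM'

/-- A subgraph that is a matching has no isolated vertices, so it is determined by its edges; this
makes subgraphs and edge sets interchangeable. -/
lemma numMaximumMatchings_eq (G : SimpleGraph α) :
    numMaximumMatchings G = (matchingPoly G ∅).leadingCoeff := by
  classical
  rw [leadingCoeff, coeff_matchingPoly, numMaximumMatchings, ← Set.ncard_coe_finset]
  refine Set.ncard_congr (fun M _ => M.edgeSet.toFinset) ?_ ?_ ?_
  · intro M hM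
    have hM' := isMaximumMatching_iff.1 hM
    simp only [Finset.coe_filter, Set.mem_ofPred_eq]
    refine ⟨mem_matchingSets.2 (IsMatching.isMatchingSet hM'.1), ?_⟩
    rw [← hM'.2, Set.ncard_eq_toFinset_card']
  · intro M N hM hN h
    exact Subgraph.IsMatching.injOn_edgeSet hM.1 hN.1 (Set.toFinset_inj.1 h)
  · intro M hM
    simp only [Finset.coe_filter, Set.mem_ofPred_eq] at hM
    have hM' := mem_matchingSets.1 hM.1
    refine ⟨edgesSubgraph hM'.1, isMaximumMatching_iff.2 ⟨edgesSubgraph_isMatching hM', ?_⟩, ?_⟩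
    · rw [edgesSubgraph_edgeSet, Set.ncard_coe_finset, hM.2]
    · simp [edgesSubgraph_edgeSet]

lemma matchingSets_subset (G : SimpleGraph α) (W : Set α) : matchingSets G W ⊆ matchingSets G ∅ :=
  fun _ hM => mem_matchingSets.2 ⟨(mem_matchingSets.1 hM).1, (mem_matchingSets.1 hM).2.1, by simp⟩

lemma natDegree_matchingPoly_le (G : SimpleGraph α) (W : Set α) :
    (matchingPoly G W).natDegree ≤ (matchingPoly G ∅).natDegree := by
  obtain ⟨M, hM, hc⟩ := exists_card_eq_natDegree G W
  rw [← hc]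
  exact card_le_natDegree_matchingPoly (matchingSets_subset G W hM)

lemma isTypeA_iff (G : SimpleGraph α) (v : α) :
    IsTypeA G v ↔ (matchingPoly G {v}).natDegree = (matchingPoly G ∅).natDegree := by
  classical
  constructor
  · rintro ⟨M, hM, hv⟩
    have hM' := isMaximumMatching_iff.1 hM
    refine le_antisymm (natDegree_matchingPoly_le G _) ?_
    rw [← hM'.2, Set.ncard_eq_toFinset_card']
    have h := IsMatching.isMatchingSet hM'.1
    refine card_le_natDegree_matchingPoly (mem_matchingSets.2 ⟨h.1, h.2.1, ?_⟩)
    rintro e he w hw rfl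
    exact hv (M.mem_verts_of_mem_edge (by simpa using he) hw)
  · intro h
    obtain ⟨M, hM, hc⟩ := exists_card_eq_natDegree G {v}
    have hM' := mem_matchingSets.1 hM
    refine ⟨edgesSubgraph hM'.1, isMaximumMatching_iff.2 ⟨edgesSubgraph_isMatching hM', ?_⟩, ?_⟩
    · rw [edgesSubgraph_edgeSet, Set.ncard_coe_finset, hc, h]
    · rintro ⟨e, he, hve⟩
      exact hM'.2.2 e he v hve rfl

lemma IsMatchingSet.image [DecidableEq α] [DecidableEq β] {G : SimpleGraph α} {H : SimpleGraph β}
    (e : G ≃g H) {W : Set β} {M : Finset (Sym2 α)} (hM : IsMatchingSet G (e ⁻¹' W) M) :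
    IsMatchingSet H W (M.image (Sym2.map e)) := by
  refine ⟨?_, ?_, ?_⟩
  · intro f hf
    obtain ⟨f', hf', rfl⟩ := Finset.mem_image.1 hf
    have := hM.1 f' hf'
    clear hf hf'
    induction f' with | _ x y => exact e.map_adj_iff.2 this
  · intro f hf g hg v hv hv'
    obtain ⟨f', hf', rfl⟩ := Finset.mem_image.1 hf
    obtain ⟨g', hg', rfl⟩ := Finset.mem_image.1 hg
    obtain ⟨x, hx, rfl⟩ := Sym2.mem_map.1 hv
    obtain ⟨y, hy, hxy⟩ := Sym2.mem_map.1 hv'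
    rw [hM.2.1 f' hf' g' hg' x hx (e.injective hxy ▸ hy)]
  · intro f hf v hv
    obtain ⟨f', hf', rfl⟩ := Finset.mem_image.1 hf
    obtain ⟨x, hx, rfl⟩ := Sym2.mem_map.1 hv
    exact hM.2.2 f' hf' x hx

lemma matchingPoly_iso {G : SimpleGraph α} {H : SimpleGraph β} (e : G ≃g H) (W : Set β) :
    matchingPoly G (e ⁻¹' W) = matchingPoly H W := by
  classical
  refine Finset.sum_nbij' (fun M => M.image (Sym2.map e)) (fun M => M.image (Sym2.map e.symm))
    ?_ ?_ ?_ ?_ ?_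
  · intro M hM
    exact mem_matchingSets.2 ((mem_matchingSets.1 hM).image e)
  · intro M hM
    refine mem_matchingSets.2 (IsMatchingSet.image e.symm ?_)
    have : e.symm ⁻¹' (e ⁻¹' W) = W := by ext x; simp
    rw [this]
    exact mem_matchingSets.1 hM
  · intro M _
    have h : Sym2.map e.symm ∘ Sym2.map e = id := by
      ext f
      induction f with | _ x y => simp
    rw [Finset.image_image, h, Finset.image_id]
  · intro M _
    have h : Sym2.map e ∘ Sym2.map e.symm = id := by
      ext f
      induction f with | _ x y => simp
    rw [Finset.image_image, h, Finset.image_id]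
  · intro M _
    rw [Finset.card_image_of_injective _ (Sym2.map.injective e.injective)]

lemma numMaximumMatchings_iso {G : SimpleGraph α} {H : SimpleGraph β} (e : G ≃g H) :
    numMaximumMatchings G = numMaximumMatchings H := by
  rw [numMaximumMatchings_eq, numMaximumMatchings_eq, ← matchingPoly_iso e, Set.preimage_empty]

lemma isTypeA_iso {G : SimpleGraph α} {H : SimpleGraph β} (e : G ≃g H) (v : α) :
    IsTypeA H (e v) ↔ IsTypeA G v := by
  rw [isTypeA_iff, isTypeA_iff, ← matchingPoly_iso e, ← matchingPoly_iso e, Set.preimage_empty]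
  have : e ⁻¹' {e v} = {v} := by ext x; simp
  rw [this]

end MaximumMatchings

lemma card_edgeSet_joinGraph {α β : Type*} [Finite α] [Finite β] (G : SimpleGraph α)
    (H : SimpleGraph β) (a : α) (b : β) :
    Nat.card (joinGraph G H a b).edgeSet = Nat.card G.edgeSet + Nat.card H.edgeSet + 1 := by
  have h : (joinGraph G H a b).edgeSet = insert s(Sum.inl a, Sum.inr b) (G ⊕g H).edgeSet := by
    ext e
    induction e with
    | _ x y =>
      rcases x with x | x <;> rcases y with y | y <;> simp [and_comm]
  have h2 : Nat.card (G ⊕g H).edgeSet = Nat.card G.edgeSet + Nat.card H.edgeSet := by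
    rw [Nat.card_congr edgeSetSumEquiv, Nat.card_sum]
  rw [h, Nat.card_coe_set_eq, Set.ncard_insert_of_notMem (by simp), ← Nat.card_coe_set_eq, h2]

/-! ### Rooted trees -/

/-- Rooted trees: a single vertex, or a rooted tree with a further branch at its root. -/
inductive RT : Type
  | leaf : RT
  | join : RT → RT → RT

namespace RT

/-- The vertices of a rooted tree. -/
def Vert : RT → Type
  | leaf => Unit
  | join t u => Vert t ⊕ Vert u

/-- The root. -/
def root : (t : RT) → Vert t
  | leaf => ()
  | join t _ => Sum.inl (root t)

/-- The underlying graph of a rooted tree. -/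
def graph : (t : RT) → SimpleGraph (Vert t)
  | leaf => ⊥
  | join t u => joinGraph (graph t) (graph u) (root t) (root u)

noncomputable instance instFintypeVert : (t : RT) → Fintype (Vert t)
  | leaf => inferInstanceAs (Fintype Unit)
  | join t u => @instFintypeSum _ _ (instFintypeVert t) (instFintypeVert u)

/-- The number of vertices. -/
def size : RT → ℕ
  | leaf => 1
  | join t u => size t + size u

lemma size_pos : ∀ t : RT, 0 < size t
  | leaf => Nat.one_pos
  | join t _ => Nat.add_pos_left (size_pos t) _

lemma card_vert : ∀ t : RT, Fintype.card (Vert t) = size t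
  | leaf => rfl
  | join t u => by
    rw [size, ← card_vert t, ← card_vert u]
    exact Fintype.card_sum

lemma graph_connected : ∀ t : RT, (graph t).Connected
  | leaf => by
    have : Subsingleton (Vert leaf) := inferInstanceAs (Subsingleton Unit)
    have : Nonempty (Vert leaf) := inferInstanceAs (Nonempty Unit)
    exact Connected.of_subsingleton
  | join t u => (graph_connected t).sum_sup_edge (graph_connected u)

lemma card_edgeSet : ∀ t : RT, Nat.card (graph t).edgeSet + 1 = size t
  | leaf => by simp [graph, size]
  | join t u => by
    have h : Nat.card (graph (join t u)).edgeSet = _ :=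
      card_edgeSet_joinGraph (graph t) (graph u) (root t) (root u)
    rw [h, size, ← card_edgeSet t, ← card_edgeSet u]
    ring

lemma graph_isTree (t : RT) : (graph t).IsTree := by
  rw [isTree_iff_connected_and_card]
  refine ⟨graph_connected t, ?_⟩
  rw [card_edgeSet, Nat.card_eq_fintype_card, card_vert]

/-- The generating polynomial of the matchings. -/
noncomputable def P (t : RT) : ℕ[X] := matchingPoly (graph t) ∅

/-- The generating polynomial of the matchings which do not cover the root. -/
noncomputable def Q (t : RT) : ℕ[X] := matchingPoly (graph t) {root t}

lemma matchingPoly_leaf (W : Set (Vert leaf)) : matchingPoly (graph leaf) W = 1 := by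
  have : matchingSets (graph leaf) W = {∅} := by
    ext M
    rw [mem_matchingSets, Finset.mem_singleton]
    constructor
    · rintro ⟨h, -, -⟩
      by_contra hne
      obtain ⟨e, he⟩ := Finset.nonempty_iff_ne_empty.2 hne
      simpa [graph] using h e he
    · rintro rfl
      exact ⟨by simp, by simp, by simp⟩
  simp [matchingPoly, this]

@[simp] lemma P_leaf : P leaf = 1 := matchingPoly_leaf _

@[simp] lemma Q_leaf : Q leaf = 1 := matchingPoly_leaf _

lemma P_join (t u : RT) : P (join t u) = P t * P u + X * (Q t * Q u) := by
  have h : sumSet (∅ : Set (Vert t)) (∅ : Set (Vert u)) = ∅ := by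
    ext x; rcases x with x | x <;> simp
  have := matchingPoly_joinGraph_of_notMem (graph t) (graph u) (root t) (root u) ∅ ∅
    (by simp) (by simp)
  rw [h, insert_empty_eq, insert_empty_eq] at this
  exact this

/-- The root of the join is the root of `t`; leaving it uncovered rules out the joining edge. -/
lemma Q_join (t u : RT) : Q (join t u) = Q t * P u := by
  have h : sumSet {root t} (∅ : Set (Vert u)) = {Sum.inl (root t)} := by
    ext x; rcases x with x | x <;> simp
  have := matchingPoly_joinGraph_of_mem (graph t) (graph u) (root t) (root u) {root t} ∅
    (by simp)
  rw [h] at this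
  exact this

end RT

end OptimalTree

namespace OptimalTree

open Polynomial SimpleGraph

/-! ### Trees are graphs of rooted trees -/

/-- An isomorphism between graphs joined by an edge. -/
def joinGraphIso {α β α' β' : Type*} {G : SimpleGraph α} {H : SimpleGraph β}
    {G' : SimpleGraph α'} {H' : SimpleGraph β'} {a : α} {b : β} {a' : α'} {b' : β'} (e : G ≃g G')
    (f : H ≃g H') (ha : e a = a') (hb : f b = b') :
    joinGraph G H a b ≃g joinGraph G' H' a' b' where
  toEquiv := Equiv.sumCongr e.toEquiv f.toEquiv
  map_rel_iff' := by
    subst ha hb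
    rintro (x | x) (y | y)
    · simp [e.map_adj_iff]
    · simp
    · simp
    · simp [f.map_adj_iff]

/-- The graphs joined by an edge may be exchanged. -/
def joinGraphComm {α β : Type*} (G : SimpleGraph α) (H : SimpleGraph β) (a : α) (b : β) :
    joinGraph G H a b ≃g joinGraph H G b a where
  toEquiv := Equiv.sumComm α β
  map_rel_iff' := by
    rintro (x | x) (y | y) <;> simp [and_comm]

/-- Two graphs attached at the same vertex may be exchanged. -/
def joinGraphRightComm {α β γ : Type*} (G : SimpleGraph α) (H : SimpleGraph β)
    (K : SimpleGraph γ) (a : α) (b : β) (c : γ) :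
    joinGraph (joinGraph G H a b) K (Sum.inl a) c ≃g
      joinGraph (joinGraph G K a c) H (Sum.inl a) b where
  toFun := Sum.elim (Sum.elim (Sum.inl ∘ Sum.inl) Sum.inr) (Sum.inl ∘ Sum.inr)
  invFun := Sum.elim (Sum.elim (Sum.inl ∘ Sum.inl) Sum.inr) (Sum.inl ∘ Sum.inr)
  left_inv := by rintro ((x | x) | x) <;> rfl
  right_inv := by rintro ((x | x) | x) <;> rfl
  map_rel_iff' := by
    rintro ((x | x) | x) ((y | y) | y) <;> simp

section Split

variable {V : Type*} {G : SimpleGraph V}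

/-- Every edge of a tree is a bridge: `C` and `D` are the components of its ends after deletion of
the edge. -/
lemma exists_joinGraphIso (hG : G.IsTree) {v w : V} (h : G.Adj v w) :
    ∃ (C D : Set V) (hv : v ∈ C) (hw : w ∈ D), v ∉ D ∧ w ∉ C ∧ (G.induce C).IsTree ∧
      (G.induce D).IsTree ∧
      ∃ e : joinGraph (G.induce C) (G.induce D) ⟨v, hv⟩ ⟨w, hw⟩ ≃g G,
        e (Sum.inl ⟨v, hv⟩) = v ∧ e (Sum.inr ⟨w, hw⟩) = w := by
  classical
  set G' := G.deleteEdges {s(v, w)} with hG'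
  have hbr : ¬ G'.Reachable v w := isBridge_iff.1 (isAcyclic_iff_forall_adj_isBridge.1 hG.2 h)
  have hG'a : G'.IsAcyclic := IsAcyclic.anti (deleteEdges_le _) hG.2
  have hadj : ∀ x y, G.Adj x y → (s(x, y) = s(v, w) ∨ G'.Adj x y) := by
    intro x y hxy
    by_cases h1 : s(x, y) = s(v, w)
    · exact Or.inl h1
    · exact Or.inr (by simp [hG', hxy, h1])
  have hle : ∀ x y, G'.Adj x y → G.Adj x y := fun x y hxy => deleteEdges_le _ hxy
  have hcover : ∀ x, G'.Reachable v x ∨ G'.Reachable w x := by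
    intro x
    obtain ⟨p⟩ := hG.1.preconnected v x
    suffices H : ∀ y x (p : G.Walk y x), (G'.Reachable v y ∨ G'.Reachable w y) →
        (G'.Reachable v x ∨ G'.Reachable w x) from H v x p (Or.inl (Reachable.refl _))
    intro y x p
    induction p with
    | nil => exact id
    | @cons a b c hab p ih =>
      intro h1
      apply ih
      rcases hadj _ _ hab with h2 | h2
      · rcases Sym2.eq_iff.1 h2 with ⟨-, rfl⟩ | ⟨-, rfl⟩
        · exact Or.inr (Reachable.refl _)
        · exact Or.inl (Reachable.refl _)
      · exact h1.imp (fun h3 => h3.trans h2.reachable) (fun h3 => h3.trans h2.reachable)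
  have hsame : ∀ u, (u = v ∨ u = w) → G.induce {x | G'.Reachable u x} =
      G'.induce {x | G'.Reachable u x} := by
    intro u hu
    ext ⟨x, hx⟩ ⟨y, hy⟩
    simp only [Set.mem_ofPred_eq] at hx hy
    simp only [comap_adj, Function.Embedding.subtype_apply]
    refine ⟨fun hxy => ?_, hle x y⟩
    rcases hadj _ _ hxy with h2 | h2
    · rcases Sym2.eq_iff.1 h2 with ⟨rfl, rfl⟩ | ⟨rfl, rfl⟩
      · exact absurd (hx.symm.trans hy) hbr
      · exact absurd (hy.symm.trans hx) hbr
    · exact h2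
  have htree : ∀ u, (u = v ∨ u = w) → (G.induce {x | G'.Reachable u x}).IsTree := by
    intro u hu
    rw [hsame u hu]
    have : (G'.induce (G'.connectedComponentMk u).supp).IsTree :=
      hG'a.isTree_connectedComponent (G'.connectedComponentMk u)
    have hs : (G'.connectedComponentMk u).supp = {x | G'.Reachable u x} := by
      ext x
      simp [reachable_comm]
    rwa [hs] at this
  refine ⟨{x | G'.Reachable v x}, {x | G'.Reachable w x}, Reachable.refl _, Reachable.refl _,
    fun h1 => hbr (Reachable.symm h1), hbr, htree v (Or.inl rfl), htree w (Or.inr rfl), ?_⟩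
  have hbij : Function.Bijective (Sum.elim (Subtype.val : {x | G'.Reachable v x} → V)
      (Subtype.val : {x | G'.Reachable w x} → V)) := by
    constructor
    · rintro (⟨x, hx⟩ | ⟨x, hx⟩) (⟨y, hy⟩ | ⟨y, hy⟩) hxy <;>
        simp only [Sum.elim_inl, Sum.elim_inr] at hxy <;> subst hxy
      · rfl
      · exact absurd (Reachable.trans hx (Reachable.symm hy)) hbr
      · exact absurd (Reachable.trans hy (Reachable.symm hx)) hbr
      · rfl
    · intro x
      rcases hcover x with hx | hx
      · exact ⟨Sum.inl ⟨x, hx⟩, rfl⟩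
      · exact ⟨Sum.inr ⟨x, hx⟩, rfl⟩
  have hmixed : ∀ x y, G'.Reachable v x → G'.Reachable w y → (G.Adj x y ↔ x = v ∧ y = w) := by
    intro x y hx hy
    constructor
    · intro hxy
      rcases hadj _ _ hxy with h2 | h2
      · rcases Sym2.eq_iff.1 h2 with h3 | ⟨rfl, rfl⟩
        · exact h3
        · exact absurd hx hbr
      · exact absurd (hx.trans (h2.reachable.trans hy.symm)) hbr
    · rintro ⟨rfl, rfl⟩
      exact h
  refine ⟨⟨Equiv.ofBijective _ hbij, ?_⟩, rfl, rfl⟩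
  rintro (⟨x, hx⟩ | ⟨x, hx⟩) (⟨y, hy⟩ | ⟨y, hy⟩)
  · simp
  · simpa using hmixed x y hx hy
  · simpa [G.adj_comm x y] using hmixed y x hy hx
  · simp

end Split

namespace RT

lemma card_lt_of_notMem {V : Type*} [Finite V] {C : Set V} {v : V} (h : v ∉ C) :
    Nat.card C < Nat.card V := by
  rw [Nat.card_coe_set_eq, ← Set.ncard_univ]
  exact Set.ncard_lt_ncard (Set.ssubset_univ_iff.2 fun h' => h (h' ▸ Set.mem_univ v))

lemma exists_iso_of_isTree {V : Type*} [Finite V] {G : SimpleGraph V} (hG : G.IsTree) (v : V) :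
    ∃ (t : RT) (e : graph t ≃g G), e (root t) = v := by
  classical
  -- The induction must vary the vertex type, since the two halves of the tree live on subtypes.
  have key : ∀ (n : ℕ) {V : Type _} [Finite V] {G : SimpleGraph V}, Nat.card V = n → G.IsTree →
      ∀ v : V, ∃ (t : RT) (e : graph t ≃g G), e (root t) = v := by
    intro n
    induction n using Nat.strong_induction_on with
    | _ n ih =>
      intro V _ G hn hG v
      by_cases hne : ∃ w, G.Adj v w
      · obtain ⟨w, hw⟩ := hne
        obtain ⟨C, D, hv, hw', hvD, hwC, hC, hD, e, he, -⟩ := exists_joinGraphIso hG hw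
        obtain ⟨t, et, ht⟩ := ih _ (hn ▸ card_lt_of_notMem hwC) rfl hC ⟨v, hv⟩
        obtain ⟨u, eu, hu⟩ := ih _ (hn ▸ card_lt_of_notMem hvD) rfl hD ⟨w, hw'⟩
        refine ⟨join t u, (joinGraphIso et eu ht hu).trans e, ?_⟩
        exact (congrArg (fun x => e (Sum.inl x)) ht).trans he
      · have hs : Subsingleton V := by
          rw [← not_nontrivial_iff_subsingleton]
          intro hnt
          obtain ⟨w, hw⟩ := hG.1.preconnected.exists_adj_of_nontrivial v
          exact hne ⟨w, hw⟩
        have hu : Subsingleton (Vert leaf) := inferInstanceAs (Subsingleton Unit)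
        refine ⟨leaf, ⟨⟨fun _ => v, fun _ => root leaf, fun _ => Subsingleton.elim _ _,
          fun _ => Subsingleton.elim _ _⟩, ?_⟩, rfl⟩
        intro a b
        simp [graph]
  exact key _ rfl hG v

lemma exists_join_iso_of_adj {V : Type*} [Finite V] {G : SimpleGraph V} (hG : G.IsTree) {v w : V}
    (h : G.Adj v w) :
    ∃ (t u : RT) (e : graph (join t u) ≃g G) (f : graph (join u t) ≃g G),
      e (root (join t u)) = v ∧ f (root (join u t)) = w := by
  obtain ⟨C, D, hv, hw, -, -, hC, hD, e, he, he'⟩ := exists_joinGraphIso hG h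
  obtain ⟨t, et, ht⟩ := exists_iso_of_isTree hC ⟨v, hv⟩
  obtain ⟨u, eu, hu⟩ := exists_iso_of_isTree hD ⟨w, hw⟩
  refine ⟨t, u, (joinGraphIso et eu ht hu).trans e,
    ((joinGraphComm _ _ _ _).trans (joinGraphIso et eu ht hu)).trans e, ?_, ?_⟩
  · exact (congrArg (fun x => e (Sum.inl x)) ht).trans he
  · exact (congrArg (fun x => e (Sum.inr x)) hu).trans he'

/-- The isomorphism of the two rootings at the ends of an edge. -/
def joinComm (t u : RT) : graph (join t u) ≃g graph (join u t) :=
  joinGraphComm (graph t) (graph u) (root t) (root u)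

/-- Rooted trees are equivalent if their graphs are isomorphic by a map preserving the roots. -/
def REquiv (t u : RT) : Prop := ∃ e : graph t ≃g graph u, e (root t) = root u

lemma REquiv.refl (t : RT) : REquiv t t := ⟨RelIso.refl _, rfl⟩

lemma REquiv.trans {t u v : RT} : REquiv t u → REquiv u v → REquiv t v := by
  rintro ⟨e, he⟩ ⟨f, hf⟩
  exact ⟨e.trans f, by rw [RelIso.trans_apply, he, hf]⟩

lemma REquiv.join {t u t' u' : RT} : REquiv t t' → REquiv u u' →
    REquiv (RT.join t u) (RT.join t' u') := by
  rintro ⟨e, he⟩ ⟨f, hf⟩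
  exact ⟨joinGraphIso e f he hf, congrArg Sum.inl he⟩

lemma REquiv.join_right_comm (t u v : RT) :
    REquiv (RT.join (RT.join t u) v) (RT.join (RT.join t v) u) :=
  ⟨joinGraphRightComm (graph t) (graph u) (graph v) (root t) (root u) (root v), rfl⟩

/-- The rooted tree with the given branches. -/
def mk : List RT → RT
  | [] => leaf
  | u :: us => join (mk us) u

/-- The branches of a rooted tree. -/
def branches : RT → List RT
  | leaf => []
  | join t u => u :: branches t

@[simp] lemma mk_branches : ∀ t : RT, mk (branches t) = t
  | leaf => rfl
  | join t u => by rw [branches, mk, mk_branches t]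

lemma exists_eq_mk (t : RT) : ∃ us, t = mk us := ⟨branches t, (mk_branches t).symm⟩

lemma REquiv.mk_perm {us vs : List RT} (h : us.Perm vs) : REquiv (RT.mk us) (RT.mk vs) := by
  induction h with
  | nil => exact REquiv.refl _
  | cons x _ ih => exact ih.join (REquiv.refl x)
  | swap x y l => exact REquiv.join_right_comm _ _ _
  | trans _ _ ih₁ ih₂ => exact ih₁.trans ih₂

lemma size_mk (us : List RT) : size (mk us) = 1 + (us.map size).sum := by
  induction us with
  | nil => rfl
  | cons u us ih => rw [mk, size, ih, List.map_cons, List.sum_cons]; ring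

/-- Whether a rooted tree is a single vertex. -/
def isLeaf : RT → Bool
  | leaf => true
  | join _ _ => false

end RT

/-! ### Degrees -/

section Degree

variable {α β : Type*}

/-- The number of neighbours of `v`. -/
noncomputable def valency (G : SimpleGraph α) (v : α) : ℕ := (G.neighborSet v).ncard

/-- The number of leaves adjacent to `v`. -/
noncomputable def leafValency (G : SimpleGraph α) (v : α) : ℕ :=
  {w | G.Adj v w ∧ valency G w = 1}.ncard

lemma valency_iso {G : SimpleGraph α} {H : SimpleGraph β} (e : G ≃g H) (v : α) :
    valency H (e v) = valency G v := by
  have h : H.neighborSet (e v) = e '' G.neighborSet v := by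
    ext w
    obtain ⟨w, rfl⟩ := e.surjective w
    simp [e.map_adj_iff]
  rw [valency, h, Set.ncard_image_of_injective _ e.injective, valency]

lemma leafValency_iso {G : SimpleGraph α} {H : SimpleGraph β} (e : G ≃g H) (v : α) :
    leafValency H (e v) = leafValency G v := by
  have h : {w | H.Adj (e v) w ∧ valency H w = 1} = e '' {w | G.Adj v w ∧ valency G w = 1} := by
    ext w
    obtain ⟨w, rfl⟩ := e.surjective w
    simp [e.map_adj_iff, valency_iso]
  rw [leafValency, h, Set.ncard_image_of_injective _ e.injective, leafValency]

variable {G : SimpleGraph α} {H : SimpleGraph β} {a : α} {b : β}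

lemma neighborSet_joinGraph_inl :
    (joinGraph G H a b).neighborSet (Sum.inl a) =
      insert (Sum.inr b) (Sum.inl '' G.neighborSet a) := by
  ext (x | x) <;> simp

lemma neighborSet_joinGraph_inl_of_ne {x : α} (hx : x ≠ a) :
    (joinGraph G H a b).neighborSet (Sum.inl x) = Sum.inl '' G.neighborSet x := by
  ext (y | y) <;> simp [hx]

lemma neighborSet_joinGraph_inr :
    (joinGraph G H a b).neighborSet (Sum.inr b) =
      insert (Sum.inl a) (Sum.inr '' H.neighborSet b) := by
  ext (x | x) <;> simp

variable [Finite α] [Finite β]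

lemma valency_joinGraph_inl :
    valency (joinGraph G H a b) (Sum.inl a) = valency G a + 1 := by
  rw [valency, neighborSet_joinGraph_inl, Set.ncard_insert_of_notMem (by simp),
    Set.ncard_image_of_injective _ Sum.inl_injective, valency]

lemma valency_joinGraph_inl_of_ne {x : α} (hx : x ≠ a) :
    valency (joinGraph G H a b) (Sum.inl x) = valency G x := by
  rw [valency, neighborSet_joinGraph_inl_of_ne hx,
    Set.ncard_image_of_injective _ Sum.inl_injective, valency]

lemma valency_joinGraph_inr :
    valency (joinGraph G H a b) (Sum.inr b) = valency H b + 1 := by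
  rw [valency, neighborSet_joinGraph_inr, Set.ncard_insert_of_notMem (by simp),
    Set.ncard_image_of_injective _ Sum.inr_injective, valency]

lemma leafValency_joinGraph_inl :
    leafValency (joinGraph G H a b) (Sum.inl a) =
      leafValency G a + if valency H b = 0 then 1 else 0 := by
  have h : ∀ x, G.Adj a x → valency (joinGraph G H a b) (Sum.inl x) = valency G x :=
    fun x hx => valency_joinGraph_inl_of_ne hx.ne'
  split_ifs with hb
  · have : {w | (joinGraph G H a b).Adj (Sum.inl a) w ∧ valency (joinGraph G H a b) w = 1} =
        insert (Sum.inr b) (Sum.inl '' {w | G.Adj a w ∧ valency G w = 1}) := by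
      ext (x | x)
      · simp only [Set.mem_ofPred_eq, joinGraph_adj_inl_inl, Set.mem_insert_iff, reduceCtorEq,
          Set.mem_image, Sum.inl.injEq, exists_eq_right, false_or]
        exact and_congr_right fun hx => by rw [h x hx]
      · simp only [Set.mem_ofPred_eq, joinGraph_adj_inl_inr, true_and, Set.mem_insert_iff,
          Sum.inr.injEq, Set.mem_image, reduceCtorEq, and_false, exists_false, or_false,
          and_iff_left_iff_imp]
        rintro rfl
        rw [valency_joinGraph_inr, hb]
    rw [leafValency, this, Set.ncard_insert_of_notMem (by simp),
      Set.ncard_image_of_injective _ Sum.inl_injective, leafValency]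
  · have : {w | (joinGraph G H a b).Adj (Sum.inl a) w ∧ valency (joinGraph G H a b) w = 1} =
        Sum.inl '' {w | G.Adj a w ∧ valency G w = 1} := by
      ext (x | x)
      · simp only [Set.mem_ofPred_eq, joinGraph_adj_inl_inl,
          Set.mem_image, Sum.inl.injEq, exists_eq_right]
        exact and_congr_right fun hx => by rw [h x hx]
      · simp only [Set.mem_ofPred_eq, joinGraph_adj_inl_inr, true_and,
          Set.mem_image, reduceCtorEq, and_false, exists_false, iff_false, not_and]
        rintro rfl
        rw [valency_joinGraph_inr]
        omega
    rw [leafValency, this, Set.ncard_image_of_injective _ Sum.inl_injective, leafValency,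
      add_zero]

end Degree

namespace RT

lemma not_adj_leaf (x y : Vert leaf) : ¬ (graph leaf).Adj x y := by simp [graph]

lemma valency_root (us : List RT) : valency (graph (mk us)) (root (mk us)) = us.length := by
  induction us with
  | nil =>
    have : (graph (mk [])).neighborSet (root (mk [])) = ∅ := by
      refine Set.eq_empty_of_forall_notMem fun x hx => ?_
      exact not_adj_leaf (root leaf) x hx
    simp [valency, this]
  | cons u us ih =>
    have := valency_joinGraph_inl (G := graph (mk us)) (H := graph u) (a := root (mk us))
      (b := root u)
    rw [ih] at this
    exact this

lemma leafValency_root (us : List RT) :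
    leafValency (graph (mk us)) (root (mk us)) = us.countP isLeaf := by
  induction us with
  | nil =>
    have : {w | (graph (mk [])).Adj (root (mk [])) w ∧ valency (graph (mk [])) w = 1} = ∅ := by
      refine Set.eq_empty_of_forall_notMem fun x hx => ?_
      exact not_adj_leaf (root leaf) x hx.1
    simp [leafValency, this]
  | cons u us ih =>
    have h := leafValency_joinGraph_inl (G := graph (mk us)) (H := graph u) (a := root (mk us))
      (b := root u)
    have hu : valency (graph u) (root u) = 0 ↔ isLeaf u = true := by
      obtain ⟨vs, rfl⟩ := exists_eq_mk u
      rw [valency_root]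
      cases vs <;> simp [mk, isLeaf]
    rw [ih] at h
    rw [List.countP_cons]
    simp only [hu] at h
    exact h

end RT

end OptimalTree

namespace OptimalTree

open Polynomial SimpleGraph

namespace RT

/-! ### Degrees and leading coefficients of matching polynomials -/

/-- The number of maximum matchings. -/
noncomputable def num (t : RT) : ℕ := (P t).leadingCoeff

/-- The root is not covered by some maximum matching. -/
def RootA (t : RT) : Prop := (Q t).natDegree = (P t).natDegree

lemma numMaximumMatchings_graph (t : RT) : numMaximumMatchings (graph t) = num t :=
  numMaximumMatchings_eq _

lemma isTypeA_root (t : RT) : IsTypeA (graph t) (root t) ↔ RootA t := isTypeA_iff _ _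

lemma P_ne_zero (t : RT) : P t ≠ 0 := matchingPoly_ne_zero _ _

lemma Q_ne_zero (t : RT) : Q t ≠ 0 := matchingPoly_ne_zero _ _

lemma natDegree_Q_le (t : RT) : (Q t).natDegree ≤ (P t).natDegree := natDegree_matchingPoly_le _ _

lemma natDegree_add {p q : ℕ[X]} : (p + q).natDegree = max p.natDegree q.natDegree := by
  refine le_antisymm (natDegree_add_le _ _) (max_le ?_ ?_)
  · by_cases hp : p = 0
    · simp [hp]
    · refine le_natDegree_of_ne_zero ?_
      have : p.coeff p.natDegree ≠ 0 := leadingCoeff_ne_zero.2 hp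
      rw [coeff_add]
      omega
  · by_cases hq : q = 0
    · simp [hq]
    · refine le_natDegree_of_ne_zero ?_
      have : q.coeff q.natDegree ≠ 0 := leadingCoeff_ne_zero.2 hq
      rw [coeff_add]
      omega

lemma natDegree_PP (t u : RT) : (P t * P u).natDegree = (P t).natDegree + (P u).natDegree :=
  natDegree_mul (P_ne_zero t) (P_ne_zero u)

lemma natDegree_XQQ (t u : RT) :
    (X * (Q t * Q u)).natDegree = (Q t).natDegree + (Q u).natDegree + 1 := by
  rw [natDegree_X_mul (mul_ne_zero (Q_ne_zero t) (Q_ne_zero u)),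
    natDegree_mul (Q_ne_zero t) (Q_ne_zero u)]

lemma natDegree_P_join (t u : RT) : (P (join t u)).natDegree =
    max ((P t).natDegree + (P u).natDegree) ((Q t).natDegree + (Q u).natDegree + 1) := by
  rw [P_join, natDegree_add, natDegree_PP, natDegree_XQQ]

lemma natDegree_Q_join (t u : RT) :
    (Q (join t u)).natDegree = (Q t).natDegree + (P u).natDegree := by
  rw [Q_join, natDegree_mul (Q_ne_zero t) (P_ne_zero u)]

/-- Freeing the root costs at most one edge of a matching. -/
lemma natDegree_P_le (t : RT) : (P t).natDegree ≤ (Q t).natDegree + 1 := by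
  induction t with
  | leaf => simp
  | join t u iht _ =>
    rw [natDegree_P_join, natDegree_Q_join]
    have := natDegree_Q_le u
    omega

lemma natDegree_Q_of_not_rootA {t : RT} (h : ¬ RootA t) :
    (P t).natDegree = (Q t).natDegree + 1 := by
  have h1 := natDegree_P_le t
  have h2 := natDegree_Q_le t
  unfold RootA at h
  omega

lemma rootA_leaf : RootA leaf := by simp [RootA]

/-- If both roots are of type A, the joining edge enlarges the matching and every maximum matching
uses it. If `u` has a root of type B, the edge brings no gain and the root of `t` keeps its type. -/
lemma rootA_join_iff (t u : RT) : RootA (join t u) ↔ RootA t ∧ ¬ RootA u := by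
  unfold RootA
  rw [natDegree_P_join, natDegree_Q_join]
  have h1 := natDegree_P_le t
  have h2 := natDegree_Q_le t
  have h3 := natDegree_P_le u
  have h4 := natDegree_Q_le u
  omega

/-- Using an edge between two roots of type B loses one edge on each side and gains only one, so no
maximum matching contains it. -/
lemma num_join_BB {t u : RT} (ht : ¬ RootA t) (hu : ¬ RootA u) :
    num (join t u) = num t * num u := by
  have h1 := natDegree_Q_of_not_rootA ht
  have h2 := natDegree_Q_of_not_rootA hu
  rw [num, P_join, add_comm, leadingCoeff_add_of_degree_lt, leadingCoeff_mul, num, num]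
  refine degree_lt_degree ?_
  rw [natDegree_PP, natDegree_XQQ]
  omega

/-- Between a root of type A and one of type B the loss and the gain are equal, so the matchings
through the joining edge add to the product. -/
lemma num_join_AB_lt {t u : RT} (ht : RootA t) (hu : ¬ RootA u) :
    num t * num u < num (join t u) := by
  have h1 : (Q t).natDegree = (P t).natDegree := ht
  have h2 := natDegree_Q_of_not_rootA hu
  unfold num
  rw [P_join, leadingCoeff_add_of_degree_eq, leadingCoeff_mul, leadingCoeff_mul,
    leadingCoeff_mul, leadingCoeff_X, one_mul]
  · have : 0 < (Q t).leadingCoeff * (Q u).leadingCoeff :=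
      Nat.pos_of_ne_zero (mul_ne_zero (leadingCoeff_ne_zero.2 (Q_ne_zero t))
        (leadingCoeff_ne_zero.2 (Q_ne_zero u)))
    omega
  · rw [degree_eq_natDegree (mul_ne_zero (P_ne_zero t) (P_ne_zero u)),
      degree_eq_natDegree (mul_ne_zero X_ne_zero (mul_ne_zero (Q_ne_zero t) (Q_ne_zero u))),
      natDegree_PP, natDegree_XQQ]
    congr 1
    omega
  · intro h
    have h3 := leadingCoeff_ne_zero.2 (mul_ne_zero (P_ne_zero t) (P_ne_zero u))
    omega

lemma P_eq_of_iso {t u : RT} (e : graph t ≃g graph u) : P t = P u := by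
  have := matchingPoly_iso e ∅
  rwa [Set.preimage_empty] at this

lemma num_eq_of_iso {t u : RT} (e : graph t ≃g graph u) : num t = num u := by
  rw [num, num, P_eq_of_iso e]

lemma size_eq_of_iso {t u : RT} (e : graph t ≃g graph u) : size t = size u := by
  rw [← card_vert, ← card_vert, Fintype.card_congr e.toEquiv]

/-- A rooted tree of the largest number of maximum matchings for its size. -/
def Opt (t : RT) : Prop := ∀ u, size u = size t → num u ≤ num t

/-! ### Perfect matchings -/

/-- A perfect matching of a tree is unique; the induction carries along the matchings that miss the
root only. -/
lemma two_natDegree_le (t : RT) : 2 * (P t).natDegree ≤ size t ∧ 2 * (Q t).natDegree + 1 ≤ size t ∧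
    (2 * (P t).natDegree = size t → (P t).leadingCoeff = 1) ∧
    (2 * (Q t).natDegree + 1 = size t → (Q t).leadingCoeff = 1) := by
  induction t with
  | leaf => simp [size]
  | join t u iht ihu =>
    obtain ⟨t1, t2, t3, t4⟩ := iht
    obtain ⟨u1, u2, u3, u4⟩ := ihu
    rw [natDegree_P_join, natDegree_Q_join, size]
    refine ⟨by omega, by omega, fun h => ?_, fun h => ?_⟩
    · rcases lt_or_ge ((P t).natDegree + (P u).natDegree) ((Q t).natDegree + (Q u).natDegree + 1)
        with h1 | h1
      · rw [P_join, leadingCoeff_add_of_degree_lt, leadingCoeff_mul, leadingCoeff_mul,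
          leadingCoeff_X, t4 (by omega), u4 (by omega), one_mul, one_mul]
        refine degree_lt_degree ?_
        rw [natDegree_PP, natDegree_XQQ]
        omega
      · rw [P_join, add_comm, leadingCoeff_add_of_degree_lt, leadingCoeff_mul, t3 (by omega),
          u3 (by omega), one_mul]
        refine degree_lt_degree ?_
        rw [natDegree_PP, natDegree_XQQ]
        omega
    · rw [Q_join, leadingCoeff_mul, t4 (by omega), u3 (by omega), one_mul]

end RT

lemma two_mul_natDegree_eq {α : Type*} [Fintype α] {G : SimpleGraph α} (h : ∀ v, ¬ IsTypeA G v) :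
    2 * (matchingPoly G ∅).natDegree = Fintype.card α := by
  classical
  obtain ⟨M, hM, hc⟩ := exists_card_eq_natDegree G ∅
  have hM' := mem_matchingSets.1 hM
  have hcov : M.biUnion Sym2.toFinset = Finset.univ := by
    ext v
    simp only [Finset.mem_biUnion, Sym2.mem_toFinset, Finset.mem_univ, iff_true]
    by_contra hv
    refine h v ⟨edgesSubgraph hM'.1, isMaximumMatching_iff.2 ⟨edgesSubgraph_isMatching hM', ?_⟩, hv⟩
    rw [edgesSubgraph_edgeSet, Set.ncard_coe_finset, hc]
  rw [← Finset.card_univ, ← hcov, Finset.card_biUnion, Finset.sum_congr rfl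
    (fun e he => Sym2.card_toFinset_of_not_isDiag e (G.not_isDiag_of_mem_edgeSet (hM'.1 e he)))]
  · simp [hc, mul_comm]
  · intro e he f hf hef
    rw [Function.onFun, Finset.disjoint_left]
    intro v hv hv'
    exact hef (hM'.2.1 e he f hf v (Sym2.mem_toFinset.1 hv) (Sym2.mem_toFinset.1 hv'))

namespace RT

lemma exists_rootA_or (t : RT) :
    (∃ u, Nonempty (graph t ≃g graph u) ∧ RootA u) ∨ 2 * (P t).natDegree = size t := by
  by_cases h : ∃ v, IsTypeA (graph t) v
  · obtain ⟨v, hv⟩ := h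
    obtain ⟨u, e, he⟩ := exists_iso_of_isTree (graph_isTree t) v
    refine Or.inl ⟨u, ⟨e.symm⟩, ?_⟩
    rw [← isTypeA_root, ← isTypeA_iso e, he]
    exact hv
  · push Not at h
    right
    rw [P, two_mul_natDegree_eq h, card_vert]

/-! ### Colourings -/

mutual
/-- The number of matchings covering all vertices of the second colour. -/
def S : Bool → RT → ℕ
  | c, leaf => if c then 1 else 0
  | c, join t u => S c t * S (!c) u + Z c t * Z (!c) u

/-- The number of matchings covering all vertices of the second colour but the root, and not
covering the root. -/
def Z : Bool → RT → ℕ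
  | _, leaf => 1
  | c, join t u => Z c t * S (!c) u
end

/-- The number of vertices of the second colour, apart from the root. -/
def numB : Bool → RT → ℕ
  | _, leaf => 0
  | c, join t u => numB c t + numB (!c) u + if c then 1 else 0

/-- Every edge has exactly one end of the second colour, so a matching has at most as many edges as
there are such vertices, with equality when it covers them all. The term `if c then 0 else 1`
accounts for the root, which `numB` leaves out. -/
lemma coeff_PQ (t : RT) : ∀ c : Bool,
    (P t).natDegree ≤ numB c t + (if c then 0 else 1) ∧ (Q t).natDegree ≤ numB c t ∧
    (P t).coeff (numB c t + if c then 0 else 1) = S c t ∧ (Q t).coeff (numB c t) = Z c t := by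
  induction t with
  | leaf => intro c; cases c <;> simp [numB, S, Z, coeff_one]
  | join t u iht ihu =>
    intro c
    obtain ⟨t1, t2, t3, t4⟩ := iht c
    obtain ⟨u1, u2, u3, u4⟩ := ihu (!c)
    rw [natDegree_P_join, natDegree_Q_join, numB, S, Z]
    have h1 : (P t * P u).coeff ((numB c t + if c then 0 else 1) +
        (numB (!c) u + if !c then 0 else 1)) = S c t * S (!c) u := by
      rw [coeff_mul_add_eq_of_natDegree_le t1 u1, t3, u3]
    have h2 : (Q t * Q u).coeff (numB c t + numB (!c) u) = Z c t * Z (!c) u := by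
      rw [coeff_mul_add_eq_of_natDegree_le t2 u2, t4, u4]
    have h3 : (Q t * P u).coeff (numB c t + (numB (!c) u + if !c then 0 else 1)) =
        Z c t * S (!c) u := by
      rw [coeff_mul_add_eq_of_natDegree_le t2 u1, t4, u3]
    rcases c with _ | _ <;>
      simp only [Bool.not_false, Bool.not_true, Bool.false_eq_true, if_false, if_true,
        Nat.add_zero] at *
    · refine ⟨by omega, by omega, ?_, ?_⟩
      · rw [P_join, coeff_add, coeff_X_mul, h2, ← h1]
        congr 2; omega
      · rw [Q_join, ← h3]
    · refine ⟨by omega, by omega, ?_, ?_⟩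
      · rw [P_join, coeff_add, coeff_X_mul, h2, ← h1, add_assoc]
      · rw [Q_join, ← h3, add_assoc]

/-- Either no matching covers the colour class, or those that cover it are exactly the maximum
matchings. Competitors can thus be evaluated without knowing the types of their vertices. -/
lemma S_le_num (c : Bool) (t : RT) : S c t ≤ num t := by
  obtain ⟨h1, -, h3, -⟩ := coeff_PQ t c
  by_cases h : S c t = 0
  · omega
  · have : (P t).natDegree = numB c t + if c then 0 else 1 :=
      le_antisymm h1 (le_natDegree_of_ne_zero (by rw [h3]; exact h))
    rw [num, leadingCoeff, this, h3]

lemma num_eq_S {c : Bool} {t : RT} (h : S c t ≠ 0) : num t = S c t := by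
  obtain ⟨h1, -, h3, -⟩ := coeff_PQ t c
  have : (P t).natDegree = numB c t + if c then 0 else 1 :=
    le_antisymm h1 (le_natDegree_of_ne_zero (by rw [h3]; exact h))
  rw [num, leadingCoeff, this, h3]

/-! ### The types of adjacent vertices of optimal trees -/

lemma S_star (n : ℕ) : S false (mk (List.replicate n leaf)) = n ∧
    Z false (mk (List.replicate n leaf)) = 1 := by
  induction n with
  | zero => simp [mk, S, Z]
  | succ n ih => simp [List.replicate_succ, mk, S, Z, ih]

lemma sub_one_le_num {t : RT} (h : Opt t) : size t - 1 ≤ num t := by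
  have h1 : size (mk (List.replicate (size t - 1) leaf)) = size t := by
    have := size_pos t
    rw [size_mk]
    simp [size]
    omega
  refine le_trans ?_ (h _ h1)
  refine le_trans (le_of_eq ?_) (S_le_num false _)
  exact (S_star _).1.symm

/-- If one side has a vertex of type A, rehanging that side there gives strictly more. Otherwise
both sides have perfect matchings, and the only maximum matching of the tree competes with the star.
-/
lemma Opt.not_BB {t u : RT} (h : Opt (join t u)) : RootA t ∨ RootA u := by
  by_contra! hc
  obtain ⟨ht, hu⟩ := hc
  have hnum := num_join_BB ht hu
  rcases exists_rootA_or t with ⟨t', ⟨e⟩, ht'⟩ | h1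
  · have h2 := h (join t' u) (by rw [size, size, size_eq_of_iso e])
    have h3 := num_join_AB_lt ht' hu
    rw [num_eq_of_iso e] at hnum
    omega
  · rcases exists_rootA_or u with ⟨u', ⟨e⟩, hu'⟩ | h2
    · have h2 := h (join u' t) (by rw [size, size, size_eq_of_iso e, add_comm])
      have h3 := num_join_AB_lt hu' ht
      rw [num_eq_of_iso e, mul_comm] at hnum
      omega
    · have h3 := sub_one_le_num h
      have h4 : num t = 1 := (two_natDegree_le t).2.2.1 h1
      have h5 : num u = 1 := (two_natDegree_le u).2.2.1 h2
      have h6 := natDegree_Q_of_not_rootA ht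
      have h7 := natDegree_Q_of_not_rootA hu
      rw [hnum, h4, h5, size] at h3
      omega

lemma Opt.congr {t u : RT} (h : Opt t) (e : graph t ≃g graph u) : Opt u := by
  intro v hv
  rw [← num_eq_of_iso e]
  exact h v (by rw [hv, size_eq_of_iso e])

/-- If both ends had type A, one of the halves, say `join t₁ t₂`, would have a further branch `t₂`
with root of type B. Across the edge to `t₂` both roots would then be of type B, against
`Opt.not_BB`. -/
lemma Opt.rootA_iff {t u : RT} (h : Opt (join t u)) (hs : size (join t u) ≠ 2) :
    RootA t ↔ ¬ RootA u := by
  constructor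
  · intro ht hu
    have key : ∀ t₁ t₂ u : RT, Opt (join (join t₁ t₂) u) → RootA (join t₁ t₂) → RootA u →
        False := by
      intro t₁ t₂ u h ht hu
      obtain ⟨e, -⟩ := REquiv.join_right_comm t₁ t₂ u
      rw [rootA_join_iff] at ht
      rcases (h.congr e).not_BB with h1 | h1
      · rw [rootA_join_iff] at h1
        exact h1.2 hu
      · exact ht.2 h1
    cases t with
    | join t₁ t₂ => exact key t₁ t₂ u h ht hu
    | leaf =>
      cases u with
      | join u₁ u₂ => exact key u₁ u₂ leaf (h.congr (joinComm _ _)) hu ht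
      | leaf => simp [size] at hs
  · intro hu
    exact h.not_BB.resolve_right hu

end RT

end OptimalTree

namespace OptimalTree

open Polynomial SimpleGraph

/-! ### Rootings of optimal trees -/

section Rep

open RT

variable {V : Type*} [Fintype V] {G : SimpleGraph V}

lemma IsOptimalTree.opt (hG : IsOptimalTree G) {t : RT} (e : graph t ≃g G) : Opt t := by
  intro u hu
  have hc : Fintype.card (Vert u) = Fintype.card V := by
    rw [card_vert, hu, ← card_vert, Fintype.card_congr e.toEquiv]
  have f := Iso.map (Fintype.equivOfCardEq hc) (graph u)
  have h := hG.2 _ (f.isTree_iff.1 (graph_isTree u))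
  rwa [← numMaximumMatchings_iso f, ← numMaximumMatchings_iso e, numMaximumMatchings_graph,
    numMaximumMatchings_graph] at h

lemma card_eq_size {t : RT} (e : graph t ≃g G) : Fintype.card V = size t := by
  rw [← card_vert, Fintype.card_congr e.toEquiv]

/-- The branches of `G` at the vertex `v` are the given rooted trees. -/
def RepAt (G : SimpleGraph V) (v : V) (us : List RT) : Prop :=
  ∃ e : graph (mk us) ≃g G, e (root (mk us)) = v

/-- The branches of `G` at some vertex are the given rooted trees; the vertex is of type A if and
only if `c` is true. -/
def Rep (G : SimpleGraph V) (c : Bool) (us : List RT) : Prop :=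
  ∃ v, RepAt G v us ∧ (IsTypeA G v ↔ c = true)

lemma exists_repAt (hG : G.IsTree) (v : V) : ∃ us, RepAt G v us := by
  obtain ⟨t, e, he⟩ := exists_iso_of_isTree hG v
  obtain ⟨us, rfl⟩ := exists_eq_mk t
  exact ⟨us, e, he⟩

lemma RepAt.valency {v : V} {us : List RT} (h : RepAt G v us) : valency G v = us.length := by
  obtain ⟨e, rfl⟩ := h
  rw [valency_iso, valency_root]

lemma RepAt.leafValency {v : V} {us : List RT} (h : RepAt G v us) :
    leafValency G v = us.countP isLeaf := by
  obtain ⟨e, rfl⟩ := h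
  rw [leafValency_iso, leafValency_root]

lemma RepAt.card {v : V} {us : List RT} (h : RepAt G v us) : Fintype.card V = size (mk us) := by
  obtain ⟨e, rfl⟩ := h
  rw [← card_vert, Fintype.card_congr e.toEquiv]

lemma Rep.card {c : Bool} {us : List RT} (h : Rep G c us) : Fintype.card V = size (mk us) := by
  obtain ⟨v, h, -⟩ := h
  exact h.card

lemma Rep.perm {c : Bool} {us vs : List RT} (h : Rep G c us) (hp : us.Perm vs) : Rep G c vs := by
  obtain ⟨v, ⟨e, he⟩, hv⟩ := h
  obtain ⟨f, hf⟩ := REquiv.mk_perm hp.symm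
  exact ⟨v, ⟨f.trans e, by rw [RelIso.trans_apply, hf, he]⟩, hv⟩

lemma isTypeA_root_join {t u : RT} (e : graph (join t u) ≃g G) {v : V} (h : e (root (join t u)) = v) :
    IsTypeA G v ↔ RootA t ∧ ¬ RootA u := by
  subst h
  rw [← rootA_join_iff t u, ← isTypeA_root, ← isTypeA_iso e]

lemma isTypeA_iff_of_adj (hG : IsOptimalTree G) (hn : Fintype.card V ≠ 2) {v w : V}
    (h : G.Adj v w) : IsTypeA G v ↔ ¬ IsTypeA G w := by
  obtain ⟨t, u, e, f, he, hf⟩ := exists_join_iso_of_adj hG.1 h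
  have hs : size (join t u) ≠ 2 := fun hs => hn ((card_eq_size e).trans hs)
  have h1 := (hG.opt e).rootA_iff hs
  have h2 := isTypeA_root_join e he
  have h3 := isTypeA_root_join f hf
  clear he hf e f
  rw [h2, h3, h1]
  simp only [not_not, and_self]

lemma bipartitionCondition (hG : IsOptimalTree G) (hn : Fintype.card V ≠ 2) :
    BipartitionCondition G := by
  refine ⟨?_, fun v w h => ?_⟩
  · rw [Set.disjoint_left]
    exact fun v h h' => h' h
  · have h1 := isTypeA_iff_of_adj hG hn h
    simp only [Set.mem_ofPred_eq, IsTypeB]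
    tauto

/-- Moves the viewpoint across the edge to the first branch; the old vertex, with its remaining
branches, becomes a branch itself. -/
lemma Rep.rotate (hG : IsOptimalTree G) (hn : Fintype.card V ≠ 2) {c : Bool} {ws us : List RT}
    (h : Rep G c (mk ws :: us)) : Rep G (!c) (mk us :: ws) := by
  obtain ⟨v, ⟨e, he⟩, hv⟩ := h
  let f : graph (mk (mk us :: ws)) ≃g G := (joinComm (mk ws) (mk us)).trans e
  refine ⟨f (root _), ⟨f, rfl⟩, ?_⟩
  have hadj : G.Adj v (f (root _)) := by
    rw [← he]
    refine e.map_adj_iff.2 ?_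
    exact joinGraph_adj_inl_inr.2 ⟨rfl, rfl⟩
  have := isTypeA_iff_of_adj hG hn hadj
  rw [hv] at this
  cases c <;> simp_all

lemma Rep.eq_true_of_singleton (hG : IsOptimalTree G) (hn : Fintype.card V ≠ 2) {c : Bool}
    {x : RT} (h : Rep G c [x]) : c = true := by
  obtain ⟨v, ⟨e, he⟩, hv⟩ := h
  rw [← hv, ← he, isTypeA_iso, isTypeA_root]
  have hs : size (join leaf x) ≠ 2 := by
    have := Fintype.card_congr e.toEquiv
    rw [card_vert] at this
    change size (join leaf x) = _ at this
    rwa [this]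
  have h1 := (hG.opt (t := join leaf x) e).rootA_iff hs
  exact (rootA_join_iff leaf x).2 ⟨rootA_leaf, h1.1 rootA_leaf⟩

lemma SZ_mk_pos {d : Bool} {ws : List RT} (h : ∀ w ∈ ws, 0 < S (!d) w ∧ 0 < Z (!d) w) :
    0 < Z d (mk ws) ∧ (d = true ∨ ws ≠ [] → 0 < S d (mk ws)) := by
  induction ws with
  | nil =>
    simp only [RT.mk, S, Z]
    cases d <;> simp
  | cons w ws ih =>
    obtain ⟨h1, h2⟩ := h w (by simp)
    obtain ⟨h3, -⟩ := ih fun w hw => h w (by simp [hw])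
    rw [RT.mk, S, Z]
    exact ⟨Nat.mul_pos h3 h1, fun _ => Nat.add_pos_right _ (Nat.mul_pos h3 h2)⟩

/-- Induction from the leaves inwards. The only branch with value zero would be a single vertex of
type B, but leaves have type A. -/
lemma Rep.SZ_pos (hG : IsOptimalTree G) (hn : Fintype.card V ≠ 2) :
    ∀ (n : ℕ) {c : Bool} {x : RT} {us : List RT}, size x = n → Rep G c (x :: us) →
      0 < S (!c) x ∧ 0 < Z (!c) x := by
  intro n
  induction n using Nat.strong_induction_on with
  | _ n ih =>
    intro c x us hx h
    obtain ⟨ws, rfl⟩ := exists_eq_mk x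
    have hr := h.rotate hG hn
    have key : ∀ w ∈ ws, 0 < S (!!c) w ∧ 0 < Z (!!c) w := by
      intro w hw
      have hlt : size w < n := by
        rw [← hx, size_mk]
        have := List.single_le_sum (l := ws.map size) (by simp) (size w)
          (List.mem_map.2 ⟨w, hw, rfl⟩)
        omega
      obtain ⟨l₁, l₂, rfl⟩ := List.append_of_mem hw
      refine ih _ hlt (us := mk us :: (l₁ ++ l₂)) rfl (hr.perm ?_)
      exact (List.Perm.cons _ List.perm_middle).trans (List.Perm.swap _ _ _)
    have h1 := SZ_mk_pos key
    refine ⟨h1.2 ?_, h1.1⟩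
    by_contra! hc
    obtain ⟨hc1, rfl⟩ := hc
    exact hc1 (hr.eq_true_of_singleton hG hn)

lemma Rep.S_pos (hG : IsOptimalTree G) (hn : Fintype.card V ≠ 2) (hn1 : Fintype.card V ≠ 1)
    {c : Bool} {us : List RT} (h : Rep G c us) : 0 < S c (mk us) := by
  refine (SZ_mk_pos fun w hw => ?_).2 (Or.inr ?_)
  · obtain ⟨l₁, l₂, rfl⟩ := List.append_of_mem hw
    exact (h.perm List.perm_middle).SZ_pos hG hn _ rfl
  · rintro rfl
    exact hn1 h.card

lemma Rep.num_eq (hG : IsOptimalTree G) (hn : Fintype.card V ≠ 2) (hn1 : Fintype.card V ≠ 1)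
    {c : Bool} {us : List RT} (h : Rep G c us) : numMaximumMatchings G = S c (mk us) := by
  have h1 := h.S_pos hG hn hn1
  obtain ⟨v, ⟨e, he⟩, hv⟩ := h
  rw [← numMaximumMatchings_iso e, numMaximumMatchings_graph, num_eq_S h1.ne']

/-- The working form of optimality: any competitor `mk vs` of the same order, with either colour `d`
at its root, gives an inequality. -/
lemma Rep.S_le (hG : IsOptimalTree G) (hn : Fintype.card V ≠ 2) (hn1 : Fintype.card V ≠ 1)
    {c d : Bool} {us vs : List RT} (h : Rep G c us) (hs : size (mk vs) = size (mk us)) :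
    S d (mk vs) ≤ S c (mk us) := by
  rw [← h.num_eq hG hn hn1]
  obtain ⟨v, ⟨e, he⟩, hv⟩ := h
  rw [← numMaximumMatchings_iso e, numMaximumMatchings_graph]
  exact (S_le_num d _).trans (hG.opt e _ hs)

end Rep

/-! ### Canonical numberings -/

section Numbering

open RT

/-- The vertices numbered from `k` on, the left part before the right part. -/
def RT.number : (t : RT) → ℕ → Vert t → ℕ
  | leaf, k, _ => k
  | join t u, k, x => Sum.elim (number t k) (number u (k + size t)) x

/-- The edges in the numbering from `k` on. -/
def RT.edgeList : RT → ℕ → List (ℕ × ℕ)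
  | leaf, _ => []
  | join t u, k => (k, k + size t) :: (edgeList t k ++ edgeList u (k + size t))

namespace RT

lemma number_root (t : RT) : ∀ k, number t k (root t) = k := by
  induction t with
  | leaf => intro k; rfl
  | join t u iht _ => exact iht

lemma number_mem (t : RT) : ∀ k x, k ≤ number t k x ∧ number t k x < k + size t := by
  induction t with
  | leaf => intro k x; simp [number, size]
  | join t u iht ihu =>
    rintro k (x | x)
    · have := iht k x
      simp only [number, size, Sum.elim_inl]
      omega
    · have := ihu (k + size t) x
      simp only [number, size, Sum.elim_inr]
      omega

lemma number_injective (t : RT) : ∀ k, Function.Injective (number t k) := by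
  induction t with
  | leaf => exact fun k x y _ => rfl
  | join t u iht ihu =>
    rintro k (x | x) (y | y) h
    · exact congrArg Sum.inl (iht k h)
    · have h1 := number_mem t k x
      have h2 := number_mem u (k + size t) y
      change number t k x = number u (k + size t) y at h
      omega
    · have h1 := number_mem t k y
      have h2 := number_mem u (k + size t) x
      change number u (k + size t) x = number t k y at h
      omega
    · exact congrArg Sum.inr (ihu _ h)

lemma edgeList_mem (t : RT) : ∀ k, ∀ p ∈ edgeList t k,
    k ≤ p.1 ∧ p.1 < k + size t ∧ k ≤ p.2 ∧ p.2 < k + size t := by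
  induction t with
  | leaf => simp [edgeList]
  | join t u iht ihu =>
    intro k p hp
    have h1 := size_pos t
    have h2 := size_pos u
    simp only [edgeList, List.mem_cons, List.mem_append] at hp
    rw [size]
    rcases hp with rfl | hp | hp
    · simp only; omega
    · have := iht k p hp; omega
    · have := ihu _ p hp; omega

lemma graph_adj_iff (t : RT) : ∀ k x y, (graph t).Adj x y ↔
    (number t k x, number t k y) ∈ edgeList t k ∨ (number t k y, number t k x) ∈ edgeList t k := by
  induction t with
  | leaf =>
    intro k x y
    simp [edgeList, not_adj_leaf]
  | join t u iht ihu =>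
    have key : ∀ k (x : Vert t) (y : Vert u), (x = root t ∧ y = root u) ↔
        (number t k x, number u (k + size t) y) ∈ edgeList (join t u) k ∨
        (number u (k + size t) y, number t k x) ∈ edgeList (join t u) k := by
      intro k x y
      have h1 := number_mem t k x
      have h2 := number_mem u (k + size t) y
      have h3 := edgeList_mem t k
      have h4 := edgeList_mem u (k + size t)
      have h5 := size_pos t
      constructor
      · rintro ⟨rfl, rfl⟩
        simp [edgeList, number_root]
      · simp only [edgeList, List.mem_cons, List.mem_append, Prod.mk.injEq]
        rintro ((⟨ha, hb⟩ | h | h) | (⟨ha, hb⟩ | h | h))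
        · exact ⟨number_injective t k (by rw [ha, number_root]),
            number_injective u (k + size t) (by rw [hb, number_root])⟩
        · have := h3 _ h; simp only at this; omega
        · have := h4 _ h; simp only at this; omega
        · omega
        · have := h3 _ h; simp only at this; omega
        · have := h4 _ h; simp only at this; omega
    rintro k (x | x) (y | y)
    · refine (joinGraph_adj_inl_inl.trans (iht k x y)).trans ?_
      have h1 := number_mem t k x
      have h2 := number_mem t k y
      have h4 := edgeList_mem u (k + size t)
      have e : ∀ a b, a < k + size t → b < k + size t → ((a, b) ∈ edgeList (join t u) k ↔
          (a, b) ∈ edgeList t k) := by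
        intro a b ha hb
        simp only [edgeList, List.mem_cons, List.mem_append, Prod.mk.injEq]
        refine ⟨?_, fun h => Or.inr (Or.inl h)⟩
        rintro (h | h | h)
        · omega
        · exact h
        · have := h4 _ h; simp only at this; omega
      simp only [number, Sum.elim_inl]
      rw [e _ _ h1.2 h2.2, e _ _ h2.2 h1.2]
    · exact joinGraph_adj_inl_inr.trans (key k x y)
    · exact (joinGraph_adj_inr_inl.trans (key k y x)).trans or_comm
    · refine (joinGraph_adj_inr_inr.trans (ihu (k + size t) x y)).trans ?_
      have h1 := number_mem u (k + size t) x
      have h2 := number_mem u (k + size t) y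
      have h4 := edgeList_mem t k
      have h5 := size_pos t
      have e : ∀ a b, k + size t ≤ a → k + size t ≤ b → ((a, b) ∈ edgeList (join t u) k ↔
          (a, b) ∈ edgeList u (k + size t)) := by
        intro a b ha hb
        simp only [edgeList, List.mem_cons, List.mem_append, Prod.mk.injEq]
        refine ⟨?_, fun h => Or.inr (Or.inr h)⟩
        rintro (h | h | h)
        · omega
        · have := h4 _ h; simp only at this; omega
        · exact h
      simp only [number, Sum.elim_inr]
      rw [e _ _ h1.1 h2.1, e _ _ h2.1 h1.1]

/-- The map `p`, with left inverse `q`, renames the canonical numbers to those of the given edge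
list; for a concrete tree all the hypotheses are decidable. -/
lemma nonempty_iso_ofEdges (t : RT) (n : ℕ) (l : List (ℕ × ℕ)) (p q : ℕ → ℕ) (hn : size t = n)
    (hp : ∀ i ∈ List.range n, p i < n ∧ q (p i) = i)
    (h₁ : ∀ e ∈ edgeList t 0, (p e.1, p e.2) ∈ l ∨ (p e.2, p e.1) ∈ l)
    (h₂ : ∀ e ∈ l, (e.1 < n ∧ e.2 < n ∧ e.1 ≠ e.2) ∧
      ((q e.1, q e.2) ∈ edgeList t 0 ∨ (q e.2, q e.1) ∈ edgeList t 0)) :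
    Nonempty (graph t ≃g ofEdges n l) := by
  have hlt : ∀ x, number t 0 x < n := fun x => by
    have := number_mem t 0 x
    omega
  have hpr : ∀ x, p (number t 0 x) < n ∧ q (p (number t 0 x)) = number t 0 x :=
    fun x => hp _ (List.mem_range.2 (hlt x))
  let f : Vert t → Fin n := fun x => ⟨p (number t 0 x), (hpr x).1⟩
  have hf : Function.Injective f := by
    intro x y h
    have h : p (number t 0 x) = p (number t 0 y) := congrArg Fin.val h
    refine number_injective t 0 ?_
    rw [← (hpr x).2, ← (hpr y).2, h]
  have hfb : Function.Bijective f :=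
    (Fintype.bijective_iff_injective_and_card f).2 ⟨hf, by rw [card_vert, hn, Fintype.card_fin]⟩
  have key : ∀ x y, (p (number t 0 x), p (number t 0 y)) ∈ l →
      (number t 0 x, number t 0 y) ∈ edgeList t 0 ∨ (number t 0 y, number t 0 x) ∈ edgeList t 0 := by
    intro x y h
    have := (h₂ _ h).2
    simp only [(hpr x).2, (hpr y).2] at this
    exact this
  refine ⟨⟨Equiv.ofBijective f hfb, ?_⟩⟩
  intro x y
  rw [graph_adj_iff t 0]
  simp only [ofEdges, fromRel_adj, Equiv.ofBijective_apply]
  constructor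
  · rintro ⟨-, h | h⟩
    · exact key x y h
    · exact (key y x h).symm
  · intro h
    refine ⟨?_, ?_⟩
    · intro hxy
      have hxy := hf hxy
      subst hxy
      have := (graph_adj_iff t 0 x x).2 h
      exact (graph t).irrefl this
    · rcases h with h | h
      · exact h₁ _ h
      · exact (h₁ _ h).symm

end RT

lemma Rep.isExceptional {V : Type*} [Fintype V] {G : SimpleGraph V} {c : Bool} {us : List RT}
    (h : Rep G c us) {n : ℕ} {l : List (ℕ × ℕ)} (hl : ⟨n, ofEdges n l⟩ ∈ exceptionalTrees)
    (p q : ℕ → ℕ) (hn : size (RT.mk us) = n)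
    (hp : ∀ i ∈ List.range n, p i < n ∧ q (p i) = i)
    (h₁ : ∀ e ∈ edgeList (RT.mk us) 0, (p e.1, p e.2) ∈ l ∨ (p e.2, p e.1) ∈ l)
    (h₂ : ∀ e ∈ l, (e.1 < n ∧ e.2 < n ∧ e.1 ≠ e.2) ∧
      ((q e.1, q e.2) ∈ edgeList (RT.mk us) 0 ∨ (q e.2, q e.1) ∈ edgeList (RT.mk us) 0)) :
    IsExceptional G := by
  obtain ⟨v, ⟨e, -⟩, -⟩ := h
  obtain ⟨f⟩ := nonempty_iso_ofEdges (RT.mk us) n l p q hn hp h₁ h₂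
  exact ⟨_, hl, ⟨e.symm.trans f⟩⟩

end Numbering

end OptimalTree

namespace OptimalTree
open RT
/-- A branch whose root has a single child, with the given branches. -/
def RT.N (ys : List RT) : RT := RT.mk [RT.mk ys]
-- Recognition of the twelve exceptional trees
section Exceptional
variable {V : Type*} [Fintype V] {G : SimpleGraph V}

lemma Rep.isExceptional_T2 {c : Bool} (h : Rep G c [leaf]) :
    IsExceptional G :=
  h.isExceptional (n := 2) (l := [(0, 1)]) (by simp [exceptionalTrees, T2])
    (fun i => [0, 1].getD i 0)
    (fun i => [0, 1].getD i 0)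
    rfl (by decide) (by decide) (by decide)

lemma Rep.isExceptional_T3 {c : Bool} (h : Rep G c [leaf, leaf]) :
    IsExceptional G :=
  h.isExceptional (n := 3) (l := [(0, 1), (0, 2)]) (by simp [exceptionalTrees, T3])
    (fun i => [0, 1, 2].getD i 0)
    (fun i => [0, 1, 2].getD i 0)
    rfl (by decide) (by decide) (by decide)

lemma Rep.isExceptional_T5 {c : Bool} (h : Rep G c [leaf, leaf, leaf, leaf]) :
    IsExceptional G :=
  h.isExceptional (n := 5) (l := [(0, 1), (0, 2), (0, 3), (0, 4)]) (by simp [exceptionalTrees, T5])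
    (fun i => [0, 1, 2, 3, 4].getD i 0)
    (fun i => [0, 1, 2, 3, 4].getD i 0)
    rfl (by decide) (by decide) (by decide)

lemma Rep.isExceptional_T6₁ {c : Bool} (h : Rep G c [leaf, leaf, leaf, leaf, leaf]) :
    IsExceptional G :=
  h.isExceptional (n := 6) (l := [(0, 1), (0, 2), (0, 3), (0, 4), (0, 5)]) (by simp [exceptionalTrees, T6₁])
    (fun i => [0, 1, 2, 3, 4, 5].getD i 0)
    (fun i => [0, 1, 2, 3, 4, 5].getD i 0)
    rfl (by decide) (by decide) (by decide)

lemma Rep.isExceptional_T6₂ {c : Bool} (h : Rep G c [leaf, leaf, N [leaf]]) :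
    IsExceptional G :=
  h.isExceptional (n := 6) (l := [(0, 1), (1, 2), (0, 3), (0, 4), (2, 5)]) (by simp [exceptionalTrees, T6₂])
    (fun i => [0, 1, 2, 5, 3, 4].getD i 0)
    (fun i => [0, 1, 2, 4, 5, 3].getD i 0)
    rfl (by decide) (by decide) (by decide)

lemma Rep.isExceptional_T8 {c : Bool} (h : Rep G c [leaf, leaf, leaf, N [leaf, leaf]]) :
    IsExceptional G :=
  h.isExceptional (n := 8) (l := [(0, 1), (1, 2), (0, 3), (0, 4), (0, 5), (2, 6), (2, 7)]) (by simp [exceptionalTrees, T8])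
    (fun i => [0, 1, 2, 6, 7, 3, 4, 5].getD i 0)
    (fun i => [0, 1, 2, 5, 6, 7, 3, 4].getD i 0)
    rfl (by decide) (by decide) (by decide)

lemma Rep.isExceptional_T9 {c : Bool} (h : Rep G c [leaf, leaf, leaf, N [leaf, leaf, leaf]]) :
    IsExceptional G :=
  h.isExceptional (n := 9) (l := [(0, 1), (1, 2), (0, 3), (0, 4), (0, 5), (2, 6), (2, 7), (2, 8)]) (by simp [exceptionalTrees, T9])
    (fun i => [0, 1, 2, 8, 6, 7, 3, 4, 5].getD i 0)
    (fun i => [0, 1, 2, 6, 7, 8, 4, 5, 3].getD i 0)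
    rfl (by decide) (by decide) (by decide)

lemma Rep.isExceptional_T10 {c : Bool} (h : Rep G c [leaf, leaf, N [leaf, N [leaf, leaf]]]) :
    IsExceptional G :=
  h.isExceptional (n := 10) (l := [(0, 1), (1, 2), (2, 3), (3, 4), (0, 5), (0, 6), (2, 7), (4, 8), (4, 9)]) (by simp [exceptionalTrees, T10])
    (fun i => [0, 1, 2, 3, 4, 8, 9, 7, 5, 6].getD i 0)
    (fun i => [0, 1, 2, 3, 4, 8, 9, 7, 5, 6].getD i 0)
    rfl (by decide) (by decide) (by decide)

lemma Rep.isExceptional_T12 {c : Bool} (h : Rep G c [leaf, leaf, leaf, N [leaf, leaf, N [leaf, leaf]]]) :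
    IsExceptional G :=
  h.isExceptional (n := 12) (l := [(0, 1), (1, 2), (2, 3), (3, 4), (0, 5), (0, 6), (0, 7), (2, 8), (2, 9), (4, 10), (4, 11)]) (by simp [exceptionalTrees, T12])
    (fun i => [0, 1, 2, 3, 4, 11, 10, 8, 9, 5, 6, 7].getD i 0)
    (fun i => [0, 1, 2, 3, 4, 9, 10, 11, 7, 8, 6, 5].getD i 0)
    rfl (by decide) (by decide) (by decide)

lemma Rep.isExceptional_T13 {c : Bool} (h : Rep G c [leaf, leaf, leaf, N [leaf, leaf, N [leaf, leaf, leaf]]]) :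
    IsExceptional G :=
  h.isExceptional (n := 13) (l := [(0, 1), (1, 2), (2, 3), (3, 4), (0, 5), (0, 6), (0, 7), (2, 8), (2, 9), (4, 10), (4, 11), (4, 12)]) (by simp [exceptionalTrees, T13])
    (fun i => [0, 1, 2, 3, 4, 11, 10, 12, 8, 9, 5, 6, 7].getD i 0)
    (fun i => [0, 1, 2, 3, 4, 10, 11, 12, 8, 9, 6, 5, 7].getD i 0)
    rfl (by decide) (by decide) (by decide)

lemma Rep.isExceptional_T16 {c : Bool} (h : Rep G c [leaf, leaf, leaf, N [leaf, leaf, N [leaf, leaf, N [leaf, leaf]]]]) :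
    IsExceptional G :=
  h.isExceptional (n := 16) (l := [(0, 1), (1, 2), (2, 3), (3, 4), (4, 5), (5, 6), (0, 7), (0, 8), (0, 9), (2, 10), (2, 11), (4, 12), (4, 13), (6, 14), (6, 15)]) (by simp [exceptionalTrees, T16])
    (fun i => [0, 1, 2, 3, 4, 5, 6, 14, 15, 13, 12, 11, 10, 8, 9, 7].getD i 0)
    (fun i => [0, 1, 2, 3, 4, 5, 6, 15, 13, 14, 12, 11, 10, 9, 7, 8].getD i 0)
    rfl (by decide) (by decide) (by decide)

lemma Rep.isExceptional_T20 {c : Bool} (h : Rep G c [leaf, leaf, leaf, N [leaf, leaf, N [leaf, leaf, N [leaf, leaf, N [leaf, leaf]]]]]) :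
    IsExceptional G :=
  h.isExceptional (n := 20) (l := [(0, 1), (1, 2), (2, 3), (3, 4), (4, 5), (5, 6), (6, 7), (7, 8), (0, 9), (0, 10), (0, 11), (2, 12), (2, 13), (4, 14), (4, 15), (6, 16), (6, 17), (8, 18), (8, 19)]) (by simp [exceptionalTrees, T20])
    (fun i => [0, 1, 2, 3, 4, 5, 6, 7, 8, 18, 19, 16, 17, 14, 15, 12, 13, 10, 11, 9].getD i 0)
    (fun i => [0, 1, 2, 3, 4, 5, 6, 7, 8, 19, 17, 18, 15, 16, 13, 14, 11, 12, 9, 10].getD i 0)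
    rfl (by decide) (by decide) (by decide)

end Exceptional
end OptimalTree

namespace OptimalTree

open RT

namespace RT

/-! ### Values of branches -/

/-- The value of a branch with root of type A. -/
def Sa (x : RT) : ℚ := S true x
/-- The value of a branch with root of type A, the root being uncovered. -/
def Za (x : RT) : ℚ := Z true x
/-- The value of a branch with root of type B. -/
def Sb (x : RT) : ℚ := S false x
/-- The value of a branch with root of type B, the root being uncovered. -/
def Zb (x : RT) : ℚ := Z false x

@[simp] lemma Sa_leaf : Sa leaf = 1 := by simp [Sa, S]
@[simp] lemma Za_leaf : Za leaf = 1 := by simp [Za, Z]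
@[simp] lemma Sb_nil : Sb (mk []) = 0 := by simp [Sb, S, RT.mk]
@[simp] lemma Zb_nil : Zb (mk []) = 1 := by simp [Zb, Z, RT.mk]
@[simp] lemma Sa_nil : Sa (mk []) = 1 := Sa_leaf
@[simp] lemma Za_nil : Za (mk []) = 1 := Za_leaf

lemma Sa_cons (u : RT) (us : List RT) :
    Sa (mk (u :: us)) = Sa (mk us) * Sb u + Za (mk us) * Zb u := by
  simp [Sa, Sb, Za, Zb, S, RT.mk]

lemma Za_cons (u : RT) (us : List RT) : Za (mk (u :: us)) = Za (mk us) * Sb u := by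
  simp [Sb, Za, Z, RT.mk]

lemma Sb_cons (x : RT) (xs : List RT) :
    Sb (mk (x :: xs)) = Sb (mk xs) * Sa x + Zb (mk xs) * Za x := by
  simp [Sa, Sb, Za, Zb, S, RT.mk]

lemma Zb_cons (x : RT) (xs : List RT) : Zb (mk (x :: xs)) = Zb (mk xs) * Sa x := by
  simp [Sa, Zb, Z, RT.mk]

lemma Za_append (us vs : List RT) : Za (mk (us ++ vs)) = Za (mk us) * Za (mk vs) := by
  induction us with
  | nil => simp
  | cons u us ih => rw [List.cons_append, Za_cons, Za_cons, ih]; ring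

/-- Two vertices of type A are merged into one, which may be matched into one side only; the
matchings leaving it uncovered are counted twice and subtracted once. -/
lemma Sa_append (us vs : List RT) : Sa (mk (us ++ vs)) =
    Sa (mk us) * Za (mk vs) + Za (mk us) * Sa (mk vs) - Za (mk us) * Za (mk vs) := by
  induction us with
  | nil => simp
  | cons u us ih => rw [List.cons_append, Sa_cons, Sa_cons, Za_cons, ih, Za_append]; ring

lemma SZ_perm {us vs : List RT} (h : us.Perm vs) (c : Bool) :
    S c (mk us) = S c (mk vs) ∧ Z c (mk us) = Z c (mk vs) := by
  induction h with
  | nil => exact ⟨rfl, rfl⟩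
  | cons x _ ih => simp only [RT.mk, S, Z, ih, and_self]
  | swap x y l => simp only [RT.mk, S, Z]; constructor <;> ring
  | trans _ _ ih₁ ih₂ => exact ⟨ih₁.1.trans ih₂.1, ih₁.2.trans ih₂.2⟩

lemma Sa_perm {us vs : List RT} (h : us.Perm vs) : Sa (mk us) = Sa (mk vs) := by
  simp [Sa, SZ_perm h]

lemma Za_perm {us vs : List RT} (h : us.Perm vs) : Za (mk us) = Za (mk vs) := by
  simp [Za, SZ_perm h]

lemma Sb_perm {us vs : List RT} (h : us.Perm vs) : Sb (mk us) = Sb (mk vs) := by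
  simp [Sb, SZ_perm h]

lemma Zb_perm {us vs : List RT} (h : us.Perm vs) : Zb (mk us) = Zb (mk vs) := by
  simp [Zb, SZ_perm h]

lemma size_perm {us vs : List RT} (h : us.Perm vs) : size (mk us) = size (mk vs) := by
  rw [size_mk, size_mk, (h.map size).sum_eq]

lemma Z_true_le_S (x : RT) : Z true x ≤ S true x := by
  induction x with
  | leaf => simp [S, Z]
  | join t u iht _ =>
    rw [S, Z]
    exact le_add_right (Nat.mul_le_mul_right _ iht)

lemma Za_le_Sa (x : RT) : Za x ≤ Sa x := by
  exact Nat.cast_le.2 (Z_true_le_S x)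

lemma eq_nil_of_Sa_eq_Za {us : List RT} (h : Sa (mk us) = Za (mk us)) (hp : 0 < Za (mk us))
    (hu : ∀ u ∈ us, 0 < Zb u) : us = [] := by
  cases us with
  | nil => rfl
  | cons u us =>
    rw [Za_cons] at hp
    rw [Sa_cons, Za_cons] at h
    have h1 := Za_le_Sa (mk us)
    have h2 := hu u (by simp)
    have h3 : (0 : ℚ) ≤ Za (mk us) := by simp [Za]
    have h4 : (0 : ℚ) ≤ Sb u := by simp [Sb]
    have h5 : 0 < Za (mk us) := lt_of_le_of_ne h3 (by rintro h; simp [← h] at hp)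
    nlinarith [mul_pos h5 h2, mul_le_mul_of_nonneg_right h1 h4]

end RT

-- Admissible trees and the basic comparison inequality

section Admissible

variable {V : Type*} [Fintype V] {G : SimpleGraph V}

/-- The trees considered: optimal trees which are not exceptional. -/
structure Adm (G : SimpleGraph V) : Prop where
  opt : IsOptimalTree G
  card_ne_one : Fintype.card V ≠ 1
  card_ne_two : Fintype.card V ≠ 2
  card_ne_four : Fintype.card V ≠ 4
  not_exc : ¬ IsExceptional G

lemma Rep.rot {c : Bool} {ws us : List RT} (h : Rep G c (mk ws :: us)) (hG : Adm G) :
    Rep G (!c) (mk us :: ws) :=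
  h.rotate hG.opt hG.card_ne_two

lemma Rep.le_of_size {xs ys : List RT} (h : Rep G false xs) (hG : Adm G) (hs : size (mk ys) = size (mk xs)) :
    Sb (mk ys) ≤ Sb (mk xs) := by
  have := h.S_le hG.opt hG.card_ne_two hG.card_ne_one (d := false) hs
  exact Nat.cast_le.2 this

lemma Rep.pos {c : Bool} {us : List RT} (h : Rep G c us) (hG : Adm G) :
    ∀ u ∈ us, 0 < S (!c) u ∧ 0 < Z (!c) u := by
  intro u hu
  obtain ⟨l₁, l₂, rfl⟩ := List.append_of_mem hu
  exact (h.perm List.perm_middle).SZ_pos hG.opt hG.card_ne_two _ rfl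

lemma Rep.pos_a {us : List RT} (h : Rep G false us) (hG : Adm G) :
    ∀ u ∈ us, 0 < Sa u ∧ 0 < Za u := by
  intro u hu
  have := h.pos hG u hu
  simp only [Sa, Za, Nat.cast_pos]
  exact this

lemma Rep.pos_b {us : List RT} (h : Rep G true us) (hG : Adm G) :
    ∀ u ∈ us, 0 < Sb u ∧ 0 < Zb u := by
  intro u hu
  have := h.pos hG u hu
  simp only [Sb, Zb, Nat.cast_pos]
  exact this

/-! ### Vertices of type B have degree at least three -/

lemma Rep.ne_nil {c : Bool} {us : List RT} (h : Rep G c us) (hG : Adm G) : us ≠ [] := by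
  rintro rfl
  exact hG.card_ne_one h.card

lemma Rep.not_singleton {x : RT} (h : Rep G false [x]) (hG : Adm G) : False := by
  simpa using h.eq_true_of_singleton hG.opt hG.card_ne_two

lemma eq_leaf_of_Sa_eq_Za {us : List RT} (hu : ∀ u ∈ us, 0 < Zb u) (hp : 0 < Za (RT.mk us))
    (h : Sa (RT.mk us) = Za (RT.mk us)) : RT.mk us = leaf := by
  rw [eq_nil_of_Sa_eq_Za h hp hu]; rfl

/-- The combination `B` times `e4` plus `s * (a * b)` times `e3` bounds a sum of nonnegative terms
by zero, so every term vanishes. -/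
lemma merge_inequality {A a B b s z U W : ℚ} (ha : 0 < a) (hA : a ≤ A) (hb : 0 < b) (hB : b ≤ B)
    (hz : 0 < z) (hs : z ≤ s) (hW : 0 < W) (e3 : U * B ≤ W * b)
    (e4 : 2 * (W * s) * (A * b + a * B - a * b) ≤ (U * s + W * z) * (a * b)) :
    A = a ∧ B = b ∧ s = z ∧ U * s + W * z = 2 * (W * s) := by
  have hB0 : 0 < B := hb.trans_le hB
  have hs0 : 0 < s := hz.trans_le hs
  have h1 : W * (2 * s * B * b * (A - a) + 2 * s * B * a * (B - b) +
      (s * (B - b) + B * (s - z)) * (a * b)) ≤ 0 := by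
    have h2 := mul_le_mul_of_nonneg_left e4 hB0.le
    have h3 := mul_le_mul_of_nonneg_left e3 (by positivity : 0 ≤ s * (a * b))
    linarith
  have h4 := nonpos_of_mul_nonpos_right h1 hW
  have k1 : 0 ≤ 2 * s * B * b * (A - a) := mul_nonneg (by positivity) (sub_nonneg.2 hA)
  have k2 : 0 ≤ 2 * s * B * a * (B - b) := mul_nonneg (by positivity) (sub_nonneg.2 hB)
  have k3 : 0 ≤ s * (B - b) * (a * b) := mul_nonneg (mul_nonneg hs0.le (sub_nonneg.2 hB)) (by positivity)
  have k4 : 0 ≤ B * (s - z) * (a * b) := mul_nonneg (mul_nonneg hB0.le (sub_nonneg.2 hs)) (by positivity)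
  have l1 : 2 * s * B * b * (A - a) = 0 := by linarith
  have l2 : 2 * s * B * a * (B - b) = 0 := by linarith
  have l4 : B * (s - z) * (a * b) = 0 := by linarith
  have m1 : A = a := sub_eq_zero.1 ((mul_eq_zero.1 l1).resolve_left (by positivity))
  have m2 : B = b := sub_eq_zero.1 ((mul_eq_zero.1 l2).resolve_left (by positivity))
  have m4 : s = z := by
    have := (mul_eq_zero.1 l4).resolve_right (by positivity)
    exact sub_eq_zero.1 ((mul_eq_zero.1 this).resolve_left (by positivity))
  refine ⟨m1, m2, m4, ?_⟩
  subst m1 m2 m4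
  have h5 : 2 * (W * s) ≤ U * s + W * s := by
    have : 0 < A * B := by positivity
    have h6 : 2 * (W * s) * (A * B) ≤ (U * s + W * s) * (A * B) := by linarith
    exact le_of_mul_le_mul_right h6 this
  have h7 : U ≤ W := le_of_mul_le_mul_right e3 hB0
  nlinarith

/-- Two rearrangements of a vertex of type B of degree two leave only the equality case, in which
`us` and `vs` are empty and `ys` consists of two leaves: this is `T6₂`. -/
lemma Rep.not_pair_of_inner {us ys vs : List RT} (hG : Adm G)
    (h : Rep G false [RT.mk (RT.mk ys :: us), RT.mk vs]) : False := by
  have hpos := h.pos_a hG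
  have hr1 := h.rot hG
  have hr2 := (h.perm (List.Perm.swap _ _ _)).rot hG
  have hus : ∀ u ∈ RT.mk ys :: us, 0 < Sb u ∧ 0 < Zb u := fun u hu =>
    hr1.pos_b hG u (List.mem_cons_of_mem _ hu)
  have hvs : ∀ u ∈ vs, 0 < Sb u ∧ 0 < Zb u := fun u hu =>
    hr2.pos_b hG u (List.mem_cons_of_mem _ hu)
  have hr3 := (hr1.perm (List.Perm.swap _ _ _)).rot hG
  have hys : ∀ y ∈ ys, 0 < Sa y ∧ 0 < Za y := fun y hy =>
    hr3.pos_a hG y (List.mem_cons_of_mem _ hy)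
  have hyne : ys ≠ [] := by
    rintro rfl
    exact hr3.not_singleton hG
  obtain ⟨hU, hW⟩ := hus _ (List.mem_cons_self)
  have hb := (hpos (RT.mk vs) (by simp)).2
  have ha : 0 < Za (RT.mk us) := by
    have := (hpos _ (List.mem_cons_self)).2
    rw [Za_cons] at this
    exact pos_of_mul_pos_left this hU.le
  have hAa := Za_le_Sa (RT.mk us)
  have hBb := Za_le_Sa (RT.mk vs)
  have key : ∀ y ∈ ys, Sa (RT.mk us) = Za (RT.mk us) ∧ Sa (RT.mk vs) = Za (RT.mk vs) ∧
      Sa y = Za y ∧ Sb (RT.mk ys) = 2 * Zb (RT.mk ys) := by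
    intro y hy
    obtain ⟨l₁, l₂, rfl⟩ := List.append_of_mem hy
    have hp : (l₁ ++ y :: l₂).Perm (y :: (l₁ ++ l₂)) := List.perm_middle
    obtain ⟨hy1, hy2⟩ := hys y (by simp)
    have hyy := Za_le_Sa y
    -- The two neighbours of the root are merged; the root of `mk ys` keeps the merged vertex and
    -- receives two leaves for the two vertices set free.
    have e1 := h.le_of_size hG (ys := leaf :: leaf :: RT.mk (us ++ vs) :: (l₁ ++ y :: l₂)) (by
      simp only [size_mk, List.map_cons, List.sum_cons, List.map_append, List.sum_append, size,
        List.map_nil, List.sum_nil]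
      omega)
    -- The branch `y` moves from the root of `mk ys` to the vertex of degree two.
    have e2 := h.le_of_size hG (ys := [y, RT.mk (RT.mk (l₁ ++ l₂) :: us), RT.mk vs]) (by
      simp only [size_mk, List.map_cons, List.sum_cons, List.map_append, List.sum_append,
        List.map_nil, List.sum_nil]
      omega)
    simp only [Sb_cons, Zb_cons, Sb_nil, Zb_nil, Sa_cons, Za_cons, Sa_append, Za_append, Sa_leaf,
      Za_leaf] at e1 e2
    simp only [Sb_perm hp, Zb_perm hp] at e1 e2 hW ⊢
    simp only [Sb_cons, Zb_cons] at e1 e2 hW ⊢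
    have hW' : 0 < Zb (RT.mk (l₁ ++ l₂)) := pos_of_mul_pos_left hW hy1.le
    generalize Sa (RT.mk us) = A at *
    generalize Za (RT.mk us) = a at *
    generalize Sa (RT.mk vs) = B at *
    generalize Za (RT.mk vs) = b at *
    generalize Sa y = s at *
    generalize Za y = z at *
    generalize Sb (RT.mk (l₁ ++ l₂)) = U at *
    generalize Zb (RT.mk (l₁ ++ l₂)) = W at *
    refine merge_inequality ha hAa hb hBb hy2 hyy hW' ?_ ?_
    · have : 0 ≤ A * z * (W * b - U * B) := by linarith
      have := nonneg_of_mul_nonneg_right this (mul_pos (ha.trans_le hAa) hy2)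
      linarith
    · linarith
  obtain ⟨y, hy⟩ := List.exists_mem_of_ne_nil _ hyne
  obtain ⟨k1, k2, -, k4⟩ := key y hy
  obtain rfl := eq_nil_of_Sa_eq_Za k1 ha fun u hu => (hus u (List.mem_cons_of_mem _ hu)).2
  obtain rfl := eq_nil_of_Sa_eq_Za k2 hb fun u hu => (hvs u hu).2
  have hleaf : ∀ y ∈ ys, y = leaf := by
    intro y hy
    obtain ⟨l₁, l₂, hl⟩ := List.append_of_mem hy
    obtain ⟨ws, rfl⟩ := exists_eq_mk y
    have hrw := ((hr3.perm (List.Perm.cons _ (hl ▸ List.perm_middle))).perm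
      (List.Perm.swap _ _ _)).rot hG
    exact eq_leaf_of_Sa_eq_Za (fun u hu => (hrw.pos_b hG u (List.mem_cons_of_mem _ hu)).2)
      (hys _ hy).2 (key _ hy).2.2.1
  obtain ⟨k, rfl⟩ : ∃ k, ys = List.replicate k leaf := ⟨_, List.eq_replicate_of_mem hleaf⟩
  have hk : k = 2 := by
    have h1 : Sb (RT.mk (List.replicate k leaf)) = k := by rw [Sb, (S_star k).1]
    have h2 : Zb (RT.mk (List.replicate k leaf)) = 1 := by rw [Zb, (S_star k).2]; simp
    rw [h1, h2] at k4
    exact_mod_cast k4.trans (mul_one 2)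
  subst hk
  refine hG.not_exc (Rep.isExceptional_T6₂ (c := !!false) (hr3.perm ?_))
  exact (List.Perm.swap _ _ _).trans (List.Perm.cons _ (List.Perm.swap _ _ _))

lemma Rep.not_pair {x₁ x₂ : RT} (h : Rep G false [x₁, x₂]) (hG : Adm G) : False := by
  obtain ⟨us, rfl⟩ := exists_eq_mk x₁
  obtain ⟨vs, rfl⟩ := exists_eq_mk x₂
  cases us with
  | cons u us =>
    obtain ⟨ys, rfl⟩ := exists_eq_mk u
    exact not_pair_of_inner hG h
  | nil =>
    cases vs with
    | cons v vs =>
      obtain ⟨ys, rfl⟩ := exists_eq_mk v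
      exact not_pair_of_inner hG (h.perm (List.Perm.swap _ _ _))
    | nil => exact hG.not_exc h.isExceptional_T3

lemma Rep.three_le_length {us : List RT} (h : Rep G false us) (hG : Adm G) : 3 ≤ us.length := by
  match us, h with
  | [], h => exact absurd rfl (h.ne_nil hG)
  | [x], h => exact (h.not_singleton hG).elim
  | [x₁, x₂], h => exact (h.not_pair hG).elim
  | _ :: _ :: _ :: _, _ => simp

end Admissible

end OptimalTree

namespace OptimalTree

open RT

namespace RT

/-! ### Paths -/

lemma Sa_N (ys : List RT) : Sa (N ys) = Sb (mk ys) + Zb (mk ys) := by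
  simp [N, Sa_cons]

lemma Za_N (ys : List RT) : Za (N ys) = Sb (mk ys) := by
  simp [N, Za_cons]

lemma size_N (ys : List RT) : size (N ys) = size (mk ys) + 1 := by
  rw [N, size_mk]; simp [add_comm]

/-- The branch in which `u` hangs at the end of a path, with the given further branches at the
vertices of type B of the path. -/
def up : List (List RT) → RT → RT
  | [], u => u
  | ys :: p, u => N (up p u :: ys)

/-- The branch seen from the other end of the path. -/
def dn : List (List RT) → List RT → RT
  | [], zs => mk zs
  | ys :: p, zs => dn p (N zs :: ys)

/-- All vertices of type A, except possibly the root, have degree at most two. -/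
inductive Bushy : RT → Prop
  | leaf : Bushy leaf
  | node {ys : List RT} (h : 2 ≤ ys.length) (h' : ∀ y ∈ ys, Bushy y) : Bushy (N ys)

lemma Za_pos_of {us : List RT} (h : ∀ u ∈ us, 0 < Sb u) : 0 < Za (mk us) := by
  induction us with
  | nil => simp
  | cons u us ih =>
    rw [Za_cons]
    exact mul_pos (ih fun u hu => h u (by simp [hu])) (h u (by simp))

lemma Zb_pos_of {xs : List RT} (h : ∀ x ∈ xs, 0 < Sa x) : 0 < Zb (mk xs) := by
  induction xs with
  | nil => simp
  | cons x xs ih =>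
    rw [Zb_cons]
    exact mul_pos (ih fun x hx => h x (by simp [hx])) (h x (by simp))

lemma Sb_nonneg (u : RT) : 0 ≤ Sb u := by simp [Sb]
lemma Zb_nonneg (u : RT) : 0 ≤ Zb u := by simp [Zb]
lemma Sa_nonneg (u : RT) : 0 ≤ Sa u := by simp [Sa]
lemma Za_nonneg (u : RT) : 0 ≤ Za u := by simp [Za]

lemma Sb_pos_of {xs : List RT} (h : ∀ x ∈ xs, 0 < Sa x ∧ 0 < Za x) (hne : xs ≠ []) :
    0 < Sb (mk xs) := by
  cases xs with
  | nil => exact absurd rfl hne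
  | cons x xs =>
    rw [Sb_cons]
    have h1 : 0 < Zb (mk xs) := Zb_pos_of fun y hy => (h y (by simp [hy])).1
    have := mul_nonneg (Sb_nonneg (mk xs)) (h x (by simp)).1.le
    have := mul_pos h1 (h x (by simp)).2
    linarith

lemma Bushy.pos {x : RT} (h : Bushy x) : 0 < Sa x ∧ 0 < Za x := by
  induction h with
  | leaf => simp
  | @node ys h h' ih =>
    rw [Sa_N, Za_N]
    have h1 := Sb_pos_of ih (by rintro rfl; simp at h)
    have h2 := Zb_pos_of fun y hy => (ih y hy).1
    exact ⟨by linarith, h1⟩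

lemma Sb_replicate_leaf (k : ℕ) : Sb (mk (List.replicate k leaf)) = k := by
  rw [Sb, (S_star k).1]

lemma Zb_replicate_leaf (k : ℕ) : Zb (mk (List.replicate k leaf)) = 1 := by
  rw [Zb, (S_star k).2]; simp

/-- A path acts on the pair of values at one end by a matrix with positive determinant, and on those
at the other end by its transpose. -/
lemma exists_path_coeff {p : List (List RT)} (hp : ∀ ys ∈ p, ∀ y ∈ ys, Bushy y) :
    ∃ a b c d : ℚ, 0 < a ∧ 0 ≤ b ∧ 0 ≤ c ∧ 0 < d ∧ b * c < a * d ∧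
      (∀ u, Sa (up p u) = a * Sa u + b * Za u ∧ Za (up p u) = c * Sa u + d * Za u) ∧
      ∀ zs, Sb (dn p zs) = a * Sb (mk zs) + c * Zb (mk zs) ∧
        Zb (dn p zs) = b * Sb (mk zs) + d * Zb (mk zs) := by
  induction p with
  | nil => exact ⟨1, 0, 0, 1, by norm_num, by norm_num, by norm_num, by norm_num, by norm_num,
      fun u => by simp [up], fun zs => by simp [dn]⟩
  | cons ys p ih =>
    obtain ⟨a, b, c, d, ha, hb, hc, hd, hdet, h1, h2⟩ := ih fun ys hy => hp ys (by simp [hy])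
    have hw : 0 < Zb (mk ys) := Zb_pos_of fun y hy => (hp ys (by simp) y hy).pos.1
    have hv : 0 ≤ Sb (mk ys) := Sb_nonneg _
    have e1 : ∀ u, Sb (mk (up p u :: ys)) = _ := fun u => Sb_cons _ _
    have e2 : ∀ u, Zb (mk (up p u :: ys)) = _ := fun u => Zb_cons _ _
    have e3 : ∀ zs, Sb (mk (N zs :: ys)) = _ := fun u => Sb_cons _ _
    have e4 : ∀ zs, Zb (mk (N zs :: ys)) = _ := fun u => Zb_cons _ _
    generalize Zb (mk ys) = w at *
    generalize Sb (mk ys) = v at *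
    refine ⟨(v + w) * a + w * c, (v + w) * b + w * d, v * a + w * c, v * b + w * d,
      by positivity, by positivity, by positivity, by positivity, ?_, ?_, ?_⟩
    · have := mul_lt_mul_of_pos_left hdet (mul_pos hw hw)
      linarith
    · intro u
      rw [up, Sa_N, Za_N, e1, e2, (h1 u).1, (h1 u).2]
      constructor <;> ring
    · intro zs
      rw [dn, (h2 _).1, (h2 _).2, e3, e4, Sa_N, Za_N]
      constructor <;> ring

lemma up_perm_coeff {p : List (List RT)} (hp : ∀ ys ∈ p, ∀ y ∈ ys, Bushy y) {zs zs' : List RT}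
    (h : zs.Perm zs') : Sb (dn p zs) = Sb (dn p zs') ∧ Zb (dn p zs) = Zb (dn p zs') := by
  obtain ⟨a, b, c, d, -, -, -, -, -, -, h2⟩ := exists_path_coeff hp
  rw [(h2 _).1, (h2 _).2, (h2 _).1, (h2 _).2, Sb_perm h, Zb_perm h]
  simp

lemma size_up (p : List (List RT)) : ∃ k, ∀ u, size (up p u) = k + size u := by
  induction p with
  | nil => exact ⟨0, by simp [up]⟩
  | cons ys p ih =>
    obtain ⟨k, hk⟩ := ih
    refine ⟨k + size (mk ys) + 1, fun u => ?_⟩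
    rw [up, size_N, size_mk, List.map_cons, List.sum_cons, hk, size_mk]
    ring

end RT

section

variable {V : Type*} [Fintype V] {G : SimpleGraph V}

lemma Rep.rotN {ys xs : List RT} (h : Rep G false (N ys :: xs)) (hG : Adm G) :
    Rep G false (N xs :: ys) :=
  ((h.rot hG).perm (List.Perm.swap _ _ _)).rot hG

lemma Rep.up_step {p : List (List RT)} {u : RT} {ys zs : List RT}
    (h : Rep G false (up p u :: N zs :: ys)) (hG : Adm G) :
    Rep G false (up (ys :: p) u :: zs) :=
  (h.perm (List.Perm.swap _ _ _)).rotN hG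

/-- Descends through nontrivial branches until only leaves are left. The last two conclusions say
that the values seen through the path have not changed. -/
lemma Rep.exists_end (hG : Adm G) {u : RT} : ∀ (n : ℕ) (p : List (List RT)) (ys : List RT),
    size (RT.mk ys) = n → (∀ y ∈ ys, Bushy y) → 2 ≤ ys.length →
    (∀ zs ∈ p, ∀ y ∈ zs, Bushy y) → Rep G false (up p u :: ys) →
    ∃ p' k, 2 ≤ k ∧ (∀ zs ∈ p', ∀ y ∈ zs, Bushy y) ∧
      Rep G false (up p' u :: List.replicate k leaf) ∧
      Sb (dn p' (List.replicate k leaf)) = Sb (dn p ys) ∧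
      Zb (dn p' (List.replicate k leaf)) = Zb (dn p ys) := by
  intro n
  induction n using Nat.strong_induction_on with
  | _ n ih =>
    intro p ys hn hb hl hp h
    by_cases hall : ∀ y ∈ ys, y = leaf
    · obtain ⟨k, rfl⟩ : ∃ k, ys = List.replicate k leaf := ⟨_, List.eq_replicate_of_mem hall⟩
      exact ⟨p, k, by simpa using hl, hp, h, rfl, rfl⟩
    · push Not at hall
      obtain ⟨y, hy, hyl⟩ := hall
      obtain ⟨l₁, l₂, rfl⟩ := List.append_of_mem hy
      cases hb y hy with
      | leaf => exact absurd rfl hyl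
      | @node zs h1 h2 =>
        have hperm : (l₁ ++ N zs :: l₂).Perm (N zs :: (l₁ ++ l₂)) := List.perm_middle
        have hp' : ∀ ys ∈ (l₁ ++ l₂) :: p, ∀ y ∈ ys, Bushy y := by
          intro ys hys y hy
          rcases List.mem_cons.1 hys with rfl | hys
          · exact hb y (by simp at hy ⊢; tauto)
          · exact hp ys hys y hy
        obtain ⟨p', k, hk, hq, hr, hs, hz⟩ := ih (size (RT.mk zs)) (by
          rw [← hn, size_perm hperm, size_mk, size_mk, List.map_cons, List.sum_cons, size_N,
            size_mk]
          omega) ((l₁ ++ l₂) :: p) zs rfl h2 h1 hp' ((h.perm (hperm.cons _)).up_step hG)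
        refine ⟨p', k, hk, hq, hr, ?_, ?_⟩
        · rw [hs, (up_perm_coeff hp hperm).1, dn]
        · rw [hz, (up_perm_coeff hp hperm).2, dn]

/-- Here `P p Q q` is the path matrix; `X T`, `M m` and `L l` are the value pairs of the remaining
branches, of the branch of least ratio, and of the branch containing the path. With D = P X + p T
and E = Q X + q T, `h1` and the ratio bounds give 2 m ((k - 1) D + E) ≤ M D. Then `h2` and D < 2 T P
make (k - 2) D + E - D / 2 negative, although E ≥ D / 2. -/
lemma branch_inequality {P p Q q X T M m L l k : ℚ} (hP : 0 < P) (hp : 0 ≤ p) (hQ : 0 ≤ Q)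
    (hq : 0 < q) (hdet : p * Q < P * q) (hT : 0 < T) (hX : T ≤ X) (hM : 0 < M) (hm : 0 < m)
    (hk : 2 ≤ k) (hL : L = P * k + Q) (hl : l = p * k + q)
    (h1 : (k - 1) * (P * X + p * T) + (Q * X + q * T) ≤ T * L)
    (h2 : (M - m) * (P * X + p * T) + m * (T * P) ≤
      m * (k * (P * X + p * T) + (Q * X + q * T)))
    (ho : m * L ≤ l * M) (ho' : m * T ≤ (X - T) * M)
    (hhalf : P * (X * M + T * m) + p * (T * M) ≤ 2 * (Q * (X * M + T * m) + q * (T * M))) :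
    False := by
  have hX0 : 0 < X := hT.trans_le hX
  have hk0 : 0 < k := by linarith
  -- The bound `hhalf` includes the branch of least ratio; here it is transferred to the situation
  -- without that branch.
  have hE : P * X + p * T ≤ 2 * (Q * X + q * T) := by
    rcases le_total (2 * Q) P with hc | hc
    · have : 0 ≤ M * (2 * (Q * X + q * T) - (P * X + p * T)) := by
        have := mul_nonneg (sub_nonneg.2 hc) (mul_pos hT hm).le
        linarith
      have := nonneg_of_mul_nonneg_right this hM
      linarith
    · have h3 : 0 ≤ 2 * q - p := by
        have : 0 ≤ P * (2 * q - p) := by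
          have := mul_nonneg hp (sub_nonneg.2 hc)
          linarith
        exact nonneg_of_mul_nonneg_right this hP
      have := mul_nonneg (sub_nonneg.2 hc) hX0.le
      have := mul_nonneg h3 hT.le
      linarith
  have hD : 0 < P * X + p * T := by positivity
  have hkD : k * (P * X + p * T) + (Q * X + q * T) = X * L + T * l := by rw [hL, hl]; ring
  have hra : P * X + p * T < 2 * (T * P) := by
    have h4 : Q * T ≤ Q * X := mul_le_mul_of_nonneg_left hX hQ
    have h5 : (k - 1) * (P * X + p * T) < k * (T * P) := by
      have := mul_pos hq hT
      rw [hL] at h1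
      linarith
    have h6 : (k - 1) * (P * X + p * T) < (k - 1) * (2 * (T * P)) := by
      have : 0 ≤ (k - 2) * (T * P) := mul_nonneg (by linarith) (by positivity)
      linarith
    exact lt_of_mul_lt_mul_left h6 (by linarith)
  generalize P * X + p * T = D at *
  generalize Q * X + q * T = E at *
  have hsum : 2 * m * ((k - 1) * D + E) ≤ M * D := by
    have h7 : 2 * m * ((k - 1) * D + E) ≤ 2 * m * (T * L) :=
      mul_le_mul_of_nonneg_left h1 (by linarith)
    have hL0 : 0 < L := by rw [hL]; positivity
    have h8 : 2 * m * (T * L) ≤ M * ((X - T) * L + T * l) := by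
      have := mul_le_mul_of_nonneg_left ho hT.le
      have := mul_le_mul_of_nonneg_right ho' hL0.le
      linarith
    have h9 : M * ((X - T) * L + T * l) ≤ M * D :=
      mul_le_mul_of_nonneg_left (by linarith) hM.le
    linarith
  have h10 : m * ((k - 2) * D + (E - D / 2)) < 0 := by
    have := mul_pos hm (sub_pos.2 hra)
    linarith
  have h11 : 0 ≤ m * ((k - 2) * D + (E - D / 2)) :=
    mul_nonneg hm.le (add_nonneg (mul_nonneg (by linarith) hD.le) (by linarith))
  linarith

/-- The branch `um` has ratio `Zb / Sb` at most that of `mk ys` and of a third branch `w`. The path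
leads from the vertex of type A into `mk ys`, to a vertex whose other branches are `k` leaves. -/
lemma Rep.false_of_branch (hG : Adm G) {ys : List RT} {um w : RT} {R : List RT}
    (h : Rep G true (RT.mk ys :: um :: R)) (hys : ∀ y ∈ ys, Bushy y) (hlen : 2 ≤ ys.length)
    (ho : Zb um * Sb (RT.mk ys) ≤ Zb (RT.mk ys) * Sb um) (hw : w ∈ R)
    (ho' : Zb um * Sb w ≤ Zb w * Sb um) : False := by
  have hposb := h.pos_b hG
  obtain ⟨hM, hm⟩ := hposb um (by simp)
  obtain ⟨p, k, hk, hp, hr, hS, hZ⟩ := Rep.exists_end hG (u := RT.mk (um :: R)) _ [] ys rfl hys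
    hlen (by simp) (by simpa [up] using h.rot hG)
  obtain ⟨P, b, Q, d, hP, hb, hQ, hd, hdet, hup, hdn⟩ := exists_path_coeff hp
  have hT : 0 < Za (RT.mk R) := Za_pos_of fun u hu => (hposb u (by simp [hu])).1
  have hX : Za (RT.mk R) ≤ Sa (RT.mk R) := Za_le_Sa _
  obtain ⟨κ, hκ⟩ := size_up p
  have hk1 : List.replicate k leaf = leaf :: List.replicate (k - 1) leaf := by
    rw [← List.replicate_succ]; congr; omega
  have hkq : ((k - 1 : ℕ) : ℚ) = (k : ℚ) - 1 := by
    rw [Nat.cast_sub (by omega)]; simp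
  have hk2 : (2 : ℚ) ≤ k := by exact_mod_cast hk
  -- The branch `um` moves from the vertex of type A to one of the leaves at the end of the path.
  have e1 := hr.le_of_size hG (ys := RT.mk [um] :: up p (RT.mk R) ::
    List.replicate (k - 1) leaf) (by
      rw [hk1]
      simp only [size_mk, List.map_cons, List.sum_cons, hκ, size, List.map_nil, List.sum_nil]
      omega)
  simp only [Sb_cons, Zb_cons, Sb_replicate_leaf, Zb_replicate_leaf, hup, Sa_cons, Za_cons, hkq,
    Sa_nil, Za_nil] at e1
  have hwR : Za (RT.mk R) * Zb w ≤ (Sa (RT.mk R) - Za (RT.mk R)) * Sb w := by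
    obtain ⟨l₁, l₂, rfl⟩ := List.append_of_mem hw
    have hperm : (l₁ ++ w :: l₂).Perm (w :: (l₁ ++ l₂)) := List.perm_middle
    rw [Sa_perm hperm, Za_perm hperm, Sa_cons, Za_cons]
    have h1 := Za_le_Sa (RT.mk (l₁ ++ l₂))
    have h2 := mul_le_mul_of_nonneg_right h1 (Sb_nonneg w)
    have h3 := mul_le_mul_of_nonneg_right h2 (Sb_nonneg w)
    linarith
  have hw0 : 0 < Sb w := (hposb w (by simp [hw])).1
  have ho2 : Zb um * Za (RT.mk R) ≤ (Sa (RT.mk R) - Za (RT.mk R)) * Sb um := by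
    have h1 := mul_le_mul_of_nonneg_left ho' hT.le
    have h2 := mul_le_mul_of_nonneg_right hwR hM.le
    refine le_of_mul_le_mul_right ?_ hw0
    linarith
  have f1 : ((k : ℚ) - 1) * (P * Sa (RT.mk R) + b * Za (RT.mk R)) +
      (Q * Sa (RT.mk R) + d * Za (RT.mk R)) ≤ Za (RT.mk R) * Sb (RT.mk ys) := by
    have hL : Sb (RT.mk ys) = P * k + Q := by
      have : Sb (dn [] ys) = _ := hS.symm
      rw [dn] at this
      rw [this, (hdn _).1, Sb_replicate_leaf, Zb_replicate_leaf, mul_one]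
    rw [hL]
    refine le_of_mul_le_mul_left ?_ hm
    linarith
  obtain ⟨rs, rfl⟩ := exists_eq_mk um
  have f2 : (Sb (RT.mk rs) - Zb (RT.mk rs)) * (P * Sa (RT.mk R) + b * Za (RT.mk R)) +
      Zb (RT.mk rs) * (Za (RT.mk R) * P) ≤
      Zb (RT.mk rs) * (k * (P * Sa (RT.mk R) + b * Za (RT.mk R)) +
        (Q * Sa (RT.mk R) + d * Za (RT.mk R))) := by
    cases rs with
    | nil => simp at hM
    | cons r rs =>
      -- A branch `r` at the root of `um` moves to the end of the path.
      have e2 := hr.le_of_size hG (ys := r :: up p (RT.mk (RT.mk rs :: R)) ::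
        List.replicate k leaf) (by
          simp only [size_mk, List.map_cons, List.sum_cons, hκ]
          omega)
      simp only [Sb_cons, Zb_cons, Sb_replicate_leaf, Zb_replicate_leaf, hup, Sa_cons,
        Za_cons] at e2 hM hm ⊢
      have hD : 0 ≤ P * Sa (RT.mk R) + b * Za (RT.mk R) := by
        have := Sa_nonneg (RT.mk R)
        positivity
      have hzr : 0 < Za r := by
        have hrr := (((h.perm (List.Perm.swap _ _ _)).rot hG).pos_a hG) r (by simp)
        exact hrr.2
      have hsr : 0 < Sa r := hzr.trans_le (Za_le_Sa r)
      have hle := Za_le_Sa r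
      have hW := Zb_nonneg (RT.mk rs)
      have h1 : 0 ≤ Za r * (Zb (RT.mk rs) * (k * (P * Sa (RT.mk R) + b * Za (RT.mk R)) +
          (Q * Sa (RT.mk R) + d * Za (RT.mk R))) - Sb (RT.mk rs) *
          (P * Sa (RT.mk R) + b * Za (RT.mk R)) - P * Za (RT.mk R) * Zb (RT.mk rs)) := by
        linarith
      have h2 := mul_nonneg hsr.le (nonneg_of_mul_nonneg_right h1 hzr)
      have h3 := mul_nonneg (mul_nonneg hW (sub_nonneg.2 hle)) hD
      linarith
  have ho1 : Zb (RT.mk rs) * Sb (RT.mk ys) ≤ Zb (RT.mk ys) * Sb (RT.mk rs) := ho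
  have hL : Sb (RT.mk ys) = P * k + Q := by
    have : Sb (dn [] ys) = _ := hS.symm
    rw [dn] at this
    rw [this, (hdn _).1, Sb_replicate_leaf, Zb_replicate_leaf, mul_one]
  have hl : Zb (RT.mk ys) = b * k + d := by
    have : Zb (dn [] ys) = _ := hZ.symm
    rw [dn] at this
    rw [this, (hdn _).2, Sb_replicate_leaf, Zb_replicate_leaf, mul_one]
  cases p with
  -- With an empty path, `f1` says that no matching covers the vertex of type A from `R`, which is
  -- absurd.
  | nil =>
    have g1 := hup leaf
    have g2 := hup (N [leaf])
    simp only [up, Sa_leaf, Za_leaf, Sa_N, Za_N, Sb_cons, Zb_cons, Sb_nil, Zb_nil] at g1 g2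
    obtain rfl : P = 1 := by linarith
    obtain rfl : b = 0 := by linarith
    obtain rfl : Q = 0 := by linarith
    obtain rfl : d = 1 := by linarith
    rw [hL] at f1
    have h3 : ((k : ℚ) - 1) * (Sa (RT.mk R) - Za (RT.mk R)) ≤ 0 := by linarith
    have h4 : 0 < (Sa (RT.mk R) - Za (RT.mk R)) * Sb (RT.mk rs) :=
      lt_of_lt_of_le (mul_pos hm hT) ho2
    have h5 : 0 < Sa (RT.mk R) - Za (RT.mk R) := pos_of_mul_pos_left h4 hM.le
    have := mul_pos (by linarith : (0 : ℚ) < (k : ℚ) - 1) h5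
    linarith
  | cons ts p =>
    refine branch_inequality hP hb hQ hd hdet hT hX hM hm hk2 hL hl f1 f2 ho1 ho2 ?_
    -- A leaf moves from the end of the path to the next vertex of type B. With `k ≥ 2` this gives
    -- ratio at least one half to the branch behind that vertex.
    have e3 := hr.le_of_size hG (ys := N (leaf :: up p (RT.mk (RT.mk rs :: R)) :: ts) ::
      List.replicate (k - 1) leaf) (by
        rw [hk1]
        simp only [up, N, size_mk, List.map_cons, List.sum_cons, size, List.map_nil, List.sum_nil]
        omega)
    have g := hup (RT.mk (RT.mk rs :: R))
    simp only [up, Sa_N, Za_N] at g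
    simp only [Sa_cons (RT.mk rs) R, Za_cons (RT.mk rs) R] at g
    generalize hY : up p (RT.mk (RT.mk rs :: R)) :: ts = Y at *
    simp only [up, hY] at e3
    rw [Sb_cons, Sb_cons, Zb_replicate_leaf, Zb_replicate_leaf, Sb_replicate_leaf,
      Sb_replicate_leaf, Sa_N, Za_N, Sa_N, Za_N, Sb_cons, Zb_cons, hkq, Sa_leaf, Za_leaf] at e3
    have hv : 0 ≤ Zb (RT.mk Y) := Zb_nonneg _
    have : 0 ≤ ((k : ℚ) - 2) * Zb (RT.mk Y) := mul_nonneg (by linarith) hv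
    linarith

/-! ### Vertices of type A have degree at most two -/

/-- A branch at a vertex of type A without vertices of type A of degree three or more. -/
def BushyB (u : RT) : Prop := ∃ ys, u = RT.mk ys ∧ 2 ≤ ys.length ∧ ∀ y ∈ ys, Bushy y

lemma ratio_trans {a b c a' b' c' : ℚ} (hb : 0 < b) (h1 : a' * b ≤ b' * a)
    (h2 : b' * c ≤ c' * b) (ha : 0 < a) (hc : 0 < c) : a' * c ≤ c' * a := by
  refine le_of_mul_le_mul_right ?_ hb
  have := mul_le_mul_of_nonneg_right h1 hc.le
  have := mul_le_mul_of_nonneg_right h2 ha.le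
  linarith

lemma exists_min_ratio : ∀ (l : List RT), l ≠ [] → (∀ u ∈ l, 0 < Sb u) →
    ∃ m ∈ l, ∀ u ∈ l, Zb m * Sb u ≤ Zb u * Sb m
  | [x], _, _ => ⟨x, by simp, by simp [mul_comm]⟩
  | x :: y :: l, _, h => by
    obtain ⟨m, hm, hmin⟩ := exists_min_ratio (y :: l) (by simp) fun u hu => h u (by simp [hu])
    have hx := h x (by simp)
    have hm0 := h m (by simp [hm])
    rcases le_total (Zb m * Sb x) (Zb x * Sb m) with h1 | h1
    · refine ⟨m, by simp [hm], fun u hu => ?_⟩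
      rcases List.mem_cons.1 hu with rfl | hu
      · exact h1
      · exact hmin u hu
    · refine ⟨x, by simp, fun u hu => ?_⟩
      rcases List.mem_cons.1 hu with rfl | hu
      · exact le_rfl
      · exact ratio_trans hm0 h1 (hmin u hu) hx (h u (by simp [hu]))

/-- With `m` a branch of least ratio, one of the two bushy branches differs from `m` and carries the
path; any third branch serves as `w`. -/
lemma Rep.false_of_two_bushy (hG : Adm G) {u v : RT} {R : List RT} (h : Rep G true (u :: v :: R))
    (hR : R ≠ []) (hu : BushyB u) (hv : BushyB v) : False := by
  have hpos := h.pos_b hG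
  obtain ⟨m, hm, hmin⟩ := exists_min_ratio (u :: v :: R) (by simp) fun u hu => (hpos u hu).1
  obtain ⟨ys, rfl, hl, hb⟩ := hu
  obtain ⟨ys', rfl, hl', hb'⟩ := hv
  rcases List.mem_cons.1 hm with rfl | hm
  · obtain ⟨w, hw⟩ := List.exists_mem_of_ne_nil _ hR
    exact Rep.false_of_branch hG (h.perm (List.Perm.swap _ _ _)) hb' hl' (hmin _ (by simp)) hw
      (hmin _ (by simp [hw]))
  · obtain ⟨l₁, l₂, hl₁⟩ := List.append_of_mem hm
    have hp : (RT.mk ys' :: R).Perm (m :: (l₁ ++ l₂)) := hl₁ ▸ List.perm_middle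
    have hne : l₁ ++ l₂ ≠ [] := by
      intro he
      have := hp.length_eq
      rw [he] at this
      cases R with
      | nil => exact hR rfl
      | cons => simp at this
    obtain ⟨w, hw⟩ := List.exists_mem_of_ne_nil _ hne
    have hw' : w ∈ RT.mk ys' :: R := hp.mem_iff.2 (by simp [hw])
    exact Rep.false_of_branch hG (h.perm (hp.cons _)) hb hl (hmin _ (by simp)) hw
      (hmin _ (List.mem_cons_of_mem _ hw'))

lemma size_le_of_mem {us : List RT} {u : RT} (h : u ∈ us) : size u < size (RT.mk us) := by
  obtain ⟨l₁, l₂, rfl⟩ := List.append_of_mem h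
  rw [size_mk]
  simp only [List.map_append, List.map_cons, List.sum_append, List.sum_cons]
  omega

lemma perm_cons_of_mem {α : Type*} {l : List α} {a : α} (h : a ∈ l) :
    ∃ l', l.Perm (a :: l') := by
  obtain ⟨l₁, l₂, rfl⟩ := List.append_of_mem h
  exact ⟨l₁ ++ l₂, List.perm_middle⟩

lemma Rep.false_of_all_bushy (hG : Adm G) {us : List RT} {u : RT} (h : Rep G true (u :: us))
    (hl : 2 ≤ us.length) (hb : ∀ v ∈ us, BushyB v) : False := by
  match us, hl, h, hb with
  | v :: w :: R, _, h, hb =>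
    refine Rep.false_of_two_bushy hG (u := v) (v := w) (R := u :: R) (h.perm ?_) (by simp)
      (hb _ (by simp)) (hb _ (by simp))
    exact (List.Perm.swap _ _ _).trans ((List.Perm.swap _ _ _).cons _)

/-- Induction from the outside: the branches beyond an inner vertex of type A are already of this
form, so two of them together with the way back would contradict `Rep.false_of_all_bushy`. -/
lemma Rep.bushyB (hG : Adm G) : ∀ (n : ℕ) {u : RT} {us : List RT}, size u = n →
    Rep G true (u :: us) → BushyB u := by
  intro n
  induction n using Nat.strong_induction_on with
  | _ n ih =>
    intro u us hn h
    obtain ⟨ys, rfl⟩ := exists_eq_mk u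
    have hr : Rep G false (RT.mk us :: ys) := h.rot hG
    have hlen := hr.three_le_length hG
    refine ⟨ys, rfl, by simpa using hlen, fun y hy => ?_⟩
    obtain ⟨ys', hp⟩ := perm_cons_of_mem hy
    have hr' : Rep G true (RT.mk (RT.mk us :: ys') :: branches y) := by
      have h1 := hr.perm ((hp.cons _).trans (List.Perm.swap _ _ _))
      rw [← mk_branches y] at h1
      exact h1.rot hG
    have hlt := size_le_of_mem hy
    have hall : ∀ w ∈ branches y, BushyB w := by
      intro w hw
      obtain ⟨ws, hws⟩ := perm_cons_of_mem hw
      have hlt' := size_le_of_mem hw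
      rw [mk_branches] at hlt'
      exact ih (size w) (by omega) rfl (hr'.perm ((hws.cons _).trans (List.Perm.swap _ _ _)))
    rcases Nat.lt_or_ge (branches y).length 2 with h2 | h2
    · rw [← mk_branches y]
      match branches y, h2, hall with
      | [], _, _ => exact Bushy.leaf
      | [w], _, hall =>
        obtain ⟨zs, rfl, h3, h4⟩ := hall w (by simp)
        exact Bushy.node h3 h4
    · exact (hr'.false_of_all_bushy hG h2 hall).elim

lemma Rep.length_le_two (hG : Adm G) {us : List RT} (h : Rep G true us) : us.length ≤ 2 := by
  by_contra! hl
  match us, hl, h with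
  | u :: us, hl, h =>
    refine Rep.false_of_all_bushy hG h (by simpa using Nat.le_of_lt_succ hl) fun v hv => ?_
    obtain ⟨ws, hws⟩ := perm_cons_of_mem hv
    exact Rep.bushyB hG _ rfl (h.perm ((hws.cons _).trans (List.Perm.swap _ _ _)))

lemma Rep.bushy (hG : Adm G) {x : RT} {xs : List RT} (h : Rep G false xs) (hx : x ∈ xs) :
    Bushy x := by
  obtain ⟨xs', hp⟩ := perm_cons_of_mem hx
  have h1 := h.perm hp
  rw [← mk_branches x] at h1 ⊢
  have h2 : Rep G true _ := h1.rot hG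
  have h3 := h2.length_le_two hG
  match branches x, h2, h3 with
  | [], _, _ => exact Bushy.leaf
  | [w], h2, _ =>
    obtain ⟨zs, rfl, h4, h5⟩ := Rep.bushyB hG _ rfl (h2.perm (List.Perm.swap _ _ _))
    exact Bushy.node h4 h5

end

end OptimalTree

namespace OptimalTree

open RT

namespace RT

/-! ### Ratios -/

/-- The proportion of the value of a branch in which the root is uncovered. -/
def rho (x : RT) : ℚ := Za x / Sa x

/-- The sum of the ratios of a list of branches. -/
def sg (xs : List RT) : ℚ := (xs.map rho).sum

@[simp] lemma sg_nil : sg [] = 0 := rfl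
@[simp] lemma sg_cons (x : RT) (xs : List RT) : sg (x :: xs) = rho x + sg xs := by simp [sg]
@[simp] lemma sg_append (xs ys : List RT) : sg (xs ++ ys) = sg xs + sg ys := by simp [sg]
lemma sg_perm {xs ys : List RT} (h : xs.Perm ys) : sg xs = sg ys := (h.map rho).sum_eq
@[simp] lemma rho_leaf : rho leaf = 1 := by simp [rho]

lemma rho_nonneg (x : RT) : 0 ≤ rho x := div_nonneg (Za_nonneg x) (Sa_nonneg x)

lemma sg_nonneg (xs : List RT) : 0 ≤ sg xs := List.sum_nonneg (by simp [rho_nonneg])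

lemma rho_le_one (x : RT) : rho x ≤ 1 := div_le_one_of_le₀ (Za_le_Sa x) (Sa_nonneg x)

lemma Za_eq {x : RT} (h : 0 < Sa x) : Za x = Sa x * rho x := by
  rw [rho, mul_div_cancel₀ _ h.ne']

lemma Zb_append (xs ys : List RT) : Zb (mk (xs ++ ys)) = Zb (mk xs) * Zb (mk ys) := by
  induction xs with
  | nil => simp
  | cons x xs ih => rw [List.cons_append, Zb_cons, Zb_cons, ih]; ring

/-- The root is matched to the root of exactly one branch `x`, which then contributes `Za x` in
place of `Sa x`. -/
lemma Sb_eq {xs : List RT} (h : ∀ x ∈ xs, 0 < Sa x) : Sb (mk xs) = Zb (mk xs) * sg xs := by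
  induction xs with
  | nil => simp
  | cons x xs ih =>
    rw [Sb_cons, Zb_cons, sg_cons, ih fun y hy => h y (by simp [hy]), Za_eq (h x (by simp))]
    ring

lemma Sa_N_eq {ys : List RT} (h : ∀ x ∈ ys, 0 < Sa x) : Sa (N ys) = Zb (mk ys) * (1 + sg ys) := by
  rw [Sa_N, Sb_eq h]; ring

lemma Za_N_eq {ys : List RT} (h : ∀ x ∈ ys, 0 < Sa x) : Za (N ys) = Zb (mk ys) * sg ys := by
  rw [Za_N, Sb_eq h]

lemma Sa_N_pos {ys : List RT} (h : ∀ x ∈ ys, 0 < Sa x) : 0 < Sa (N ys) := by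
  rw [Sa_N_eq h]
  exact mul_pos (Zb_pos_of h) (by linarith [sg_nonneg ys])

lemma rho_N {ys : List RT} (h : ∀ x ∈ ys, 0 < Sa x) : rho (N ys) = sg ys / (1 + sg ys) := by
  rw [rho, Sa_N_eq h, Za_N_eq h, mul_div_mul_left _ _ (Zb_pos_of h).ne']

lemma rho_N_le {ys : List RT} (h : ∀ x ∈ ys, 0 < Sa x) {c : ℚ} (hc : sg ys ≤ c) :
    rho (N ys) ≤ c / (1 + c) := by
  have := sg_nonneg ys
  rw [rho_N h, div_le_div_iff₀ (by linarith) (by linarith)]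
  linarith

lemma le_rho_N {ys : List RT} (h : ∀ x ∈ ys, 0 < Sa x) {c : ℚ} (hc : c ≤ sg ys) (h0 : 0 ≤ c) :
    c / (1 + c) ≤ rho (N ys) := by
  have := sg_nonneg ys
  rw [rho_N h, div_le_div_iff₀ (by linarith) (by linarith)]
  linarith

lemma lt_rho_N {ys : List RT} (h : ∀ x ∈ ys, 0 < Sa x) {c : ℚ} (hc : c < sg ys) (h0 : 0 ≤ c) :
    c / (1 + c) < rho (N ys) := by
  have := sg_nonneg ys
  rw [rho_N h, div_lt_div_iff₀ (by linarith) (by linarith)]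
  linarith

lemma rho_N_lt_one {ys : List RT} (h : ∀ x ∈ ys, 0 < Sa x) : rho (N ys) < 1 := by
  have := sg_nonneg ys
  rw [rho_N h, div_lt_one (by linarith)]
  linarith

lemma sg_le_length (xs : List RT) : sg xs ≤ xs.length := by
  induction xs with
  | nil => simp
  | cons x xs ih =>
    rw [sg_cons, List.length_cons]
    push_cast
    linarith [rho_le_one x]

lemma mul_length_le_sg {c : ℚ} {xs : List RT} (h : ∀ x ∈ xs, c ≤ rho x) : c * xs.length ≤ sg xs := by
  induction xs with
  | nil => simp
  | cons x xs ih =>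
    rw [sg_cons, List.length_cons]
    push_cast
    linarith [h x (by simp), ih fun y hy => h y (by simp [hy])]

lemma sg_le_mul_length {c : ℚ} {xs : List RT} (h : ∀ x ∈ xs, rho x ≤ c) : sg xs ≤ c * xs.length := by
  induction xs with
  | nil => simp
  | cons x xs ih =>
    rw [sg_cons, List.length_cons]
    push_cast
    linarith [h x (by simp), ih fun y hy => h y (by simp [hy])]

/-- Two branches of ratio above 1/2 have sum above 1, and s/(1+s) is increasing. -/
lemma Bushy.half_lt {x : RT} (h : Bushy x) : 1 / 2 < rho x := by
  induction h with
  | leaf => norm_num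
  | @node ys h h' ih =>
    have hp : ∀ y ∈ ys, 0 < Sa y := fun y hy => (h' y hy).pos.1
    match ys, h, ih, hp with
    | a :: b :: ys, _, ih, hp =>
      have h1 := ih a (by simp)
      have h2 := ih b (by simp)
      have h3 := sg_nonneg ys
      have := lt_rho_N hp (c := 1) (by simp only [sg_cons]; linarith) (by norm_num)
      linarith

lemma Bushy.lt_one {x : RT} (h : Bushy x) (hx : x ≠ RT.leaf) : rho x < 1 := by
  cases h with
  | leaf => exact absurd rfl hx
  | node h h' => exact rho_N_lt_one fun y hy => (h' y hy).pos.1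

lemma Bushy.exists_N {x : RT} (h : Bushy x) (hx : x ≠ RT.leaf) :
    ∃ ys, x = N ys ∧ 2 ≤ ys.length ∧ ∀ y ∈ ys, Bushy y := by
  cases h with
  | leaf => exact absurd rfl hx
  | @node ys h h' => exact ⟨ys, rfl, h, h'⟩

lemma N_ne_leaf (ys : List RT) : N ys ≠ leaf := by simp [N, RT.mk]

lemma N_injective {ys zs : List RT} (h : N ys = N zs) : ys = zs := by
  have h1 : RT.mk ys = RT.mk zs := by
    simp only [N, RT.mk, RT.join.injEq, true_and] at h
    exact h
  have : ∀ us, branches (RT.mk us) = us := by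
    intro us
    induction us with
    | nil => rfl
    | cons u us ih => rw [RT.mk, branches, ih]
  rw [← this ys, ← this zs, h1]

lemma Bushy.of_N {ys : List RT} (h : Bushy (N ys)) : 2 ≤ ys.length ∧ ∀ y ∈ ys, Bushy y := by
  obtain ⟨zs, h1, h2, h3⟩ := h.exists_N (N_ne_leaf ys)
  rw [N_injective h1]
  exact ⟨h2, h3⟩

/-! ### Coefficients of paths in both directions -/

lemma up_append (p q : List (List RT)) (u : RT) : up (p ++ q) u = up p (up q u) := by
  induction p with
  | nil => rfl
  | cons ys p ih => rw [List.cons_append, up, up, ih]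

/-- In this parametrisation reversing the path just exchanges `k₁` and `k₂`. -/
lemma exists_path_coeff_reverse {p : List (List RT)} (hp : ∀ ys ∈ p, ∀ y ∈ ys, Bushy y) :
    ∃ k₀ k₁ k₂ k₃ : ℚ, 0 ≤ k₀ ∧ 0 < k₁ ∧ 0 < k₂ ∧ 0 < k₃ ∧ k₀ * k₃ < k₁ * k₂ ∧
      (∀ u, Sa (up p u) = k₁ * Sa u + (k₃ - k₁) * Za u ∧
        Za (up p u) = k₀ * Sa u + (k₂ - k₀) * Za u) ∧
      (∀ u, Sa (up p.reverse u) = k₂ * Sa u + (k₃ - k₂) * Za u ∧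
        Za (up p.reverse u) = k₀ * Sa u + (k₁ - k₀) * Za u) := by
  induction p with
  | nil => exact ⟨0, 1, 1, 1, by norm_num, by norm_num, by norm_num, by norm_num, by norm_num,
      fun u => by simp [up], fun u => by simp [up]⟩
  | cons ys p ih =>
    obtain ⟨a, b, c, d, ha, hb, hc, hd, hdet, h1, h2⟩ := ih fun ys hy => hp ys (by simp [hy])
    have hw : 0 < Zb (mk ys) := Zb_pos_of fun y hy => (hp ys (by simp) y hy).pos.1
    have hv : 0 ≤ Sb (mk ys) := Sb_nonneg _
    have e1 : ∀ u, Sb (mk (u :: ys)) = _ := fun u => Sb_cons _ _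
    have e2 : ∀ u, Zb (mk (u :: ys)) = _ := fun u => Zb_cons _ _
    generalize hW : Zb (mk ys) = w at *
    generalize hV : Sb (mk ys) = v at *
    refine ⟨v * b + w * a, (v + w) * b + w * a, v * d + w * c, (v + w) * d + w * c,
      by positivity, by positivity, by positivity, by positivity, ?_, ?_, ?_⟩
    · have := mul_lt_mul_of_pos_left hdet (mul_pos hw hw)
      linarith
    · intro u
      rw [up, Sa_N, Za_N, e1, e2, (h1 u).1, (h1 u).2]
      constructor <;> ring
    · intro u
      rw [List.reverse_cons, up_append, (h2 _).1, (h2 _).2]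
      simp only [up]
      rw [Sa_N, Za_N, e1, e2]
      constructor <;> ring

end RT

end OptimalTree

namespace OptimalTree

open RT

namespace RT

/-! ### Exchanges along paths -/

lemma bushy_of_up {p : List (List RT)} {u : RT} (h : Bushy (up p u)) :
    (∀ ys ∈ p, ∀ y ∈ ys, Bushy y) ∧ Bushy u := by
  induction p with
  | nil => exact ⟨by simp, h⟩
  | cons ys p ih =>
    have h1 := Bushy.of_N h
    have h2 := ih (h1.2 _ (by simp))
    refine ⟨fun zs hz => ?_, h2.2⟩
    rcases List.mem_cons.1 hz with rfl | hz
    · exact fun y hy => h1.2 y (by simp [hy])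
    · exact h2.1 zs hz

lemma bushy_up {p : List (List RT)} {u v : RT} (h : Bushy (up p u)) (hv : Bushy v) :
    Bushy (up p v) := by
  induction p with
  | nil => exact hv
  | cons ys p ih =>
    have h1 := Bushy.of_N h
    refine Bushy.node (by simpa using h1.1) fun y hy => ?_
    rcases List.mem_cons.1 hy with rfl | hy
    · exact ih (h1.2 _ (by simp))
    · exact h1.2 y (by simp [hy])

lemma rho_N_mono {ys zs : List RT} (hy : ∀ y ∈ ys, Bushy y) (hz : ∀ z ∈ zs, Bushy z)
    (h : sg ys ≤ sg zs) : rho (N ys) ≤ rho (N zs) := by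
  rw [rho_N fun z h => (hz z h).pos.1]
  exact rho_N_le (fun y h => (hy y h).pos.1) h

lemma rho_up_mono {p : List (List RT)} {u v : RT} (h : Bushy (up p u)) (hv : Bushy v)
    (huv : rho u ≤ rho v) : rho (up p u) ≤ rho (up p v) := by
  induction p with
  | nil => exact huv
  | cons ys p ih =>
    have h1 := Bushy.of_N h
    have h2 := Bushy.of_N (bushy_up h hv)
    refine rho_N_mono h1.2 h2.2 ?_
    simp only [sg_cons]
    linarith [ih (h1.2 _ (by simp))]

/-- The value is bilinear in the ratio sums of the two ends, so moving branches between the ends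
affects it through these sums only. -/
lemma exists_path_value {p : List (List RT)} (hp : ∀ ys ∈ p, ∀ y ∈ ys, Bushy y) :
    ∃ k₀ k₁ k₂ k₃ : ℚ, 0 ≤ k₀ ∧ 0 < k₁ ∧ 0 < k₂ ∧ 0 < k₃ ∧
      ∀ zs xs, (∀ z ∈ zs, Bushy z) → (∀ x ∈ xs, Bushy x) →
        rho (up p (N zs)) = (k₀ + k₂ * sg zs) / (k₁ + k₃ * sg zs) ∧
        rho (up p.reverse (N xs)) = (k₀ + k₁ * sg xs) / (k₂ + k₃ * sg xs) ∧
        Sb (mk (up p (N zs) :: xs)) = Zb (mk zs) * Zb (mk xs) *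
          (k₀ + k₁ * sg xs + k₂ * sg zs + k₃ * sg zs * sg xs) := by
  obtain ⟨k₀, k₁, k₂, k₃, h0, h1, h2, h3, -, hu, hr⟩ := exists_path_coeff_reverse hp
  refine ⟨k₀, k₁, k₂, k₃, h0, h1, h2, h3, fun zs xs hz hx => ?_⟩
  have pz : ∀ z ∈ zs, 0 < Sa z := fun z h => (hz z h).pos.1
  have px : ∀ x ∈ xs, 0 < Sa x := fun x h => (hx x h).pos.1
  have wz := Zb_pos_of pz
  have wx := Zb_pos_of px
  have sz := sg_nonneg zs
  have sx := sg_nonneg xs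
  have f1 : 0 < k₁ + k₃ * sg zs := by positivity
  have f2 : 0 < k₂ + k₃ * sg xs := by positivity
  refine ⟨?_, ?_, ?_⟩
  · rw [rho, (hu _).1, (hu _).2, Sa_N_eq pz, Za_N_eq pz, div_eq_div_iff _ f1.ne']
    · ring
    · have : 0 < Zb (mk zs) * (k₁ + k₃ * sg zs) := by positivity
      intro h; apply this.ne'; rw [← h]; ring
  · rw [rho, (hr _).1, (hr _).2, Sa_N_eq px, Za_N_eq px, div_eq_div_iff _ f2.ne']
    · ring
    · have : 0 < Zb (mk xs) * (k₂ + k₃ * sg xs) := by positivity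
      intro h; apply this.ne'; rw [← h]; ring
  · rw [Sb_cons, (hu _).1, (hu _).2, Sa_N_eq pz, Za_N_eq pz, Sb_eq px]
    ring

/-- A property of lists of branches at a vertex of type B which passes to all such vertices. -/
structure Rotatable (R : List RT → Prop) : Prop where
  perm : ∀ {xs ys : List RT}, R xs → xs.Perm ys → R ys
  rotN : ∀ {xs ys : List RT}, R (N ys :: xs) → R (N xs :: ys)

lemma Rotatable.zip {R : List RT → Prop} (hR : Rotatable R) {p q : List (List RT)}
    {xs ys zs : List RT} (h : R (up p (N zs) :: up q (N xs) :: ys)) :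
    R (up (p.reverse ++ (ys :: q)) (N xs) :: zs) := by
  induction p generalizing q ys with
  | nil => exact hR.rotN h
  | cons a p ih =>
    have h1 : R (N (up q (N xs) :: ys) :: up p (N zs) :: a) := hR.rotN h
    have := ih (q := ys :: q) (ys := a) (hR.perm h1 (List.Perm.swap _ _ _))
    simpa using this

lemma Rotatable.symm {R : List RT → Prop} (hR : Rotatable R) {p : List (List RT)}
    {xs zs : List RT} (h : R (up p (N zs) :: xs)) : R (up p.reverse (N xs) :: zs) := by
  cases p with
  | nil => exact hR.rotN h
  | cons a p =>
    have h1 : R (N xs :: up p (N zs) :: a) := hR.rotN h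
    have := hR.zip (p := p) (q := []) (xs := xs) (ys := a) (hR.perm h1 (List.Perm.swap _ _ _))
    simpa using this

lemma Rotatable.perm_path {R : List RT → Prop} (hR : Rotatable R) {p : List (List RT)}
    {xs zs zs' : List RT} (h : R (up p (N zs) :: xs)) (hp : zs.Perm zs') :
    R (up p (N zs') :: xs) := by
  have := hR.symm (hR.perm (hR.symm h) (hp.cons _))
  rwa [List.reverse_reverse] at this

end RT

section

variable {V : Type*} [Fintype V] {G : SimpleGraph V}

lemma Rep.bushy_all {xs : List RT} (h : Rep G false xs) (hG : Adm G) : ∀ x ∈ xs, Bushy x :=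
  fun _ hx => h.bushy hG hx

/-- For two vertices of type B with a common neighbour, the value is a fixed factor times sum plus
product of the ratio sums. Redistribution keeps the sum, so optimality maximises the product. -/
lemma Rep.mul_sg_le {ys xs xs' ys' : List RT} (h : Rep G false (N ys :: xs)) (hG : Adm G)
    (hp : (xs' ++ ys').Perm (xs ++ ys)) : sg xs' * sg ys' ≤ sg xs * sg ys := by
  have hb := h.bushy_all hG
  have hy : ∀ y ∈ ys, Bushy y := (Bushy.of_N (hb _ (by simp))).2
  have hall : ∀ z ∈ xs ++ ys, 0 < Sa z := by
    intro z hz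
    rcases List.mem_append.1 hz with hz | hz
    · exact (hb z (by simp [hz])).pos.1
    · exact (hy z hz).pos.1
  have hall' : ∀ z ∈ xs' ++ ys', 0 < Sa z := fun z hz => hall z (hp.mem_iff.1 hz)
  have hs := (hp.map size).sum_eq
  have hsg := sg_perm hp
  have hz := Zb_perm hp
  rw [Zb_append, Zb_append] at hz
  rw [sg_append, sg_append] at hsg
  simp only [List.map_append, List.sum_append] at hs
  have := h.le_of_size hG (ys := N ys' :: xs') (by
    simp only [size_mk, List.map_cons, List.sum_cons, size_N]; omega)
  have p1 : ∀ z ∈ xs, 0 < Sa z := fun z hz => hall z (by simp [hz])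
  have p2 : ∀ z ∈ ys, 0 < Sa z := fun z hz => hall z (by simp [hz])
  have p3 : ∀ z ∈ xs', 0 < Sa z := fun z hz => hall' z (by simp [hz])
  have p4 : ∀ z ∈ ys', 0 < Sa z := fun z hz => hall' z (by simp [hz])
  rw [Sb_cons, Sb_cons, Sa_N_eq p2, Za_N_eq p2, Sa_N_eq p4, Za_N_eq p4, Sb_eq p1, Sb_eq p3] at this
  have hw : 0 < Zb (mk xs) * Zb (mk ys) := mul_pos (Zb_pos_of p1) (Zb_pos_of p2)
  refine le_of_mul_le_mul_left ?_ hw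
  have e1 : Zb (mk xs') * Zb (mk ys') * (sg xs' + sg ys' + sg xs' * sg ys') ≤
      Zb (mk xs) * Zb (mk ys) * (sg xs + sg ys + sg xs * sg ys) := by linarith
  rw [hz, hsg] at e1
  linarith

/-- The untouched branches enter through a common factor and through `sg rest` alone. -/
lemma Rep.exchange {xs xs' rest : List RT} (h : Rep G false (xs ++ rest)) (hG : Adm G)
    (hs : (xs'.map size).sum = (xs.map size).sum) :
    Sb (mk xs') + Zb (mk xs') * sg rest ≤ Sb (mk xs) + Zb (mk xs) * sg rest := by
  have hb := h.bushy_all hG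
  have p : ∀ z ∈ rest, 0 < Sa z := fun z hz => (hb z (by simp [hz])).pos.1
  have hw := Zb_pos_of p
  have := h.le_of_size hG (ys := xs' ++ rest) (by simp [size_mk, hs])
  have key : ∀ l : List RT, Sb (mk (l ++ rest)) = Zb (mk rest) * (Sb (mk l) + Zb (mk l) * sg rest) := by
    intro l
    induction l with
    | nil => simp [Sb_eq p]
    | cons x l ih =>
      rw [List.cons_append, Sb_cons, ih, Zb_append, Sb_cons, Zb_cons]; ring
  rw [key, key] at this
  exact le_of_mul_le_mul_left this hw

lemma Rep.rotatable (hG : Adm G) : Rotatable (Rep G false) :=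
  ⟨fun h hp => h.perm hp, fun h => h.rotN hG⟩

lemma Rep.symm {p : List (List RT)} {xs zs : List RT} (h : Rep G false (up p (N zs) :: xs))
    (hG : Adm G) : Rep G false (up p.reverse (N xs) :: zs) :=
  (Rep.rotatable hG).symm h

lemma Rep.le_of_path {p : List (List RT)} {zs xs zs' xs' : List RT}
    (h : Rep G false (up p (N zs) :: xs)) (hG : Adm G) (hp : (zs' ++ xs').Perm (zs ++ xs)) :
    ∃ k₀ k₁ k₂ k₃ : ℚ, 0 ≤ k₀ ∧ 0 < k₁ ∧ 0 < k₂ ∧ 0 < k₃ ∧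
      (∀ zs xs, (∀ z ∈ zs, Bushy z) → (∀ x ∈ xs, Bushy x) →
        rho (up p (N zs)) = (k₀ + k₂ * sg zs) / (k₁ + k₃ * sg zs) ∧
        rho (up p.reverse (N xs)) = (k₀ + k₁ * sg xs) / (k₂ + k₃ * sg xs)) ∧
      (k₁ * sg xs' + k₂ * sg zs' + k₃ * sg zs' * sg xs') ≤
        (k₁ * sg xs + k₂ * sg zs + k₃ * sg zs * sg xs) := by
  have hb := h.bushy_all hG
  have hu := bushy_of_up (hb _ (List.mem_cons_self ..))
  have hz := (Bushy.of_N hu.2).2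
  have hx : ∀ x ∈ xs, Bushy x := fun x hx => hb x (by simp [hx])
  have hall : ∀ z ∈ zs' ++ xs', Bushy z := by
    intro z hm
    rcases List.mem_append.1 (hp.mem_iff.1 hm) with hm | hm
    · exact hz z hm
    · exact hx z hm
  obtain ⟨k₀, k₁, k₂, k₃, h0, h1, h2, h3, hv⟩ := exists_path_value hu.1
  refine ⟨k₀, k₁, k₂, k₃, h0, h1, h2, h3, fun zs xs hz hx => ⟨(hv zs xs hz hx).1, (hv zs xs hz hx).2.1⟩, ?_⟩
  have hs := (hp.map size).sum_eq
  simp only [List.map_append, List.sum_append] at hs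
  obtain ⟨k, hk⟩ := size_up p
  have := h.le_of_size hG (ys := up p (N zs') :: xs') (by
    simp only [size_mk, List.map_cons, List.sum_cons, size_N, hk]; omega)
  rw [(hv zs xs hz hx).2.2, (hv zs' xs' (fun z h => hall z (by simp [h]))
    (fun z h => hall z (by simp [h]))).2.2] at this
  have hzb := Zb_perm hp
  rw [Zb_append, Zb_append] at hzb
  rw [hzb] at this
  have hw : 0 < Zb (mk zs) * Zb (mk xs) :=
    mul_pos (Zb_pos_of fun z h => (hz z h).pos.1) (Zb_pos_of fun z h => (hx z h).pos.1)
  have := le_of_mul_le_mul_left this hw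
  linarith

/-- Moving a branch to the other end of a path does not increase the value. -/
lemma Rep.rho_add_le {p : List (List RT)} {r : RT} {zs xs : List RT}
    (h : Rep G false (r :: up p (N zs) :: xs)) (hG : Adm G) :
    rho (up p (N zs)) + sg xs ≤ rho (up p.reverse (N xs)) + sg zs := by
  have h' := h.perm (List.Perm.swap _ _ _)
  have hb := h'.bushy_all hG
  have hz := (Bushy.of_N (bushy_of_up (hb _ (List.mem_cons_self ..))).2).2
  have hx : ∀ x ∈ xs, Bushy x := fun x hx => hb x (by simp [hx])
  obtain ⟨k₀, k₁, k₂, k₃, h0, h1, h2, h3, hv, hle⟩ := h'.le_of_path hG (zs' := r :: zs) (xs' := xs)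
    List.perm_middle.symm
  obtain ⟨e1, e2⟩ := hv zs xs hz hx
  have sz := sg_nonneg zs
  have sx := sg_nonneg xs
  have hr : 0 < rho r := by linarith [(hb r (by simp)).half_lt]
  simp only [sg_cons] at hle
  -- The contribution of `r` is its ratio times the slope of the value at the end where it hangs.
  have hk : k₂ + k₃ * sg xs ≤ k₁ + k₃ * sg zs := by
    refine le_of_mul_le_mul_left ?_ hr
    linarith
  have f1 : 0 < k₁ + k₃ * sg zs := by positivity
  have f2 : 0 < k₂ + k₃ * sg xs := by positivity
  rw [e1, e2, div_add' _ _ _ f1.ne', div_add' _ _ _ f2.ne', div_le_div_iff₀ f1 f2]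
  have : 0 ≤ (k₀ + k₁ * sg xs + k₂ * sg zs + k₃ * sg zs * sg xs) *
      ((k₁ + k₃ * sg zs) - (k₂ + k₃ * sg xs)) := by
    apply mul_nonneg
    · positivity
    · linarith
  linarith

/-- Exchanging two branches at the ends of a path does not increase the value. -/
lemma Rep.rho_add_le_of_lt {p : List (List RT)} {r r' : RT} {zs xs : List RT}
    (h : Rep G false (r :: up p (N (r' :: zs)) :: xs)) (hG : Adm G) (hr : rho r < rho r') :
    rho (up p.reverse (N xs)) + sg zs ≤ rho (up p (N zs)) + sg xs := by
  have h' := h.perm (List.Perm.swap _ _ _)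
  have hb := h'.bushy_all hG
  have hz := (Bushy.of_N (bushy_of_up (hb _ (List.mem_cons_self ..))).2).2
  have hx : ∀ x ∈ xs, Bushy x := fun x hx => hb x (by simp [hx])
  obtain ⟨k₀, k₁, k₂, k₃, h0, h1, h2, h3, hv, hle⟩ := h'.le_of_path hG (zs' := r :: zs)
    (xs' := r' :: xs) (by
      refine ((List.perm_middle (l₁ := r :: zs)).trans ?_)
      simp only [List.cons_append]
      exact List.Perm.cons _ List.perm_middle.symm)
  obtain ⟨e1, e2⟩ := hv zs xs (fun z h => hz z (by simp [h])) hx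
  have sz := sg_nonneg zs
  have sx := sg_nonneg xs
  simp only [sg_cons] at hle
  have hk : k₁ + k₃ * sg zs ≤ k₂ + k₃ * sg xs := by
    refine le_of_mul_le_mul_left ?_ (sub_pos.2 hr)
    linarith
  have f1 : 0 < k₁ + k₃ * sg zs := by positivity
  have f2 : 0 < k₂ + k₃ * sg xs := by positivity
  rw [e1, e2, div_add' _ _ _ f1.ne', div_add' _ _ _ f2.ne', div_le_div_iff₀ f2 f1]
  have : 0 ≤ (k₀ + k₁ * sg xs + k₂ * sg zs + k₃ * sg zs * sg xs) *
      ((k₂ + k₃ * sg xs) - (k₁ + k₃ * sg zs)) := by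
    apply mul_nonneg
    · positivity
    · linarith
  linarith

end

end OptimalTree

namespace OptimalTree

open RT

namespace RT

/-! ### Vertices with many leaves and forks -/

/-- A vertex of type A, joined to a vertex of type B with two leaves. -/
def fork : RT := N [RT.leaf, RT.leaf]

@[simp] lemma Sa_fork : Sa fork = 3 := by simp [fork, Sa_N, Sb_cons, Zb_cons]; norm_num
@[simp] lemma Za_fork : Za fork = 2 := by simp [fork, Za_N, Sb_cons, Zb_cons]; norm_num
@[simp] lemma rho_fork : rho fork = 2 / 3 := by simp [rho]
@[simp] lemma size_fork : size fork = 4 := rfl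
lemma Bushy.fork : Bushy fork := .node (by simp) (by simp [Bushy.leaf])
lemma fork_ne_leaf : fork ≠ RT.leaf := N_ne_leaf _
@[simp] lemma size_leaf : size RT.leaf = 1 := rfl

lemma exists_min_rho {l : List RT} (h : l ≠ []) : ∃ m ∈ l, ∀ u ∈ l, rho m ≤ rho u := by
  obtain ⟨m, hm, h⟩ := Set.exists_min_image {x | x ∈ l} rho l.finite_toSet
    (List.exists_mem_of_ne_nil l h)
  exact ⟨m, hm, h⟩

end RT

section

variable {V : Type*} [Fintype V] {G : SimpleGraph V}

/-- Replacing four leaves by a fork changes the factor from 4 + σ to 2 + 3σ, where σ is `sg rest`.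
-/
lemma Rep.sg_le_one {rest : List RT}
    (h : Rep G false (RT.leaf :: RT.leaf :: RT.leaf :: RT.leaf :: rest)) (hG : Adm G) :
    sg rest ≤ 1 := by
  have := Rep.exchange (xs := [RT.leaf, RT.leaf, RT.leaf, RT.leaf]) (xs' := [fork]) h hG (by simp)
  simp [Sb_cons, Zb_cons] at this
  linarith

lemma Rep.not_four_leaves {rest : List RT}
    (h : Rep G false (RT.leaf :: RT.leaf :: RT.leaf :: RT.leaf :: rest)) (hG : Adm G) : False := by
  have hb := h.bushy_all hG
  have h1 := h.sg_le_one hG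
  match rest, h, hb, h1 with
  | [], h, _, _ => exact hG.not_exc h.isExceptional_T5
  | a :: b :: l, h, hb, h1 =>
    have h2 := (hb a (by simp)).half_lt
    have h3 := (hb b (by simp)).half_lt
    have h4 := sg_nonneg l
    simp only [sg_cons] at h1
    linarith
  | [a], h, hb, _ =>
    by_cases ha : a = RT.leaf
    · subst ha
      exact hG.not_exc h.isExceptional_T6₁
    obtain ⟨xs, rfl, hl, hx⟩ := (hb a (by simp)).exists_N ha
    have h0 : Rep G false (N xs :: [RT.leaf, RT.leaf, RT.leaf, RT.leaf]) :=
      h.perm (List.perm_append_comm (l₁ := [RT.leaf, RT.leaf, RT.leaf, RT.leaf]))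
    -- Moving one leaf to the next vertex of type B shows that `sg xs` is at least 3.
    have h1 := h0.mul_sg_le hG (xs' := [RT.leaf, RT.leaf, RT.leaf]) (ys' := RT.leaf :: xs) (by
      exact List.Perm.refl _)
    simp at h1
    have h2 := sg_le_length xs
    match xs, hl, hx, h0, h1, h2 with
    | [a, b], _, _, _, h1, h2 =>
      simp at h2 h1
      linarith
    | a :: b :: c :: l, _, hx, h0, h1, h2 =>
      have h3 := Rep.exchange (xs := [N [RT.leaf, RT.leaf, RT.leaf, RT.leaf], a, b])
        (xs' := [N [a, b], fork]) (h0.rotN hG) hG (by simp [size_N, size_mk]; omega)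
      have pa := (hx a (by simp)).pos.1
      have pb := (hx b (by simp)).pos.1
      have ha := (hx a (by simp)).half_lt
      have hb := (hx b (by simp)).half_lt
      have ha1 := rho_le_one a
      have hb1 := rho_le_one b
      simp [Sb_cons, Zb_cons, Sa_N, Za_N] at h3
      rw [Za_eq pa, Za_eq pb] at h3
      simp at h1
      have h4 : (Sa a * Sa b) * ((rho c + sg l) * (3 * (rho a + rho b) - 2) - 2) ≤ 0 := by linarith
      have h5 := nonpos_of_mul_nonpos_right h4 (mul_pos pa pb)
      generalize rho c + sg l = t at *
      nlinarith [mul_pos (show 0 < rho a + rho b - 1 by linarith) (show 0 < 8 - 3 * (rho a + rho b) by linarith)]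

/-- Otherwise trading two branches for a leaf of the fork would increase the product of the two
ratio sums. -/
lemma Rep.length_le_three_of_fork {xs : List RT} (h : Rep G false (fork :: xs)) (hG : Adm G) :
    xs.length ≤ 3 := by
  by_contra! hl
  match xs, hl, h with
  | a :: b :: c :: d :: l, _, h =>
    have hb := h.bushy_all hG
    have ha := (hb a (by simp)).half_lt
    have hb' := (hb b (by simp)).half_lt
    have hc := (hb c (by simp)).half_lt
    have hd := (hb d (by simp)).half_lt
    have hs := sg_nonneg l
    have := Rep.mul_sg_le (ys := [RT.leaf, RT.leaf]) h hG (xs' := RT.leaf :: c :: d :: l)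
      (ys' := [RT.leaf, a, b]) (by
        rw [← Multiset.coe_eq_coe]
        simp only [← Multiset.coe_add, ← Multiset.cons_coe, Multiset.coe_nil, ← Multiset.singleton_add]
        abel)
    simp at this
    nlinarith [mul_pos (show 0 < rho a + rho b - 1 by linarith)
      (show 0 < rho c + rho d + sg l - 1 by linarith)]

/-- Let s be the ratio sum inside a branch of least ratio. Moving another branch there shows that
the at least three remaining ratios sum to at most s. Hence 3s/(1+s) ≤ s, so s ≥ 2 and the ratio is
at least 2/3. -/
lemma Rep.two_thirds_le {xs : List RT} (h : Rep G false xs) (hG : Adm G) (hl : 5 ≤ xs.length) :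
    ∀ x ∈ xs, 2 / 3 ≤ rho x := by
  obtain ⟨m, hm, hmin⟩ := exists_min_rho (l := xs) (by rintro rfl; simp at hl)
  suffices 2 / 3 ≤ rho m from fun x hx => this.trans (hmin x hx)
  by_contra! hlt
  obtain ⟨l, hp⟩ := perm_cons_of_mem hm
  have h' := h.perm hp
  have hlen := hp.length_eq
  have hmin' : ∀ u ∈ l, rho m ≤ rho u := fun u hu => hmin u (hp.mem_iff.2 (by simp [hu]))
  have hb := h'.bushy_all hG
  obtain ⟨ys, rfl, h2, hy⟩ := (hb m (by simp)).exists_N (by rintro rfl; norm_num at hlt)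
  match l, hlen, h', hmin', hb with
  | [], hlen, _, _, _ => simp at hlen; omega
  | r :: l, hlen, h', hmin', hb =>
    have := h'.mul_sg_le hG (xs' := l) (ys' := r :: ys) List.perm_middle
    simp only [sg_cons] at this
    have h3 := mul_length_le_sg fun u hu => hmin' u (List.mem_cons_of_mem r hu)
    have hl3 : (3 : ℚ) ≤ l.length := by
      have : 3 ≤ l.length := by simp at hlen; omega
      exact_mod_cast this
    have hρ := rho_nonneg (N ys)
    have h4 : rho (N ys) * 3 ≤ sg l := (mul_le_mul_of_nonneg_left hl3 hρ).trans h3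
    have hr : 0 < rho r := by linarith [(hb r (by simp)).half_lt]
    have h5 : sg l ≤ sg ys := by
      refine le_of_mul_le_mul_left ?_ hr
      linarith
    have h6 := sg_nonneg ys
    have hys : 1 < sg ys := by
      have := (hb (N ys) (by simp)).half_lt
      rw [rho_N fun y h => (hy y h).pos.1, div_lt_div_iff₀ (by norm_num) (by linarith)] at this
      linarith
    have h7 := h4.trans h5
    rw [rho_N fun y h => (hy y h).pos.1] at hlt h7
    rw [div_lt_div_iff₀ (by linarith) (by norm_num)] at hlt
    rw [div_mul_eq_mul_div, div_le_iff₀ (by linarith)] at h7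
    nlinarith

end

end OptimalTree

namespace OptimalTree

open RT

namespace RT

/-! ### Trees with a fork and a vertex of degree five -/

/-- The branch contains a vertex of type B of degree three with two leaves, away from the root. -/
inductive HasFork : RT → Prop
  | fork : HasFork fork
  | node {y : RT} {ys : List RT} (hy : y ∈ ys) (h : HasFork y) : HasFork (N ys)

/-- The tree with the given branches at a vertex of type B contains a vertex of type B of degree
three with two leaves. -/
def ForkAt (xs : List RT) : Prop :=
  (∃ x ∈ xs, HasFork x) ∨ ∃ u, u ≠ RT.leaf ∧ xs.Perm [u, RT.leaf, RT.leaf]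

/-- Reordering branches puts the fork at the end of an explicit path. The second part is stated for
every rotatable property, so that it applies both to `Rep G false` and to `ForkAt`. -/
lemma HasFork.exists_path {x : RT} (h : HasFork x) : ∃ p, rho (up p RT.fork) = rho x ∧
    ∀ {R : List RT → Prop}, Rotatable R → ∀ xs, R (x :: xs) → R (up p RT.fork :: xs) := by
  suffices ∃ p, (Sa (up p RT.fork) = Sa x ∧ Za (up p RT.fork) = Za x) ∧
    ∀ {R : List RT → Prop}, Rotatable R → ∀ xs, R (x :: xs) → R (up p RT.fork :: xs) by
    obtain ⟨p, ⟨h1, h2⟩, h3⟩ := this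
    exact ⟨p, by rw [rho, rho, h1, h2], h3⟩
  induction h with
  | fork => exact ⟨[], ⟨rfl, rfl⟩, fun _ xs h => h⟩
  | @node y ys hy h ih =>
    obtain ⟨p, ⟨h1, h2⟩, h3⟩ := ih
    obtain ⟨l, hl⟩ := perm_cons_of_mem hy
    refine ⟨l :: p, ?_, fun {R} hR xs h => ?_⟩
    · rw [up, Sa_N, Za_N, Sa_N, Za_N, Sb_perm hl, Zb_perm hl, Sb_cons, Zb_cons, Sb_cons, Zb_cons,
        h1, h2]
      simp
    · have e := h3 hR _ (hR.perm (hR.rotN h) ((hl.cons _).trans (List.Perm.swap _ _ _)))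
      exact hR.rotN (hR.perm e (List.Perm.swap _ _ _))

lemma forkAt_rotatable : Rotatable ForkAt := by
  constructor
  · rintro xs ys (⟨x, hx, h⟩ | ⟨y, h⟩) hp
    · exact .inl ⟨x, hp.mem_iff.1 hx, h⟩
    · exact .inr ⟨y, h.1, hp.symm.trans h.2⟩
  · rintro xs ys (⟨x, hx, h⟩ | ⟨u, hu, h⟩)
    · rcases List.mem_cons.1 hx with rfl | hx
      · by_cases hf : ys = [RT.leaf, RT.leaf]
        · subst hf
          exact .inr ⟨N xs, N_ne_leaf _, List.Perm.refl _⟩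
        · generalize hg : N ys = u at h
          cases h with
          | fork => exact absurd (N_injective hg) hf
          | @node y ws hy h =>
            rw [N_injective hg]
            exact .inl ⟨y, by simp [hy], h⟩
      · exact .inl ⟨N xs, by simp, .node hx h⟩
    · refine .inl ⟨N xs, by simp, ?_⟩
      have hm : N ys ∈ [u, RT.leaf, RT.leaf] := h.mem_iff.1 (by simp)
      have : N ys = u := by simpa [N_ne_leaf] using hm
      subst this
      have h2 : xs.Perm (List.replicate 2 RT.leaf) := h.cons_inv
      rw [List.perm_replicate.1 h2]
      exact .fork

lemma up_fork_concat (p : List (List RT)) (t : List RT) :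
    up (p ++ [t]) fork = up p (N (fork :: t)) := by
  rw [up_append]; rfl

lemma exists_up_reverse (p : List (List RT)) (xs : List RT) : ∃ ts, up p.reverse (N xs) = N ts := by
  cases h : p.reverse with
  | nil => exact ⟨xs, rfl⟩
  | cons a q => exact ⟨_, rfl⟩

end RT

section

variable {V : Type*} [Fintype V] {G : SimpleGraph V}

lemma Rep.exists_path_of_fork {x : RT} {xs : List RT} (h : Rep G false (x :: xs)) (hG : Adm G)
    (hf : ForkAt (x :: xs)) (hx : HasFork x) (hl : 4 ≤ xs.length) : ∃ q t, rho (up q (N (fork :: t))) = rho x ∧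
      Rep G false (up q (N (fork :: t)) :: xs) ∧ ForkAt (up q (N (fork :: t)) :: xs) ∧
        t.length ≤ 2 := by
  obtain ⟨p, h1, h2⟩ := hx.exists_path
  have h3 := h2 (Rep.rotatable hG) xs h
  have hf3 := h2 forkAt_rotatable xs hf
  rcases List.eq_nil_or_concat p with rfl | ⟨q, t, rfl⟩
  · have := Rep.length_le_three_of_fork h3 hG
    omega
  · rw [List.concat_eq_append, up_fork_concat] at h1 h3 hf3
    refine ⟨q, t, h1, h3, hf3, ?_⟩
    have h4 := h3.symm hG
    have := Rep.length_le_three_of_fork (h4.perm (List.Perm.swap _ _ _)) hG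
    simpa [Nat.lt_succ_iff] using this

/-- Moving `r` to the fork cannot help. The fork offers two leaves and, looking back, a branch with
inner ratio sum at most 3, hence ratio at most 3/4. -/
lemma Rep.fork_path_le {q : List (List RT)} {r : RT} {t xs : List RT}
    (h : Rep G false (r :: up q (N (fork :: t)) :: xs)) (hG : Adm G) (ht : t.length ≤ 2) (hl : 2 ≤ xs.length) :
    rho (up q (N (fork :: t))) + sg xs ≤ 2 + 3 / 4 := by
  have h0 : Rep G false (r :: up (q ++ [t]) (N [RT.leaf, RT.leaf]) :: xs) := by
    rw [up_append]; exact h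
  have h1 := h0.rho_add_le hG
  have e : up (q ++ [t]).reverse (N xs) = N (up q.reverse (N xs) :: t) := by simp [up]
  have hb := Rep.bushy_all (Rep.symm (h.perm (List.Perm.swap _ _ _)) hG) hG
  have hr : rho (N (up q.reverse (N xs) :: t)) ≤ 3 / 4 := by
    have hu : Bushy (up q.reverse (N (r :: xs))) := hb _ (by simp)
    have hx : Bushy (N xs) := .node hl fun x hx => (h.bushy_all hG) x (by simp [hx])
    have hv := bushy_up hu hx
    have h3 : sg (up q.reverse (N xs) :: t) ≤ 3 := by
      have h4 := sg_le_length (up q.reverse (N xs) :: t)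
      have h5 : ((up q.reverse (N xs) :: t).length : ℚ) ≤ 3 := by
        exact_mod_cast (show (up q.reverse (N xs) :: t).length ≤ 3 by simpa using Nat.succ_le_succ ht)
      exact h4.trans h5
    refine (rho_N_le (fun y hy => ?_) h3).trans (by norm_num)
    rcases List.mem_cons.1 hy with rfl | hy
    · exact hv.pos.1
    · exact (hb y (by simp [hy])).pos.1
  have e2 : up (q ++ [t]) (N [RT.leaf, RT.leaf]) = up q (N (fork :: t)) := by
    rw [up_append]; rfl
  rw [e, e2] at h1
  simp at h1
  linarith

/-- By `Rep.fork_path_le` the ratios with one branch omitted sum to at most 11/4. All are at least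
2/3, so five of them do not fit, and among four each is at most 11/4 - 2 = 3/4. -/
lemma Rep.bounds_of_forkAt {xs : List RT} (h : Rep G false xs) (hG : Adm G) (hf : ForkAt xs)
    (hl : 5 ≤ xs.length) : xs.length = 5 ∧ ∀ x ∈ xs, 2 / 3 ≤ rho x ∧ rho x ≤ 3 / 4 := by
  have hlow := h.two_thirds_le hG hl
  obtain ⟨x, hx, hx'⟩ : ∃ x ∈ xs, HasFork x := by
    rcases hf with h | ⟨u, _, h⟩
    · exact h
    · have := h.length_eq
      simp at this
      omega
  obtain ⟨ys, hp⟩ := perm_cons_of_mem hx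
  have h1 := h.perm hp
  obtain ⟨q, t, hr, h2, -, ht⟩ := h1.exists_path_of_fork hG (forkAt_rotatable.perm hf hp) hx' (by
    have := hp.length_eq; simp at this; omega)
  have key : ∀ r zs, ys.Perm (r :: zs) → rho x + sg zs ≤ 2 + 3 / 4 := by
    intro r zs hz
    have := (h2.perm ((hz.cons _).trans (List.Perm.swap _ _ _))).fork_path_le hG ht (by
      have := hz.length_eq; have := hp.length_eq; simp at *; omega)
    rwa [hr] at this
  have hlow' : ∀ y ∈ x :: ys, 2 / 3 ≤ rho y := fun y hy => hlow y (hp.mem_iff.2 hy)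
  have hlen := hp.length_eq
  suffices ys.length = 4 ∧ ∀ y ∈ x :: ys, rho y ≤ 3 / 4 from
    ⟨by simp [hlen, this.1], fun y hy => ⟨hlow y hy, this.2 y (hp.mem_iff.1 hy)⟩⟩
  have hx0 := hlow' x (by simp)
  match ys, hlen, hlow', key with
  | [a, b, c, d], hlen, hlow', key =>
    have ha := hlow' a (by simp)
    have hb := hlow' b (by simp)
    have hc := hlow' c (by simp)
    have hd := hlow' d (by simp)
    have k1 := key a [b, c, d] (.refl _)
    have k2 := key b [a, c, d] (List.Perm.swap _ _ _)
    simp at k1 k2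
    simp
    refine ⟨?_, ?_, ?_, ?_, ?_⟩ <;> linarith
  | a :: b :: c :: d :: e :: l, hlen, hlow', key =>
    have hb := hlow' b (by simp)
    have hc := hlow' c (by simp)
    have hd := hlow' d (by simp)
    have he := hlow' e (by simp)
    have k1 := key a _ (.refl _)
    simp at k1
    linarith [sg_nonneg l]
  | [], hlen, _, _ => simp at hlen; omega
  | [_], hlen, _, _ => simp at hlen; omega
  | [_, _], hlen, _, _ => simp at hlen; omega
  | [_, _, _], hlen, _, _ => simp at hlen; omega

/-- The inner ratio sum is at most 3: there are at most three branches, or four of ratio at most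
3/4. -/
lemma Rep.rho_le_of_forkAt {ts xs : List RT} (h : Rep G false (N ts :: xs)) (hG : Adm G)
    (hf : ForkAt (N ts :: xs)) : rho (N ts) ≤ 3 / 4 := by
  have ht := (Bushy.of_N (h.bushy_all hG (N ts) (by simp))).2
  have : sg ts ≤ 3 := by
    by_cases hl : ts.length ≤ 3
    · exact (sg_le_length ts).trans (by exact_mod_cast hl)
    · have h1 := (h.rotN hG).bounds_of_forkAt hG (forkAt_rotatable.rotN hf) (by simp; omega)
      have h2 := sg_le_mul_length fun t ht => (h1.2 t (List.mem_cons_of_mem _ ht)).2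
      have h3 : ts.length = 4 := by simpa using h1.1
      rw [h3] at h2
      norm_num at h2
      exact h2
  exact (rho_N_le (fun y hy => (ht y hy).pos.1) this).trans (by norm_num)

lemma Rep.rho_le_of_ne_leaf {x : RT} {xs : List RT} (h : Rep G false (x :: xs)) (hG : Adm G)
    (hf : ForkAt (x :: xs)) (hx : x ≠ RT.leaf) : rho x ≤ 3 / 4 := by
  obtain ⟨ts, rfl, -⟩ := (h.bushy_all hG x (by simp)).exists_N hx
  exact h.rho_le_of_forkAt hG hf

/-- Moving a branch from the vertex of degree five to the far end gives 4 · 2/3 ≤ 3/4 + `sg zs`, and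
8/3 - 3/4 = 23/12. -/
lemma Rep.le_sg_of_path {p : List (List RT)} {zs xs : List RT}
    (h : Rep G false (up p (N zs) :: xs)) (hG : Adm G) (hf : ForkAt (up p (N zs) :: xs))
    (hl : 4 ≤ xs.length) : 23 / 12 ≤ sg zs := by
  obtain ⟨hlen, hb⟩ := h.bounds_of_forkAt hG hf (by simp; omega)
  match xs, hlen, h, hf, hb with
  | [a, b, c, d], _, h, hf, hb =>
    have h1 := (h.perm (List.Perm.swap _ _ _)).rho_add_le hG
    have hs := h.symm hG
    obtain ⟨ts, ht⟩ := exists_up_reverse p [a, b, c, d]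
    have h2 : rho (up p.reverse (N [a, b, c, d])) ≤ 3 / 4 := by
      have hf' := forkAt_rotatable.symm hf
      rw [ht] at hf' hs ⊢
      exact hs.rho_le_of_forkAt hG hf'
    have h3 : rho (up p.reverse (N [b, c, d])) ≤ rho (up p.reverse (N [a, b, c, d])) := by
      have hB := h.bushy_all hG
      refine rho_up_mono (bushy_up (hs.bushy_all hG _ (List.mem_cons_self ..))
        (.node (by simp) ?_)) (.node (by simp) ?_) (rho_N_mono ?_ ?_ ?_)
      · simp at hB; simp; tauto
      · simp at hB; simp; tauto
      · simp at hB; simp; tauto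
      · simp at hB; simp; tauto
      · simp; linarith [rho_nonneg a]
    simp at hb h1
    linarith
  | [], h, _, _, _ => simp at h
  | [_], h, _, _, _ => simp at h
  | [_, _], h, _, _, _ => simp at h
  | [_, _, _], h, _, _, _ => simp at h
  | _ :: _ :: _ :: _ :: _ :: _, h, _, _, _ => simp at h

end
end OptimalTree

namespace OptimalTree

open RT

-- Branches of ratio two thirds beyond a vertex of degree five

namespace RT

/-- A caterpillar-like branch built from forks, in which every inner vertex of type B has degree four. -/
def ternary : ℕ → RT
  | 0 => fork
  | n + 1 => N [fork, fork, ternary n]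

lemma ternary_values (n : ℕ) : Sa (ternary n) = 3 * 27 ^ n ∧ Za (ternary n) = 2 * 27 ^ n ∧
    size (ternary n) = 4 + 10 * n := by
  induction n with
  | zero => simp [ternary]
  | succ n ih =>
    obtain ⟨h1, h2, h3⟩ := ih
    simp [ternary, Sa_N, Za_N, Sb_cons, Zb_cons, size_N, size_mk, h1, h2, h3]
    refine ⟨by ring, by ring, by ring⟩

end RT

section

variable {V : Type*} [Fintype V] {G : SimpleGraph V}

/-- A nontrivial `a` would leave a ratio sum of at most 3/4 + 1, below 23/12. -/
lemma Rep.leaf_of_path_left {p : List (List RT)} {a b : RT} {xs : List RT}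
    (h : Rep G false (up p (N [a, b]) :: xs)) (hG : Adm G) (hf : ForkAt (up p (N [a, b]) :: xs))
    (hl : 4 ≤ xs.length) : a = RT.leaf := by
  by_contra ha
  have h1 := h.le_sg_of_path hG hf hl
  have h2 := Rep.rho_le_of_ne_leaf ((h.symm hG).perm (List.Perm.swap _ _ _)) hG
    (forkAt_rotatable.perm (forkAt_rotatable.symm hf) (List.Perm.swap _ _ _)) ha
  simp at h1
  linarith [rho_le_one b]

lemma Rep.leaf_of_path {p : List (List RT)} {a b : RT} {xs : List RT}
    (h : Rep G false (up p (N [a, b]) :: xs)) (hG : Adm G) (hf : ForkAt (up p (N [a, b]) :: xs))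
    (hl : 4 ≤ xs.length) : a = RT.leaf ∧ b = RT.leaf :=
  ⟨h.leaf_of_path_left hG hf hl, Rep.leaf_of_path_left
    ((Rep.rotatable hG).perm_path h (List.Perm.swap _ _ _)) hG
    (forkAt_rotatable.perm_path hf (List.Perm.swap _ _ _)) hl⟩

lemma Rep.bushy_path {p : List (List RT)} {zs xs : List RT}
    (h : Rep G false (up p (N zs) :: xs)) (hG : Adm G) : 2 ≤ zs.length ∧ ∀ z ∈ zs, Bushy z :=
  Bushy.of_N (bushy_of_up (h.bushy_all hG _ (List.mem_cons_self ..))).2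

lemma Rep.two_thirds_le_of_path (hG : Adm G) {xs : List RT} (hl : 4 ≤ xs.length) :
    ∀ (n : ℕ) {p : List (List RT)} {zs : List RT}, size (N zs) = n →
      Rep G false (up p (N zs) :: xs) → ForkAt (up p (N zs) :: xs) →
      (∀ z ∈ zs, 2 / 3 ≤ rho z) ∧ 2 / 3 ≤ rho (N zs) := by
  intro n
  induction n using Nat.strong_induction_on with
  | _ n ih =>
    intro p zs hn h hf
    obtain ⟨hlen, hB⟩ := h.bushy_path hG
    have hz : ∀ z ∈ zs, 2 / 3 ≤ rho z := by
      intro z hz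
      by_cases hzl : z = RT.leaf
      · subst hzl; norm_num
      obtain ⟨ws, rfl, -, hws⟩ := (hB z hz).exists_N hzl
      obtain ⟨l, hp⟩ := perm_cons_of_mem hz
      have h1 := (Rep.rotatable hG).perm_path h hp
      have hf1 := forkAt_rotatable.perm_path hf hp
      have e : up p (N (N ws :: l)) = up (p ++ [l]) (N ws) := by rw [up_append]; rfl
      rw [e] at h1 hf1
      refine (ih _ ?_ rfl h1 hf1).2
      rw [← hn, size_N zs, size_perm hp]
      exact Nat.lt_succ_of_lt (size_le_of_mem (by simp))
    refine ⟨hz, ?_⟩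
    have h2 : 2 ≤ sg zs := by
      match zs, hlen, h, hf, hz with
      | [a, b], _, h, hf, hz =>
        obtain ⟨rfl, rfl⟩ := h.leaf_of_path hG hf hl
        simp; norm_num
      | a :: b :: c :: l, _, h, hf, hz =>
        have := sg_nonneg l
        simp at hz ⊢
        linarith
    exact (by norm_num : (2 / 3 : ℚ) = 2 / (1 + 2)).le.trans
      (le_rho_N (fun z hz => (hB z hz).pos.1) h2 (by norm_num))

/-- All ratios are at least 2/3, so ratio 2/3 forces inner ratio sum 2: two leaves, or three
branches of ratio 2/3 again. Only the values and sizes are recorded, as they depend on the number of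
such vertices alone. -/
lemma Rep.ternary_of_path (hG : Adm G) {xs : List RT} (hl : 4 ≤ xs.length) :
    ∀ (n : ℕ) {p : List (List RT)} {zs : List RT}, size (N zs) = n →
      Rep G false (up p (N zs) :: xs) → ForkAt (up p (N zs) :: xs) → rho (N zs) ≤ 2 / 3 →
      ∃ j : ℕ, Sa (N zs) = 3 * 27 ^ j ∧ Za (N zs) = 2 * 27 ^ j ∧ size (N zs) = 4 + 10 * j := by
  intro n
  induction n using Nat.strong_induction_on with
  | _ n ih =>
    intro p zs hn h hf hr
    obtain ⟨hlen, hB⟩ := h.bushy_path hG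
    have hz := (Rep.two_thirds_le_of_path hG hl _ rfl h hf).1
    have hs : sg zs ≤ 2 := by
      by_contra! hs
      have := lt_rho_N (fun z hz => (hB z hz).pos.1) hs (by norm_num)
      norm_num at this
      linarith
    have key : ∀ z ∈ zs, rho z = 2 / 3 →
        ∃ j : ℕ, Sa z = 3 * 27 ^ j ∧ Za z = 2 * 27 ^ j ∧ size z = 4 + 10 * j := by
      intro z hz hrz
      have hzl : z ≠ RT.leaf := by rintro rfl; norm_num at hrz
      obtain ⟨ws, rfl, -, hws⟩ := (hB z hz).exists_N hzl
      obtain ⟨l, hp⟩ := perm_cons_of_mem hz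
      have h1 := (Rep.rotatable hG).perm_path h hp
      have hf1 := forkAt_rotatable.perm_path hf hp
      have e : up p (N (N ws :: l)) = up (p ++ [l]) (N ws) := by rw [up_append]; rfl
      rw [e] at h1 hf1
      refine ih _ ?_ rfl h1 hf1 hrz.le
      rw [← hn, size_N zs, size_perm hp]
      exact Nat.lt_succ_of_lt (size_le_of_mem (by simp))
    match zs, hlen, h, hf, hz, hs, key with
    | [a, b], _, h, hf, hz, _, _ =>
      obtain ⟨rfl, rfl⟩ := h.leaf_of_path hG hf hl
      exact ⟨0, Sa_fork.trans (by norm_num), Za_fork.trans (by norm_num), size_fork⟩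
    | [a, b, c], _, h, hf, hz, hs, key =>
      have ha := hz a (by simp)
      have hb := hz b (by simp)
      have hc := hz c (by simp)
      simp only [sg_cons, sg_nil] at hs
      obtain ⟨i, hi, hi', hi''⟩ := key a (by simp) (by linarith)
      obtain ⟨j, hj, hj', hj''⟩ := key b (by simp) (by linarith)
      obtain ⟨k, hk, hk', hk''⟩ := key c (by simp) (by linarith)
      refine ⟨i + j + k + 1, ?_⟩
      simp [Sa_N, Za_N, Sb_cons, Zb_cons, size_N, size_mk, hi, hj, hk, hi', hj', hk', hi'', hj'', hk'']
      refine ⟨by ring, by ring, by ring⟩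
    | a :: b :: c :: d :: l, _, h, hf, hz, hs, _ =>
      have := sg_nonneg l
      simp at hz hs
      linarith

end

end OptimalTree

namespace OptimalTree

open RT

-- A fork and a vertex of degree five exclude each other

section

variable {V : Type*} [Fintype V] {G : SimpleGraph V}

/-- The competitor keeps the total exponent in one ternary branch. The comparison reduces to `9 *
rho r ≤ 3`, against `rho r > 1 / 2`. -/
lemma Rep.not_four_ternary {a b c d r : RT} (h : Rep G false [a, b, c, d, r]) (hG : Adm G)
    (hd : ∀ x ∈ [a, b, c, d],
      ∃ j : ℕ, Sa x = 3 * 27 ^ j ∧ Za x = 2 * 27 ^ j ∧ size x = 4 + 10 * j) : False := by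
  obtain ⟨i, hi, hi', hi''⟩ := hd a (by simp)
  obtain ⟨j, hj, hj', hj''⟩ := hd b (by simp)
  obtain ⟨k, hk, hk', hk''⟩ := hd c (by simp)
  obtain ⟨l, hl, hl', hl''⟩ := hd d (by simp)
  obtain ⟨h1, h2, h3⟩ := ternary_values (i + j + k + l)
  have hr := ((h.bushy_all hG) r (by simp)).half_lt
  have := Rep.exchange (xs := [a, b, c, d])
    (xs' := [RT.leaf, fork, N [RT.leaf, fork, ternary (i + j + k + l)]]) (rest := [r]) h hG
    (by simp [size_N, size_mk, hi'', hj'', hk'', hl'', h3]; ring)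
  simp [Sa_N, Za_N, Sb_cons, Zb_cons, hi, hj, hk, hl, hi', hj', hk', hl', h1, h2] at this
  have h0 : (0 : ℚ) < 27 ^ i * 27 ^ j * 27 ^ k * 27 ^ l := by positivity
  rw [pow_add, pow_add, pow_add] at this
  have h5 : (27 ^ i * 27 ^ j * 27 ^ k * 27 ^ l) * (9 * rho r - 3) ≤ 0 := by linarith
  have := nonpos_of_mul_nonpos_right h5 h0
  linarith

/-- It suffices that the inner ratio sum is at least 7/3, which a leaf next to two ratios of at
least 2/3 provides. If `ws` has three nontrivial branches, exchanging one of them with a leaf beside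
the fork yields the contradiction. -/
lemma Rep.seven_tenths_le {q : List (List RT)} {ws ys : List RT}
    (h : Rep G false (N ws :: up q (N [fork, RT.leaf, RT.leaf]) :: ys)) (hG : Adm G)
    (hf : ForkAt (N ws :: up q (N [fork, RT.leaf, RT.leaf]) :: ys)) (hl : ys.length = 3) :
    7 / 10 ≤ rho (N ws) := by
  have hws := Bushy.of_N (h.bushy_all hG (N ws) (by simp))
  have h1 := (Rep.two_thirds_le_of_path (p := []) hG (by simp [hl]) _ rfl h hf).1
  suffices 7 / 3 ≤ sg ws from
    le_trans (by norm_num) (le_rho_N (fun y hy => (hws.2 y hy).pos.1) this (by norm_num))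
  match ws, hws, h, hf, h1 with
  | [a, b], hws, h, hf, _ =>
    obtain ⟨rfl, rfl⟩ := Rep.leaf_of_path (p := []) h hG hf (by simp [hl])
    have := Rep.length_le_three_of_fork h hG
    simp [hl] at this
  | a :: b :: c :: d :: l, _, _, _, h1 =>
    have := sg_nonneg l
    simp at h1 ⊢
    linarith
  | [a, b, c], hws, h, hf, h1 =>
    simp at h1
    obtain ⟨h1a, h1b, h1c⟩ := h1
    simp only [sg_cons, sg_nil]
    by_cases ha : a = RT.leaf
    · subst ha; norm_num; linarith
    by_cases hb : b = RT.leaf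
    · subst hb; norm_num; linarith
    by_cases hc : c = RT.leaf
    · subst hc; norm_num; linarith
    exfalso
    have h2 := h.rotN hG
    have hf2 := forkAt_rotatable.rotN hf
    have e : N (up q (N [fork, RT.leaf, RT.leaf]) :: ys) =
      up (ys :: q) (N [fork, RT.leaf, RT.leaf]) := rfl
    rw [e] at h2 hf2
    have hp : [fork, RT.leaf, RT.leaf].Perm [RT.leaf, fork, RT.leaf] := List.Perm.swap _ _ _
    have h3 := (Rep.rotatable hG).perm_path h2 hp
    have hf3 := forkAt_rotatable.perm_path hf2 hp
    have h4 := (h3.perm (List.Perm.swap _ _ _)).rho_add_le_of_lt hG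
      ((hws.2 a (by simp)).lt_one ha |>.trans_eq rho_leaf.symm)
    have hb3 := h3.bushy_all hG
    have hub := hb3 _ (List.mem_cons_self ..)
    have hu : rho (up (ys :: q) (N [RT.leaf, fork, RT.leaf])) ≤ 3 / 4 :=
      h3.rho_le_of_forkAt hG hf3
    have hmono : rho (up (ys :: q) (N [fork, RT.leaf])) ≤
        rho (up (ys :: q) (N [RT.leaf, fork, RT.leaf])) := by
      have b1 : Bushy (N [fork, RT.leaf]) := .node (by simp) (by simp [Bushy.leaf, Bushy.fork])
      refine rho_up_mono (bushy_up hub b1) (bushy_of_up hub).2 (rho_N_mono ?_ ?_ ?_)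
      · simp [Bushy.leaf, Bushy.fork]
      · simp [Bushy.leaf, Bushy.fork]
      · simp
    have hb' : rho b ≤ 3 / 4 := by
      refine Rep.rho_le_of_ne_leaf (xs := [up (ys :: q) (N [fork, RT.leaf, RT.leaf]), a, c])
        (h2.perm ?_) hG (forkAt_rotatable.perm hf2 ?_) hb
      · exact List.perm_middle (l₁ := [_, _])
      · exact List.perm_middle (l₁ := [_, _])
    have hc' : rho c ≤ 3 / 4 := by
      refine Rep.rho_le_of_ne_leaf (xs := [up (ys :: q) (N [fork, RT.leaf, RT.leaf]), a, b])
        (h2.perm ?_) hG (forkAt_rotatable.perm hf2 ?_) hc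
      · exact List.perm_middle (l₁ := [_, _, _])
      · exact List.perm_middle (l₁ := [_, _, _])
    have bbc : Bushy (N [b, c]) := .node (by simp) fun y hy => hws.2 y (by simp at hy ⊢; tauto)
    have hbc := bbc.half_lt
    have hys : ∀ y ∈ ys, 2 / 3 ≤ rho y := fun y hy =>
      h.two_thirds_le hG (by simp [hl]) y (by simp [hy])
    -- The exchange gives this ratio plus 5/3 at most 3 · 3/4, that is, at most 7/12.
    have hX : 7 / 12 < rho (up (ys :: q).reverse (N [b, c])) := by
      have hrev : (ys :: q).reverse = q.reverse ++ [ys] := by simp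
      rw [hrev, up_append]
      simp only [up]
      have bY : Bushy (N (N [b, c] :: ys)) := by
        refine .node (by simp [hl]) fun y hy => ?_
        rcases List.mem_cons.1 hy with rfl | hy
        · exact bbc
        · exact h.bushy_all hG y (by simp [hy])
      rcases List.eq_nil_or_concat q with rfl | ⟨q', s, rfl⟩
      · simp only [List.reverse_nil, up]
        have := mul_length_le_sg hys
        rw [hl] at this
        norm_num at this
        refine lt_of_le_of_lt (by norm_num)
          (lt_rho_N (c := 5 / 2) (fun y hy => (bY.of_N.2 y hy).pos.1) ?_ (by norm_num))
        simp
        linarith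
      · have h5 : Rep G false (up q' (N (N [fork, RT.leaf, RT.leaf] :: s)) :: N [a, b, c] :: ys) := by
          have := h.perm (List.Perm.swap _ _ _)
          rw [List.concat_eq_append, up_append] at this
          exact this
        have hf5 : ForkAt (up q' (N (N [fork, RT.leaf, RT.leaf] :: s)) :: N [a, b, c] :: ys) := by
          have := forkAt_rotatable.perm hf (List.Perm.swap _ _ _)
          rw [List.concat_eq_append, up_append] at this
          exact this
        have h6 := (Rep.two_thirds_le_of_path hG (by simp [hl]) _ rfl h5 hf5).1
        obtain ⟨hlen, hs⟩ := h5.bushy_path hG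
        rw [List.concat_eq_append, List.reverse_append, List.reverse_singleton, List.singleton_append]
        simp only [up]
        have h5s := (h5.symm hG).bushy_all hG _ (List.mem_cons_self ..)
        have bZ := bushy_up h5s bY
        have hZ := bZ.half_lt
        have hs2 : 4 / 3 ≤ sg s := by
          match s, hlen, h5, hf5, h6 with
          | [x], _, h5, hf5, _ =>
            exact absurd (h5.leaf_of_path hG hf5 (by simp [hl])).1 (N_ne_leaf _)
          | x :: y :: l, _, _, _, h6 =>
            have := sg_nonneg l
            simp at h6 ⊢
            linarith
        refine lt_of_le_of_lt (by norm_num) (lt_rho_N (c := 11 / 6) (fun y hy => ?_) ?_ (by norm_num))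
        · rcases List.mem_cons.1 hy with rfl | hy
          · exact bZ.pos.1
          · exact (hs y (by simp [hy])).pos.1
        · simp
          linarith
    simp at h4
    simp only [List.reverse_cons] at hX
    linarith

/-- If the fork hangs next to two leaves, the branches at the vertex of degree five have ratio at
least 7/10, too much since 2/3 + 3 · 7/10 > 11/4. If not, a branch of ratio above 2/3 could
profitably be exchanged with the fork, so four branches have ratio 2/3 and `Rep.not_four_ternary`
applies. -/
lemma Rep.false_of_forkAt {xs : List RT} (h : Rep G false xs) (hG : Adm G) (hf : ForkAt xs)
    (hl : 5 ≤ xs.length) : False := by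
  obtain ⟨hlen, hbd⟩ := h.bounds_of_forkAt hG hf hl
  obtain ⟨x, hx, hx'⟩ : ∃ x ∈ xs, HasFork x := by
    rcases hf with h | ⟨u, _, h⟩
    · exact h
    · have := h.length_eq
      simp at this
      omega
  obtain ⟨ys, hp⟩ := perm_cons_of_mem hx
  have hlen' : ys.length = 4 := by have := hp.length_eq; simp at this; omega
  obtain ⟨q, t, hr, h2, hf2, ht⟩ := (h.perm hp).exists_path_of_fork hG
    (forkAt_rotatable.perm hf hp) hx' hlen'.ge
  have hbd' : ∀ y ∈ ys, 2 / 3 ≤ rho y ∧ rho y ≤ 3 / 4 := fun y hy => hbd y (hp.mem_iff.2 (by simp [hy]))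
  have hx2 := (hbd x hx).1
  have hs := h2.symm hG
  have hfs := forkAt_rotatable.symm hf2
  have hB := h2.bushy_all hG
  obtain ⟨htl, htB⟩ := h2.bushy_path hG
  match t, ht, htl, h2, hf2, hr, htB, hs, hfs with
  | [a], _, _, h2, hf2, _, _, _, _ =>
    exact fork_ne_leaf (h2.leaf_of_path hG hf2 hlen'.ge).1
  | [a, b], _, _, h2, hf2, hr, htB, hs, hfs =>
    by_cases hab : a = RT.leaf ∧ b = RT.leaf
    · obtain ⟨rfl, rfl⟩ := hab
      have key : ∀ y l, ys.Perm (y :: l) → 7 / 10 ≤ rho y := by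
        intro y l hy
        have hym : y ∈ ys := hy.mem_iff.2 (by simp)
        have hyl : y ≠ RT.leaf := by
          rintro rfl
          have := (hbd' _ hym).2
          norm_num at this
        obtain ⟨ws, rfl, -⟩ := (hB y (by simp [hym])).exists_N hyl
        have hpp := (hy.cons (up q (N [fork, RT.leaf, RT.leaf]))).trans (List.Perm.swap _ _ _)
        exact (h2.perm hpp).seven_tenths_le hG (forkAt_rotatable.perm hf2 hpp) (by
          have := hy.length_eq; simp at this; omega)
      match ys, hlen', h2, key with
      | [c, d, e, f], _, h2, key =>
        have kc := key d [c, e, f] (List.Perm.swap _ _ _)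
        have kd := key e [c, d, f] (List.perm_middle (l₁ := [_, _]))
        have ke := key f [c, d, e] (List.perm_middle (l₁ := [_, _, _]))
        have := (h2.perm (List.Perm.swap _ _ _)).fork_path_le hG (by simp) (by simp)
        rw [hr] at this
        simp at this
        linarith
    · have hab' : rho a + rho b ≤ 7 / 4 := by
        rcases not_and_or.1 hab with ha | hb
        · have := Rep.rho_le_of_ne_leaf (hs.perm (List.perm_middle (l₁ := [_, _]))) hG
            (forkAt_rotatable.perm hfs (List.perm_middle (l₁ := [_, _]))) ha
          linarith [rho_le_one b]
        · have := Rep.rho_le_of_ne_leaf (hs.perm (List.perm_middle (l₁ := [_, _, _]))) hG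
            (forkAt_rotatable.perm hfs (List.perm_middle (l₁ := [_, _, _]))) hb
          linarith [rho_le_one a]
      have hqa : Rep G false (up q (N [a, b, fork]) :: ys) := (Rep.rotatable hG).perm_path h2
        (List.perm_append_comm (l₁ := [fork]))
      have key : ∀ y l, ys.Perm (y :: l) → rho y ≤ 2 / 3 := by
        intro y l hy
        -- The exchange of `y` with the fork bounds a sum exceeding 1/2 + 3 · 2/3 by 3/4 + 7/4,
        -- which is the same number.
        by_contra! hlt
        have h3 : Rep G false (up q.reverse (N (y :: l)) :: fork :: [a, b]) :=
          (Rep.rotatable hG).perm_path hs hy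
        have h4 := (h3.perm (List.Perm.swap _ _ _)).rho_add_le_of_lt hG (by simpa using hlt)
        rw [List.reverse_reverse] at h4
        have hll : l.length = 3 := by have := hy.length_eq; simp at this; omega
        have hlB : ∀ z ∈ l, Bushy z := fun z hz => hB z (by simp [hy.mem_iff.2 (List.mem_cons_of_mem _ hz)])
        have h5 := mul_length_le_sg fun z hz =>
          (hbd' z (hy.mem_iff.2 (List.mem_cons_of_mem _ hz))).1
        rw [hll] at h5
        norm_num at h5
        have bab : Bushy (N [a, b]) := .node (by simp) fun z hz => htB z (List.mem_cons_of_mem _ hz)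
        have h6 := (bushy_up (hB _ (List.mem_cons_self ..)) bab).half_lt
        have h7 : rho (up q.reverse (N (y :: l))) ≤ 3 / 4 := by
          have hf3 := forkAt_rotatable.perm_path hfs hy
          obtain ⟨ts, hts⟩ := exists_up_reverse q (y :: l)
          rw [hts] at h3 hf3 ⊢
          exact h3.rho_le_of_forkAt hG hf3
        have hu3 := h3.bushy_all hG _ (List.mem_cons_self ..)
        have bl : Bushy (N l) := .node (by omega) hlB
        have h8 : rho (up q.reverse (N l)) ≤ rho (up q.reverse (N (y :: l))) := by
          refine rho_up_mono (bushy_up hu3 bl) (bushy_of_up hu3).2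
            (rho_N_mono hlB (Bushy.of_N (bushy_of_up hu3).2).2 ?_)
          rw [sg_cons]
          linarith [rho_nonneg y]
        simp at h4
        linarith
      have key2 : ∀ y ∈ ys, ∃ j : ℕ, Sa y = 3 * 27 ^ j ∧ Za y = 2 * 27 ^ j ∧ size y = 4 + 10 * j := by
        intro y hy
        obtain ⟨l, hyl⟩ := perm_cons_of_mem hy
        have hyl' : y ≠ RT.leaf := by
          rintro rfl
          have := (hbd' _ hy).2
          norm_num at this
        obtain ⟨ws, rfl, -⟩ := (hB y (by simp [hy])).exists_N hyl'
        have hpp := (hyl.cons (up q (N [fork, a, b]))).trans (List.Perm.swap _ _ _)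
        exact Rep.ternary_of_path hG (p := []) (by have := hyl.length_eq; simp at this ⊢; omega) _ rfl
          (h2.perm hpp) (forkAt_rotatable.perm hf2 hpp) (key _ _ hyl)
      match ys, hlen', h2, key2 with
      | [c, d, e, f], _, h2, key2 =>
        exact (h2.perm (List.perm_append_comm (l₁ := [_]))).not_four_ternary hG key2

end

end OptimalTree

namespace OptimalTree

open RT

namespace RT

/-! ### Chains and vertices of degree five -/

/-- Branches built from a leaf by repeatedly putting a branch next to two leaves. -/
inductive Chain : RT → Prop
  | leaf : Chain leaf
  | node {y : RT} {ys : List RT} (hp : ys.Perm [y, RT.leaf, RT.leaf]) (h : Chain y) : Chain (N ys)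

/-- Branches in which all vertices of type B have degree at most four. -/
inductive Low : RT → Prop
  | leaf : Low leaf
  | node {ys : List RT} (hl : ys.length ≤ 3) (h : ∀ y ∈ ys, Low y) : Low (N ys)

lemma Chain.node_values {y : RT} {ys : List RT} (hp : ys.Perm [y, RT.leaf, RT.leaf]) :
    Sa (N ys) = 3 * Sa y + Za y ∧ Za (N ys) = 2 * Sa y + Za y ∧ size (N ys) = size y + 4 := by
  rw [Sa_N, Za_N, size_N, Sb_perm hp, Zb_perm hp, size_perm hp]
  simp only [Sb_cons, Zb_cons, Sb_nil, Zb_nil, Sa_leaf, Za_leaf, size_mk, List.map_cons,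
    List.map_nil, List.sum_cons, List.sum_nil, size_leaf]
  refine ⟨by ring, by ring, by ring⟩

/-- The quadratic form is invariant under (S, Z) ↦ (3S + Z, 2S + Z) and equals 1 at a leaf. So the
ratio of a chain exceeds √3 - 1, the positive root of r² + 2r = 2; the number 183/250 lies just
below. -/
lemma Chain.pos_eq {x : RT} (h : Chain x) :
    0 < Sa x ∧ 0 < Za x ∧ Za x ^ 2 + 2 * Sa x * Za x - 2 * Sa x ^ 2 = 1 := by
  induction h with
  | leaf => norm_num
  | node hp h ih =>
    obtain ⟨h1, h2, -⟩ := Chain.node_values hp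
    obtain ⟨i1, i2, i3⟩ := ih
    rw [h1, h2]
    exact ⟨by positivity, by positivity, by linarith⟩

lemma Chain.two_lt {x : RT} (h : Chain x) : 2 < rho x ^ 2 + 2 * rho x := by
  obtain ⟨i1, i2, i3⟩ := h.pos_eq
  rw [Za_eq i1] at i3
  have : 0 < Sa x ^ 2 * (rho x ^ 2 + 2 * rho x - 2) := by linarith
  linarith [pos_of_mul_pos_right this (by positivity)]

lemma Chain.lt_rho {x : RT} (h : Chain x) : 183 / 250 < rho x := by
  have := h.two_lt
  by_contra! hc
  nlinarith [rho_nonneg x]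

lemma rho_node {y : RT} (hy : Bushy y) : rho (N [y, RT.leaf, RT.leaf]) =
    (2 + rho y) / (3 + rho y) := by
  have := rho_nonneg y
  rw [rho_N (by simp [hy.pos.1])]
  simp
  congr 1 <;> ring

lemma rho_node_lt {y : RT} (hy : Bushy y) (h : 2 < rho y ^ 2 + 2 * rho y) :
    rho (N [y, RT.leaf, RT.leaf]) < rho y := by
  have := rho_nonneg y
  rw [rho_node hy, div_lt_iff₀ (by linarith)]
  linarith

lemma Chain.exists_node {x : RT} (h : Chain x) (hx : x ≠ RT.leaf) :
    ∃ y ys, x = N ys ∧ ys.Perm [y, RT.leaf, RT.leaf] ∧ Chain y := by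
  cases h with
  | leaf => exact absurd rfl hx
  | @node y ys hp h => exact ⟨y, ys, rfl, hp, h⟩

/-- The data of a nontrivial chain, together with the chain obtained by removing a leaf from its
end. -/
lemma Chain.exists_remove {x : RT} (h : Chain x) (hx : x ≠ RT.leaf) : ∃ x' s y,
    0 < s ∧ 183 / 250 < y ∧ y ≤ 1 ∧ Sa x = s * (3 + y) ∧ Za x = s * (2 + y) ∧
      Sa x' = s * (2 + y) ∧ Za x' = s * 2 ∧ size x = size x' + 1 ∧
      (y = 1 ∧ s = 1 ∧ size x = 5 ∨ y ≤ 3 / 4 ∧ size x ≠ 5) := by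
  induction h with
  | leaf => exact absurd rfl hx
  | @node y ys hp h ih =>
    obtain ⟨h1, h2, h3⟩ := Chain.node_values hp
    have hpos := h.pos_eq.1
    by_cases hy : y = RT.leaf
    · subst hy
      refine ⟨fork, 1, 1, ?_⟩
      simp at h1 h2 h3
      norm_num [h1, h2, h3]
    · obtain ⟨y', s, r, hs, hr, hr', e1, e2, e3, e4, e5, -⟩ := ih hy
      obtain ⟨g1, g2, g3⟩ := Chain.node_values (List.Perm.refl [y', RT.leaf, RT.leaf])
      refine ⟨N [y', RT.leaf, RT.leaf], Sa y, rho y, hpos, h.lt_rho, rho_le_one y, ?_, ?_, ?_, ?_, ?_, ?_⟩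
      · rw [h1, Za_eq hpos]; ring
      · rw [h2, Za_eq hpos]; ring
      · rw [g1, mul_add, ← Za_eq hpos, e1, e2, e3, e4]; ring
      · rw [g2, e3, e4, e1]; ring
      · rw [h3, g3, e5]
      · right
        constructor
        · rw [rho, e1, e2, mul_div_mul_left _ _ hs.ne', div_le_div_iff₀ (by linarith) (by norm_num)]
          linarith
        · obtain ⟨z, zs, rfl, hz, -⟩ := h.exists_node hy
          rw [h3, (Chain.node_values hz).2.2]
          omega

lemma Chain.rho_le {x : RT} (h : Chain x) (hx : x ≠ RT.leaf) : rho x ≤ 3 / 4 := by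
  obtain ⟨x', s, y, hs, hy, hy', e1, e2, -⟩ := h.exists_remove hx
  rw [rho, e1, e2, mul_div_mul_left _ _ hs.ne', div_le_div_iff₀ (by linarith) (by norm_num)]
  linarith

end RT

section

variable {V : Type*} [Fintype V] {G : SimpleGraph V}

lemma Rep.bushy_node {y : RT} {S : List RT} (h : Rep G false (N [y, RT.leaf, RT.leaf] :: S))
    (hG : Adm G) : Bushy y :=
  (Bushy.of_N (h.bushy_all hG _ (List.mem_cons_self ..))).2 y (by simp)

/-- Exchanging `p` with a leaf of the node must not raise the product of the ratio sums. -/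
lemma Rep.one_add_le {y p q t : RT} (h : Rep G false (N [y, RT.leaf, RT.leaf] :: [p, q, t]))
    (hG : Adm G) (hp : p ≠ RT.leaf) : 1 + rho y ≤ rho q + rho t := by
  have hp' := (h.bushy_all hG p (by simp)).lt_one hp
  have := h.mul_sg_le hG (xs' := [RT.leaf, q, t]) (ys' := [y, RT.leaf, p]) (by
    rw [← Multiset.coe_eq_coe]
    simp only [← Multiset.coe_add, ← Multiset.cons_coe, Multiset.coe_nil, ← Multiset.singleton_add]
    abel)
  simp at this
  have h2 : (1 - rho p) * (1 + rho y - (rho q + rho t)) ≤ 0 := by linarith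
  linarith [nonpos_of_mul_nonpos_right h2 (by linarith)]

lemma Rep.leaves_of_node {y p q : RT} (h : Rep G false (N [y, RT.leaf, RT.leaf] :: [p, q]))
    (hG : Adm G) : p = RT.leaf ∧ q = RT.leaf := by
  have hy : 0 < rho y := by linarith [(h.bushy_node hG).half_lt]
  have := h.mul_sg_le hG (xs' := [y, p, q]) (ys' := [RT.leaf, RT.leaf]) (by
    rw [← Multiset.coe_eq_coe]
    simp only [← Multiset.coe_add, ← Multiset.cons_coe, Multiset.coe_nil, ← Multiset.singleton_add]
    abel)
  simp at this
  have h2 : rho y * (2 - (rho p + rho q)) ≤ 0 := by linarith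
  have h3 := nonpos_of_mul_nonpos_right h2 hy
  constructor <;> by_contra hc
  · linarith [(h.bushy_all hG p (by simp)).lt_one hc, rho_le_one q]
  · linarith [(h.bushy_all hG q (by simp)).lt_one hc, rho_le_one p]

/-- Exchanging `o` with a leaf of each node gives ρ(y) ≤ ρ(Z) and ρ(z) ≤ ρ(Y), where Y and Z are the
nodes above y and z. But ρ(Y) < ρ(y), so ρ(z) < ρ(y), hence ρ(Z) ≤ ρ(Y) < ρ(y). -/
lemma Rep.not_two_nodes {y z o : RT}
    (h : Rep G false (N [y, RT.leaf, RT.leaf] :: [N [z, RT.leaf, RT.leaf], RT.leaf, o])) (hG : Adm G)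
    (ho : o ≠ RT.leaf) (hy : 2 < rho y ^ 2 + 2 * rho y) : False := by
  have h1 := Rep.one_add_le (p := o) (q := N [z, RT.leaf, RT.leaf]) (t := RT.leaf)
    (h.perm (List.Perm.cons _ (List.perm_middle (l₁ := [_, _])))) hG ho
  have h' := h.perm (List.Perm.swap _ _ _)
  have h2 := Rep.one_add_le (p := o) (q := N [y, RT.leaf, RT.leaf]) (t := RT.leaf)
    (h'.perm (List.Perm.cons _ (List.perm_middle (l₁ := [_, _])))) hG ho
  have h3 := rho_node_lt (h.bushy_node hG) hy
  have h4 : rho (N [z, RT.leaf, RT.leaf]) ≤ rho (N [y, RT.leaf, RT.leaf]) := by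
    refine rho_N_mono ?_ ?_ ?_
    · simpa [Bushy.leaf] using h'.bushy_node hG
    · simpa [Bushy.leaf] using h.bushy_node hG
    · simp at h2 ⊢; linarith
  simp at h1 h2
  linarith

lemma Rep.normalize {y : RT} {ys S : List RT} (h : Rep G false (N ys :: S)) (hG : Adm G)
    (hp : ys.Perm [y, RT.leaf, RT.leaf]) : Rep G false (N [y, RT.leaf, RT.leaf] :: S) :=
  (Rep.rotatable hG).perm_path (p := []) h hp

lemma Rep.not_chain_chain {a b c : RT} {xs : List RT} (h : Rep G false (N xs :: [a, b, c]))
    (hG : Adm G) (ha : Chain a) (hb : Chain b) (hc : Chain c) (ha' : a ≠ RT.leaf)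
    (hb' : b ≠ RT.leaf) : False := by
  obtain ⟨y, ys, rfl, hp, hy⟩ := ha.exists_node ha'
  have h1 := (h.perm (List.Perm.swap _ _ _)).normalize hG hp
  by_cases hc' : c = RT.leaf
  · subst hc'
    obtain ⟨z, zs, rfl, hq, -⟩ := hb.exists_node hb'
    have h2 := (h1.perm (List.perm_middle (l₁ := [_, _]))).normalize hG hq
    refine Rep.not_two_nodes (y := y) (z := z) (o := N xs) (h2.perm ?_) hG (N_ne_leaf _) hy.two_lt
    exact (List.Perm.swap _ _ _).trans (((List.Perm.swap _ _ _).cons _).cons _)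
  · have h3 := Rep.one_add_le h1 hG (N_ne_leaf _)
    linarith [hy.lt_rho, hb.rho_le hb', hc.rho_le hc']

/-- Inductively the inner branches are chains. Two of them would make a fork or contradict
`Rep.leaves_of_node`; among three, two nontrivial ones contradict `Rep.not_chain_chain`. -/
lemma Rep.chain_of_low (hG : Adm G) {x : RT} (hx : Low x) : ∀ {xs : List RT},
    Rep G false (x :: xs) → ¬ ForkAt (x :: xs) → Chain x := by
  induction hx with
  | leaf => exact fun _ _ => .leaf
  | @node ys hl _ ih =>
    intro xs h hf
    have h1 := h.rotN hG
    have hf1 : ¬ ForkAt (N xs :: ys) := fun h => hf (forkAt_rotatable.rotN h)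
    have hc : ∀ y ∈ ys, Chain y := by
      intro y hy
      obtain ⟨l, hp⟩ := perm_cons_of_mem hy
      have hpp := (hp.cons (N xs)).trans (List.Perm.swap _ _ _)
      exact ih y hy (h1.perm hpp) fun h => hf1 (forkAt_rotatable.perm h hpp.symm)
    have hlen := (Bushy.of_N (h.bushy_all hG _ (List.mem_cons_self ..))).1
    match ys, hlen, hl, h1, h, hf, hc with
    | [a, b], _, _, h1, h, hf, hc =>
      by_cases ha : a = RT.leaf
      · by_cases hb : b = RT.leaf
        · subst ha hb
          exact absurd (.inl ⟨_, List.mem_cons_self .., .fork⟩) hf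
        · obtain ⟨z, zs, rfl, hq, -⟩ := (hc b (by simp)).exists_node hb
          have := (h1.perm (List.perm_middle (l₁ := [_, _]))).normalize hG hq
          exact absurd (this.leaves_of_node hG).1 (N_ne_leaf _)
      · obtain ⟨z, zs, rfl, hq, -⟩ := (hc a (by simp)).exists_node ha
        have := (h1.perm (List.perm_middle (l₁ := [_]))).normalize hG hq
        exact absurd (this.leaves_of_node hG).1 (N_ne_leaf _)
    | [a, b, c], _, _, h1, h, hf, hc =>
      have ca := hc a (by simp)
      have cb := hc b (by simp)
      have cc := hc c (by simp)
      by_cases ha : a = RT.leaf <;> by_cases hb : b = RT.leaf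
      · subst ha hb
        exact .node (List.perm_middle (l₁ := [_, _])) cc
      · by_cases hc0 : c = RT.leaf
        · subst ha hc0
          exact .node (List.Perm.swap _ _ _) cb
        · exact (Rep.not_chain_chain (h1.perm ((List.perm_append_comm (l₁ := [a])).cons _)) hG
            cb cc ca hb hc0).elim
      · by_cases hc0 : c = RT.leaf
        · subst hb hc0
          exact .node (.refl _) ca
        · exact (Rep.not_chain_chain (h1.perm (((List.Perm.swap _ _ _).cons _).cons _)) hG
            ca cc cb ha hc0).elim
      · exact (Rep.not_chain_chain h1 hG ca cb cc ha hb).elim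

/-- Walks away from the starting vertex to a last vertex of degree at least five. -/
lemma Rep.exists_all_low_of_not_low (hG : Adm G) :
    ∀ (n : ℕ) {x : RT} {xs : List RT}, size x = n → Rep G false (x :: xs) → ¬ Low x →
      ∃ u rest, Rep G false (u :: rest) ∧ 4 ≤ rest.length ∧ ∀ y ∈ rest, Low y := by
  intro n
  induction n using Nat.strong_induction_on with
  | _ n ih =>
    intro x xs hn h hx
    obtain ⟨ys, rfl, -⟩ := (h.bushy_all hG x (by simp)).exists_N (by rintro rfl; exact hx .leaf)
    have h1 := h.rotN hG
    by_cases hy : ∀ y ∈ ys, Low y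
    · refine ⟨_, _, h1, ?_, hy⟩
      by_contra! hl
      exact hx (.node (by omega) hy)
    · push Not at hy
      obtain ⟨y, hy, hy'⟩ := hy
      obtain ⟨l, hp⟩ := perm_cons_of_mem hy
      refine ih _ ?_ rfl (h1.perm ((hp.cons (N xs)).trans (List.Perm.swap _ _ _))) hy'
      rw [← hn, size_N]
      exact Nat.lt_succ_of_lt (size_le_of_mem hy)

end

end OptimalTree

namespace OptimalTree

open RT

-- Exchanges among leaves and chains at a vertex of degree five

section

variable {V : Type*} [Fintype V] {G : SimpleGraph V}

/-- The leaf taken from the end of the chain by `Chain.exists_remove` pays for turning three leaves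
into a fork. The next exchanges use the same device. -/
lemma Rep.not_three_leaves_chain {c : RT} {rest : List RT}
    (h : Rep G false (RT.leaf :: RT.leaf :: RT.leaf :: c :: rest)) (hG : Adm G)
    (hc : Chain c) (hc' : c ≠ RT.leaf) (hs : 2 / 3 ≤ sg rest) : False := by
  obtain ⟨c', s, y, hs0, hy, hy', e1, e2, e3, e4, e5, -⟩ := hc.exists_remove hc'
  have := Rep.exchange (xs := [RT.leaf, RT.leaf, RT.leaf, c]) (xs' := [fork, c']) h hG (by
    simp [e5]; ring)
  simp [Sb_cons, Zb_cons, e1, e2, e3, e4] at this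
  have h2 : s * ((3 + 2 * y) * sg rest - 1 - 2 * y) ≤ 0 := by linarith
  have h3 := nonpos_of_mul_nonpos_right h2 hs0
  nlinarith

lemma Rep.not_two_leaves_two_chains {c d : RT} {rest : List RT}
    (h : Rep G false (RT.leaf :: RT.leaf :: c :: d :: rest)) (hG : Adm G)
    (hc : Chain c) (hc' : c ≠ RT.leaf) (hd : Chain d) (hd' : d ≠ RT.leaf)
    (hs : 2 / 3 ≤ sg rest) : False := by
  obtain ⟨c', s, y, hs0, hy, hy', e1, e2, e3, e4, e5, -⟩ := hc.exists_remove hc'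
  obtain ⟨d', r, z, hr0, hz, hz', f1, f2, f3, f4, f5, -⟩ := hd.exists_remove hd'
  have := Rep.exchange (xs := [RT.leaf, RT.leaf, c, d]) (xs' := [RT.leaf, d', N [RT.leaf, c']]) h hG (by
    simp [e5, f5, size_N, size_mk]; ring)
  simp [Sb_cons, Zb_cons, Sa_N, Za_N, e1, e2, e3, e4, f1, f2, f3, f4] at this
  have h2 : (s * r) * ((3 + y) * (1 + z) * (sg rest - 2 / 3) + (4 + z - y / 3 - y * z / 3)) ≤ 0 := by
    linarith
  have h3 := nonpos_of_mul_nonpos_right h2 (mul_pos hs0 hr0)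
  have h4 : 0 ≤ (3 + y) * (1 + z) * (sg rest - 2 / 3) :=
    mul_nonneg (by nlinarith) (by linarith)
  nlinarith

lemma Rep.not_leaf_two_chains {c d : RT} {rest : List RT}
    (h : Rep G false (RT.leaf :: c :: d :: rest)) (hG : Adm G)
    (hc : Chain c) (hc' : c ≠ RT.leaf) (hd : Chain d) (hd' : d ≠ RT.leaf)
    (hs : 4 / 3 ≤ sg rest) : False := by
  obtain ⟨c', s, y, hs0, hy, hy', e1, e2, e3, e4, e5, -⟩ := hc.exists_remove hc'
  obtain ⟨d', r, z, hr0, hz, hz', f1, f2, f3, f4, f5, -⟩ := hd.exists_remove hd'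
  have := Rep.exchange (xs := [RT.leaf, c, d]) (xs' := [d', N [RT.leaf, c']]) h hG (by
    simp [e5, f5, size_N, size_mk]; ring)
  simp [Sb_cons, Zb_cons, Sa_N, Za_N, e1, e2, e3, e4, f1, f2, f3, f4] at this
  have h2 : (s * r) * ((3 + y) * (1 + z) * (sg rest - 4 / 3) + (3 - 2 * y / 3 - 2 * y * z / 3)) ≤ 0 := by
    linarith
  have h3 := nonpos_of_mul_nonpos_right h2 (mul_pos hs0 hr0)
  have h4 : 0 ≤ (3 + y) * (1 + z) * (sg rest - 4 / 3) :=
    mul_nonneg (by nlinarith) (by linarith)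
  nlinarith

lemma Rep.not_three_short_chains {a b c : RT} {rest : List RT}
    (h : Rep G false (a :: b :: c :: rest)) (hG : Adm G)
    (hd : ∀ x ∈ [a, b, c], Sa x = 4 ∧ Za x = 3 ∧ size x = 5) (hs : 1 / 2 < sg rest) : False := by
  obtain ⟨a1, a2, a3⟩ := hd a (by simp)
  obtain ⟨b1, b2, b3⟩ := hd b (by simp)
  obtain ⟨c1, c2, c3⟩ := hd c (by simp)
  have := Rep.exchange (xs := [a, b, c]) (xs' := [fork, fork, N [RT.leaf, fork]]) h hG (by
    simp [a3, b3, c3, size_N, size_mk])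
  simp [Sb_cons, Zb_cons, Sa_N, Za_N, a1, a2, b1, b2, c1, c2] at this
  linarith

/-- Both chains lose a leaf and are joined in one branch. The constant is 2 · 183/250 + 687/1000:
two further chains and the remaining branch. -/
lemma Rep.not_two_long_chains {c d : RT} {rest : List RT}
    (h : Rep G false (c :: d :: rest)) (hG : Adm G)
    (hc : Chain c) (hc' : c ≠ RT.leaf) (hd : Chain d) (hd' : d ≠ RT.leaf)
    (hc5 : size c ≠ 5) (hd5 : size d ≠ 5)
    (hs : 2151 / 1000 ≤ sg rest) : False := by
  obtain ⟨c', s, y, hs0, hy, hy', e1, e2, e3, e4, e5, e6⟩ := hc.exists_remove hc'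
  obtain ⟨d', r, z, hr0, hz, hz', f1, f2, f3, f4, f5, f6⟩ := hd.exists_remove hd'
  replace e6 := e6.resolve_left (fun h => hc5 h.2.2) |>.1
  replace f6 := f6.resolve_left (fun h => hd5 h.2.2) |>.1
  have := Rep.exchange (xs := [c, d]) (xs' := [N [c', d']]) h hG (by
    simp [e5, f5, size_N, size_mk]; ring)
  simp [Sb_cons, Zb_cons, Sa_N, Za_N, e1, e2, e3, e4, f1, f2, f3, f4] at this
  have h2 : (s * r) * ((3 + y + z) * (sg rest - 2151 / 1000) +
      ((3 + y + z) * (2151 / 1000) + (4 + y + z) - 2 * (2 + y) * (2 + z))) ≤ 0 := by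
    linarith
  have h3 := nonpos_of_mul_nonpos_right h2 (mul_pos hs0 hr0)
  have h4 : 0 ≤ (3 + y + z) * (sg rest - 2151 / 1000) := mul_nonneg (by linarith) (by linarith)
  nlinarith

lemma exists_split {α : Type*} (P : α → Prop) (l : List α) :
    ∃ as bs, l.Perm (as ++ bs) ∧ (∀ a ∈ as, P a) ∧ ∀ b ∈ bs, ¬ P b := by
  classical
  exact ⟨_, _, (List.filter_append_perm (fun x => decide (P x)) l).symm, by simp, by simp⟩

lemma Rep.lt_rho_of_chains {u : RT} {rest : List RT} (h : Rep G false (u :: rest)) (hG : Adm G)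
    (hl : 4 ≤ rest.length) (hc : ∀ c ∈ rest, Chain c) : 687 / 1000 ≤ rho u := by
  by_cases hu : u = RT.leaf
  · subst hu; norm_num
  obtain ⟨us, rfl, -, hus⟩ := (h.bushy_all hG u (by simp)).exists_N hu
  match rest, hl, hc, h with
  | a :: l, hl, hc, h =>
    have := h.mul_sg_le hG (xs' := l) (ys' := a :: us) List.perm_middle
    simp at this
    have ha := (hc a (by simp)).lt_rho
    have hls := mul_length_le_sg fun c hcl => (hc c (List.mem_cons_of_mem a hcl)).lt_rho.le
    have hl3 : (3 : ℚ) ≤ l.length := by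
      simp at hl
      exact_mod_cast hl
    have h2 : rho a * (sg l - sg us) ≤ 0 := by linarith
    have h3 := nonpos_of_mul_nonpos_right h2 (by linarith)
    -- Three chain ratios give the inner sum 549/250, and 549/799 exceeds 687/1000.
    exact le_trans (by norm_num)
      (le_rho_N (c := 549 / 250) (fun y hy => (hus y hy).pos.1) (by linarith) (by norm_num))

/-- The cases are the numbers of leaves. With no leaf there are at least four nontrivial chains, of
which three have size 5 or two are longer. -/
lemma Rep.false_of_chains {u : RT} {rest : List RT} (h : Rep G false (u :: rest)) (hG : Adm G)
    (hl : 4 ≤ rest.length) (hc : ∀ c ∈ rest, Chain c) : False := by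
  have hu := h.lt_rho_of_chains hG hl hc
  obtain ⟨ls, cs, hp, hls, hcs⟩ := exists_split (· = RT.leaf) rest
  have hp' : (u :: rest).Perm (ls ++ cs ++ [u]) :=
    (hp.cons u).trans (List.perm_append_comm (l₁ := [u]))
  have h1 := h.perm hp'
  have hcc : ∀ c ∈ cs, Chain c := fun c hc' => hc c (hp.mem_iff.2 (by simp [hc']))
  have hlen : 4 ≤ ls.length + cs.length := by simpa [hp.length_eq] using hl
  rw [List.eq_replicate_of_mem hls] at h1
  generalize ls.length = k at h1 hlen
  match k, cs, hlen, h1, hcc, hcs with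
  | k + 4, cs, _, h1, _, _ =>
    exact Rep.not_four_leaves (rest := List.replicate k RT.leaf ++ cs ++ [u])
      (by simpa [List.replicate_succ] using h1) hG
  | 3, c :: cs, _, h1, hcc, hcs =>
    refine Rep.not_three_leaves_chain (rest := cs ++ [u]) h1 hG (hcc c (by simp)) (hcs c (by simp)) ?_
    have := sg_nonneg cs
    simp
    linarith
  | 2, c :: d :: cs, _, h1, hcc, hcs =>
    refine Rep.not_two_leaves_two_chains (rest := cs ++ [u]) h1 hG (hcc c (by simp))
      (hcs c (by simp)) (hcc d (by simp)) (hcs d (by simp)) ?_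
    have := sg_nonneg cs
    simp
    linarith
  | 1, c :: d :: e :: cs, _, h1, hcc, hcs =>
    refine Rep.not_leaf_two_chains (rest := e :: cs ++ [u]) h1 hG (hcc c (by simp))
      (hcs c (by simp)) (hcc d (by simp)) (hcs d (by simp)) ?_
    have := sg_nonneg cs
    have := (hcc e (by simp)).lt_rho
    simp
    linarith
  | 0, cs, hlen, h1, hcc, hcs =>
    simp at h1 hlen
    obtain ⟨as, bs, hq, ha, hb⟩ := exists_split (fun x => size x = 5) cs
    have h2 := h1.perm (hq.append_right [u])
    have hca : ∀ a ∈ as, a ∈ cs := fun a ha => hq.mem_iff.2 (by simp [ha])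
    have hcb : ∀ b ∈ bs, b ∈ cs := fun a ha => hq.mem_iff.2 (by simp [ha])
    rw [hq.length_eq] at hlen
    have hsh : ∀ a ∈ as, Sa a = 4 ∧ Za a = 3 ∧ size a = 5 := by
      intro a haa
      obtain ⟨-, s, y, -, -, -, e1, e2, -, -, -, e6⟩ :=
        (hcc a (hca a haa)).exists_remove (hcs a (hca a haa))
      obtain ⟨rfl, rfl, h5⟩ := e6.resolve_right fun h => h.2 (ha a haa)
      exact ⟨e1.trans (by norm_num), e2.trans (by norm_num), h5⟩
    match as, bs, hlen, h2, hsh, hb, hca, hcb with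
    | a :: b :: c :: as, bs, _, h2, hsh, _, _, _ =>
      refine Rep.not_three_short_chains (rest := as ++ bs ++ [u]) h2 hG (fun x hx => hsh x ?_) ?_
      · simp at hx ⊢; tauto
      · have := sg_nonneg as
        have := sg_nonneg bs
        simp
        linarith
    | as, c :: d :: bs, hlen, h2, _, hb, hca, hcb =>
      have h3 : Rep G false (c :: d :: (as ++ bs ++ [u])) := by
        refine h2.perm ?_
        rw [← Multiset.coe_eq_coe]
        simp only [← Multiset.coe_add, ← Multiset.cons_coe, Multiset.coe_nil,
          ← Multiset.singleton_add]
        abel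
      have hc := hcb c (by simp)
      have hd := hcb d (by simp)
      refine h3.not_two_long_chains hG (hcc c hc) (hcs c hc) (hcc d hd) (hcs d hd)
        (hb c (by simp)) (hb d (by simp)) ?_
      have h4 : 183 / 250 * ((as ++ bs).length : ℚ) ≤ sg (as ++ bs) := mul_length_le_sg fun x hx => by
        rcases List.mem_append.1 hx with hx | hx
        · exact (hcc x (hca x hx)).lt_rho.le
        · exact (hcc x (hcb x (by simp [hx]))).lt_rho.le
      have h5 : (2 : ℚ) ≤ ((as ++ bs).length : ℚ) := by
        have : 2 ≤ (as ++ bs).length := by simp at hlen ⊢; omega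
        exact_mod_cast this
      rw [sg_append, sg_cons, sg_nil]
      linarith
    | [], [], hlen, _, _, _, _, _ => simp at hlen
    | [_], [], hlen, _, _, _, _, _ => simp at hlen
    | [_, _], [], hlen, _, _, _, _, _ => simp at hlen
    | [], [_], hlen, _, _, _, _, _ => simp at hlen
    | [_], [_], hlen, _, _, _, _, _ => simp at hlen
    | [_, _], [_], hlen, _, _, _, _, _ => simp at hlen

/-- In an optimal tree, vertices of type B have degree at most four. -/
lemma Rep.length_le_four {xs : List RT} (h : Rep G false xs) (hG : Adm G) : xs.length ≤ 4 := by
  by_contra! hl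
  obtain ⟨u, rest, h1, h2, h3⟩ : ∃ u rest, Rep G false (u :: rest) ∧ 4 ≤ rest.length ∧
      ∀ y ∈ rest, Low y := by
    by_cases hlow : ∀ y ∈ xs, Low y
    · match xs, hl, h, hlow with
      | x :: xs, hl, h, hlow =>
        exact ⟨x, xs, h, by simpa using Nat.le_of_lt_succ hl, fun y hy => hlow y (by simp [hy])⟩
    · push Not at hlow
      obtain ⟨y, hy, hy'⟩ := hlow
      obtain ⟨l, hp⟩ := perm_cons_of_mem hy
      exact Rep.exists_all_low_of_not_low hG _ rfl (h.perm hp) hy'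
  refine h1.false_of_chains hG h2 fun c hc => ?_
  obtain ⟨l, hp⟩ := perm_cons_of_mem hc
  have hpp := (hp.cons u).trans (List.Perm.swap _ _ _)
  exact Rep.chain_of_low hG (h3 c hc) (h1.perm hpp) fun hf =>
    (h1.perm hpp).false_of_forkAt hG hf (by have := hp.length_eq; simp at this ⊢; omega)

end

end OptimalTree

namespace OptimalTree

open RT

namespace RT

/-! ### Vertices with three leaves -/

/-- The chain with a given number of vertices of type B. -/
def spine : ℕ → RT
  | 0 => RT.leaf
  | n + 1 => N [spine n, RT.leaf, RT.leaf]

lemma chain_spine (n : ℕ) : Chain (spine n) := by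
  induction n with
  | zero => exact .leaf
  | succ n ih => exact .node (.refl _) ih

end RT

section

variable {V : Type*} [Fintype V] {G : SimpleGraph V}

lemma Rep.length_of_N {ys xs : List RT} (h : Rep G false (N ys :: xs)) (hG : Adm G) :
    ys.length = 2 ∨ ys.length = 3 := by
  have h1 := (h.rotN hG).length_le_four hG
  have h2 := (h.rotN hG).three_le_length hG
  simp at h1 h2
  omega

lemma Rep.length_tail {x : RT} {xs : List RT} (h : Rep G false (x :: xs)) (hG : Adm G) :
    xs.length = 2 ∨ xs.length = 3 := by
  have h1 := h.length_le_four hG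
  have h2 := h.three_le_length hG
  simp at h1 h2
  omega

lemma Rep.rho_le_three_quarters {x : RT} {xs : List RT} (h : Rep G false (x :: xs)) (hG : Adm G)
    (hx : x ≠ RT.leaf) : rho x ≤ 3 / 4 := by
  obtain ⟨ys, rfl, -, hy⟩ := (h.bushy_all hG x (by simp)).exists_N hx
  refine (rho_N_le (c := 3) (fun y hyy => (hy y hyy).pos.1) ((sg_le_length ys).trans ?_)).trans
    (by norm_num)
  rcases h.length_of_N hG with h | h <;> rw [h] <;> norm_num

/-- Nontrivial ratios are at most 3/4, so two of them leave at most 1 + 3/2. -/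
lemma Rep.exists_perm_of_sg {a b c : RT} {xs : List RT} (h : Rep G false (N [a, b, c] :: xs))
    (hG : Adm G) (hs : 5 / 2 < sg [a, b, c]) : ∃ z, [a, b, c].Perm [z, RT.leaf, RT.leaf] := by
  have h1 := h.rotN hG
  have ha := Rep.rho_le_three_quarters (h1.perm (List.perm_middle (l₁ := [_]))) hG
  have hb := Rep.rho_le_three_quarters (h1.perm (List.perm_middle (l₁ := [_, _]))) hG
  have hc := Rep.rho_le_three_quarters (h1.perm (List.perm_middle (l₁ := [_, _, _]))) hG
  have ra := rho_le_one a
  have rb := rho_le_one b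
  have rc := rho_le_one c
  simp at hs
  by_cases a0 : a = RT.leaf <;> by_cases b0 : b = RT.leaf
  · subst a0 b0
    exact ⟨c, List.perm_middle (l₁ := [_, _])⟩
  · by_cases c0 : c = RT.leaf
    · subst a0 c0
      exact ⟨b, List.Perm.swap _ _ _⟩
    · linarith [hb b0, hc c0]
  · by_cases c0 : c = RT.leaf
    · subst b0 c0
      exact ⟨a, .refl _⟩
    · linarith [ha a0, hc c0]
  · linarith [ha a0, hb b0]

/-- If `t` is nontrivial, 1 + ρ(y) exceeds 3/2. If it is a leaf, ρ(p) ≥ ρ(y) > 5/7, so `p` has inner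
ratio sum above 5/2 and is itself a node with two leaves. -/
lemma Rep.not_two_nonleaf {y p q t : RT} (h : Rep G false (N [y, RT.leaf, RT.leaf] :: [p, q, t]))
    (hG : Adm G) (hy : 2 < rho y ^ 2 + 2 * rho y) (hp : p ≠ RT.leaf) (hq : q ≠ RT.leaf) : False := by
  have hy' : 183 / 250 < rho y := by
    by_contra! hc
    nlinarith [rho_nonneg y]
  have h1 := h.one_add_le hG hp
  by_cases ht : t = RT.leaf
  · subst ht
    have h2 := Rep.one_add_le (h.perm ((List.Perm.swap _ _ _).cons _)) hG hq
    simp at h2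
    obtain ⟨ps, rfl, -, hps⟩ := (h.bushy_all hG p (by simp)).exists_N hp
    have hsp : 5 / 2 < sg ps := by
      by_contra! hc
      have := rho_N_le (fun z hz => (hps z hz).pos.1) hc
      norm_num at this
      linarith
    have h3 := h.perm (List.Perm.swap _ _ _)
    match ps, h3.length_of_N hG, h3, hsp with
    | [a, b], _, _, hsp =>
      simp at hsp
      linarith [rho_le_one a, rho_le_one b]
    | [a, b, c], _, h3, hsp =>
      obtain ⟨z, hz⟩ := h3.exists_perm_of_sg hG hsp
      refine Rep.not_two_nodes (z := z) (((h3.normalize hG hz).perm (List.Perm.swap _ _ _)).perm ?_) hG hq hy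
      exact ((List.Perm.swap _ _ _).cons _).cons _
  · have hq' := Rep.rho_le_three_quarters (h.perm (List.perm_middle (l₁ := [_, _]))) hG hq
    have ht' := Rep.rho_le_three_quarters (h.perm (List.perm_middle (l₁ := [_, _, _]))) hG ht
    linarith

lemma Rep.leaves_next_to_node {y : RT} {S : List RT}
    (h : Rep G false (N [y, RT.leaf, RT.leaf] :: S)) (hG : Adm G)
    (hy : 2 < rho y ^ 2 + 2 * rho y) :
    S = [RT.leaf, RT.leaf] ∨ ∃ r, S.Perm [RT.leaf, RT.leaf, r] := by
  match S, h.length_tail hG, h with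
  | [a, b], _, h =>
    obtain ⟨rfl, rfl⟩ := h.leaves_of_node hG
    exact .inl rfl
  | [a, b, c], _, h =>
    right
    by_cases a0 : a = RT.leaf <;> by_cases b0 : b = RT.leaf
    · subst a0 b0
      exact ⟨c, .refl _⟩
    · by_cases c0 : c = RT.leaf
      · subst a0 c0
        exact ⟨b, (List.Perm.swap _ _ _).cons _⟩
      · exact (Rep.not_two_nonleaf (h.perm ((List.perm_append_comm (l₁ := [a])).cons _)) hG hy
          b0 c0).elim
    · by_cases c0 : c = RT.leaf
      · subst b0 c0
        exact ⟨a, List.perm_append_comm (l₁ := [a])⟩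
      · exact (Rep.not_two_nonleaf (h.perm (((List.Perm.swap _ _ _).cons _).cons _)) hG hy
          a0 c0).elim
    · exact (h.not_two_nonleaf hG hy a0 b0).elim

lemma Rep.unroll {n : ℕ} {S : List RT} (h : Rep G false (spine (n + 1) :: S)) (hG : Adm G) :
    Rep G false (spine n :: [RT.leaf, RT.leaf, N S]) :=
  (Rep.rotN (ys := [spine n, RT.leaf, RT.leaf]) h hG).perm
    ((List.perm_append_comm (l₁ := [N S])))

lemma Rep.spine_step {n : ℕ} {S : List RT} (h : Rep G false (spine (n + 1) :: S)) (hG : Adm G) :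
    Rep G false (spine (n + 1) :: [RT.leaf, RT.leaf]) ∨
    Rep G false (spine (n + 1) :: [RT.leaf, RT.leaf, RT.leaf]) ∨
    ∃ S', Rep G false (spine (n + 2) :: S') := by
  rcases Rep.leaves_next_to_node h hG (chain_spine n).two_lt with rfl | ⟨r, hr⟩
  · exact .inl h
  · have h1 := h.perm (hr.cons _)
    by_cases h0 : r = RT.leaf
    · subst h0
      exact .inr (.inl h1)
    · obtain ⟨ys, rfl, -⟩ := (h1.bushy_all hG r (by simp)).exists_N h0
      have h2 := h1.perm (List.perm_middle (l₁ := [_, _, _]))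
      refine .inr (.inr ⟨ys, ?_⟩)
      exact Rep.rotN (ys := ys) h2 hG

lemma spine_values :
    (Sa (spine 3) = 56 ∧ Za (spine 3) = 41) ∧ (Sa (spine 4) = 209 ∧ Za (spine 4) = 153) ∧
      (Sa (spine 5) = 780 ∧ Za (spine 5) = 571) := by
  simp [spine, Sa_N, Za_N, Sb_cons, Zb_cons]
  norm_num

/-- The caterpillar beginning with three leaves is extended step by step; each way of ending it is
exceptional or beaten, and it cannot get as far as `spine 5`. -/
lemma Rep.not_spine {S : List RT} (h : Rep G false (spine 1 :: S)) (hG : Adm G) : False := by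
  obtain ⟨⟨a3, b3⟩, ⟨a4, b4⟩, a5, b5⟩ := spine_values
  rcases h.spine_step hG with h | h | ⟨S, h⟩
  · exact hG.not_exc (h.unroll hG).isExceptional_T8
  · exact hG.not_exc (h.unroll hG).isExceptional_T9
  rcases h.spine_step hG with h | h | ⟨S, h⟩
  · exact hG.not_exc ((h.unroll hG).unroll hG).isExceptional_T12
  · exact hG.not_exc ((h.unroll hG).unroll hG).isExceptional_T13
  rcases h.spine_step hG with h | h | ⟨S, h⟩
  · exact hG.not_exc (((h.unroll hG).unroll hG).unroll hG).isExceptional_T16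
  -- `Cat(3,2,2,3)` loses to four forks at one vertex.
  · have := Rep.le_of_size (ys := [fork, fork, fork, fork]) h hG rfl
    simp [Sb_cons, Zb_cons, a3, b3] at this
    norm_num at this
  rcases h.spine_step hG with h | h | ⟨S, h⟩
  · exact hG.not_exc ((((h.unroll hG).unroll hG).unroll hG).unroll hG).isExceptional_T20
  · have := Rep.le_of_size (ys := [RT.leaf, fork, fork, N [RT.leaf, fork, fork]]) h hG rfl
    simp [Sb_cons, Zb_cons, Sa_N, Za_N, a4, b4] at this
    norm_num at this
  -- The replacement has `Sa` 819 and `Za` 549 instead of 780 and 571, so it wins because the other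
  -- ratios sum to more than 1.
  have := Rep.exchange (xs := [spine 5]) (xs' := [N [fork, fork, N [RT.leaf, fork, fork]]]) h hG rfl
  simp [Sb_cons, Zb_cons, Sa_N, Za_N, a5, b5] at this
  have hb := h.bushy_all hG
  match S, h.length_tail hG, hb with
  | a :: b :: l, _, hb =>
    have := (hb a (by simp)).half_lt
    have := (hb b (by simp)).half_lt
    have := sg_nonneg l
    simp at *
    linarith

/-- In an optimal tree, no vertex has three leaves. -/
lemma Rep.not_three_leaves {xs : List RT} (h : Rep G false (RT.leaf :: RT.leaf :: RT.leaf :: xs))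
    (hG : Adm G) : False := by
  have hl := h.length_le_four hG
  match xs, hl, h with
  | [], _, h =>
    exact hG.card_ne_four h.card
  | [x], _, h =>
    by_cases hx : x = RT.leaf
    · subst hx
      exact h.not_four_leaves hG
    · obtain ⟨ys, rfl, -⟩ := (h.bushy_all hG x (by simp)).exists_N hx
      exact Rep.not_spine ((h.perm (List.perm_middle (l₁ := [_, _, _]))).rotN hG) hG

end

end OptimalTree

namespace OptimalTree

open RT

namespace RT

/-! ### Vertices of degree three -/

/-- The branch contains a vertex of type B of degree three with at most one leaf, away from the
root. -/
inductive HasSmall : RT → Prop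
  | here {a b : RT} (ha : a ≠ leaf) : HasSmall (N [a, b])
  | perm {ys zs : List RT} (hp : ys.Perm zs) (h : HasSmall (N ys)) : HasSmall (N zs)
  | node {y : RT} {ys : List RT} (hy : y ∈ ys) (h : HasSmall y) : HasSmall (N ys)

/-- The tree with the given branches at a vertex of type B contains a vertex of type B of degree
three with at most one leaf. -/
def SmallAt (xs : List RT) : Prop :=
  (∃ x ∈ xs, HasSmall x) ∨ ∃ a b c, a ≠ leaf ∧ b ≠ leaf ∧ xs.Perm [a, b, c]

lemma HasSmall.cases_N {x : RT} (h : HasSmall x) : ∀ {ys : List RT}, x = N ys →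
    (∃ a b, a ≠ leaf ∧ ys.Perm [a, b]) ∨ ∃ y ∈ ys, HasSmall y := by
  induction h with
  | here ha => exact fun h => .inl ⟨_, _, ha, by rw [N_injective h]⟩
  | @perm ws zs hp h ih =>
    intro ys e
    obtain rfl := N_injective e
    rcases ih rfl with ⟨a, b, ha, h⟩ | ⟨y, hy, h⟩
    · exact .inl ⟨a, b, ha, hp.symm.trans h⟩
    · exact .inr ⟨y, hp.mem_iff.1 hy, h⟩
  | @node y zs hy h ih =>
    intro ys e
    obtain rfl := N_injective e
    exact .inr ⟨y, hy, h⟩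

lemma smallAt_rotatable : Rotatable SmallAt := by
  constructor
  · rintro xs ys (⟨x, hx, h⟩ | ⟨a, b, c, ha, hb, h⟩) hp
    · exact .inl ⟨x, hp.mem_iff.1 hx, h⟩
    · exact .inr ⟨a, b, c, ha, hb, hp.symm.trans h⟩
  · rintro xs ys (⟨x, hx, h⟩ | ⟨a, b, c, ha, hb, h⟩)
    · rcases List.mem_cons.1 hx with rfl | hx
      · rcases h.cases_N rfl with ⟨a, b, ha, hp⟩ | ⟨y, hy, h⟩
        · exact .inr ⟨N xs, a, b, N_ne_leaf _, ha, hp.cons _⟩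
        · exact .inl ⟨y, by simp [hy], h⟩
      · exact .inl ⟨N xs, by simp, .node hx h⟩
    · have key : ∃ a b, a ≠ leaf ∧ xs.Perm [a, b] := by
        have hm : N ys ∈ [a, b, c] := h.mem_iff.1 (by simp)
        simp only [List.mem_cons, List.not_mem_nil, or_false] at hm
        rcases hm with rfl | rfl | rfl
        · exact ⟨b, c, hb, h.cons_inv⟩
        · exact ⟨a, c, ha, (h.trans (List.Perm.swap _ _ _)).cons_inv⟩
        · exact ⟨a, b, ha, (h.trans (List.perm_middle (l₁ := [_, _]))).cons_inv⟩
      obtain ⟨a, b, ha, hp⟩ := key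
      exact .inl ⟨N xs, by simp, .perm hp.symm (.here ha)⟩

lemma HasSmall.ne_leaf {x : RT} (h : HasSmall x) : x ≠ leaf := by
  cases h <;> exact N_ne_leaf _

lemma HasSmall.exists_path {x : RT} (h : HasSmall x) : ∃ p a b, a ≠ leaf ∧
    ∀ {R : List RT → Prop}, Rotatable R → ∀ xs, R (x :: xs) → R (up p (N [a, b]) :: xs) := by
  induction h with
  | @here a b ha => exact ⟨[], a, b, ha, fun _ xs h => h⟩
  | perm hp h ih =>
    obtain ⟨p, a, b, ha, h3⟩ := ih
    exact ⟨p, a, b, ha, fun hR xs h => h3 hR xs (hR.perm_path (p := []) h hp.symm)⟩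
  | @node y ys hy h ih =>
    obtain ⟨p, a, b, ha, h3⟩ := ih
    obtain ⟨l, hl⟩ := perm_cons_of_mem hy
    refine ⟨l :: p, a, b, ha, fun {R} hR xs h => ?_⟩
    have e := h3 hR _ (hR.perm (hR.rotN h) ((hl.cons _).trans (List.Perm.swap _ _ _)))
    exact hR.rotN (hR.perm e (List.Perm.swap _ _ _))

lemma SmallAt.exists_hasSmall {a b c d : RT} (h : SmallAt [a, b, c, d]) :
    ∃ x ∈ [a, b, c, d], HasSmall x := by
  rcases h with h | ⟨_, _, _, _, _, h⟩
  · exact h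
  · simpa using h.length_eq

lemma Sa_up_pos {p : List (List RT)} {u w : RT} (h : Bushy (up p w)) (hu : 0 < Sa u) :
    0 < Sa (up p u) := by
  induction p with
  | nil => exact hu
  | cons ys p ih =>
    have h1 := Bushy.of_N h
    refine Sa_N_pos fun y hy => ?_
    rcases List.mem_cons.1 hy with rfl | hy
    · exact ih (h1.2 _ (by simp))
    · exact (h1.2 y (by simp [hy])).pos.1

/-- Unlike in `rho_up_mono`, the ends `u` and `v` need not be bushy, which allows vertices with a
branch taken away; `w` only vouches for the path. -/
lemma rho_up_le {p : List (List RT)} {u v w : RT} (h : Bushy (up p w)) (hu : 0 < Sa u)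
    (hv : 0 < Sa v) (huv : rho u ≤ rho v) : rho (up p u) ≤ rho (up p v) := by
  induction p with
  | nil => exact huv
  | cons ys p ih =>
    have h1 := Bushy.of_N h
    have h2 := h1.2 _ (List.mem_cons_self ..)
    have pos : ∀ z, 0 < Sa z → ∀ y ∈ up p z :: ys, 0 < Sa y := by
      intro z hz y hy
      rcases List.mem_cons.1 hy with rfl | hy
      · exact Sa_up_pos h2 hz
      · exact (h1.2 y (by simp [hy])).pos.1
    simp only [up]
    rw [rho_N (pos v hv)]
    refine rho_N_le (pos u hu) ?_
    simp only [sg_cons]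
    linarith [ih h2]

lemma half_lt_sg {ys : List RT} (h : ∀ y ∈ ys, Bushy y) (hy : ys ≠ []) : 1 / 2 < sg ys := by
  cases ys with
  | nil => exact absurd rfl hy
  | cons y ys =>
    have := sg_nonneg ys
    have := (h y (by simp)).half_lt
    rw [sg_cons]
    linarith

lemma lt_rho_up_cons {p : List (List RT)} {ys : List RT} {u w : RT} {c : ℚ}
    (h : Bushy (up (ys :: p) w)) (hu : 0 < Sa u) (hc : c ≤ rho (up p u)) (h0 : 0 ≤ c) :
    (c + 1 / 2) / (c + 3 / 2) < rho (up (ys :: p) u) := by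
  have h1 := Bushy.of_N h
  have h2 : 1 / 2 < sg ys := half_lt_sg (fun y hy => h1.2 y (by simp [hy])) (by
    rintro rfl
    simp at h1)
  refine lt_of_le_of_lt (le_of_eq ?_) (lt_rho_N (c := c + 1 / 2) (fun y hy => ?_) ?_ (by linarith))
  · congr 1; ring
  · rcases List.mem_cons.1 hy with rfl | hy
    · exact Sa_up_pos (h1.2 _ (List.mem_cons_self ..)) hu
    · exact (h1.2 y (by simp [hy])).pos.1
  · rw [sg_cons]; linarith

lemma third_lt_rho_up {p : List (List RT)} {u w : RT} (h : Bushy (up p w)) (hu : 0 < Sa u)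
    (hc : 1 / 3 < rho u) : 1 / 3 < rho (up p u) := by
  cases p with
  | nil => exact hc
  | cons ys p => exact lt_of_le_of_lt (by norm_num) (lt_rho_up_cons h hu (rho_nonneg _) le_rfl)

lemma half_le_rho_up {p : List (List RT)} {u w : RT} (h : Bushy (up p w)) (hu : 0 < Sa u)
    (hc : 1 / 2 ≤ rho u) : 1 / 2 ≤ rho (up p u) := by
  induction p with
  | nil => exact hc
  | cons ys p ih =>
    exact le_trans (by norm_num)
      (lt_rho_up_cons h hu (ih ((Bushy.of_N h).2 _ (List.mem_cons_self ..))) (by norm_num)).le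

lemma Sa_N_singleton_pos {s : RT} (h : Bushy s) : 0 < Sa (N [s]) :=
  Sa_N_pos (by simpa using h.pos.1)

lemma rho_N_singleton {s : RT} (h : Bushy s) : rho (N [s]) = rho s / (1 + rho s) := by
  rw [rho_N (by simpa using h.pos.1)]
  simp

end RT

section

variable {V : Type*} [Fintype V] {G : SimpleGraph V}

/-- An outermost vertex of type B has only leaves beyond its path back; three are excluded, so there
are two. -/
lemma Rep.hasFork_of_bushy (hG : Adm G) {x : RT} (hx : Bushy x) : ∀ {xs : List RT},
    Rep G false (x :: xs) → x ≠ leaf → HasFork x := by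
  induction hx with
  | leaf => exact fun _ h => absurd rfl h
  | @node ys hl hb ih =>
    intro xs h _
    have h1 := h.rotN hG
    by_cases hy : ∃ y ∈ ys, y ≠ leaf
    · obtain ⟨y, hy, hy'⟩ := hy
      obtain ⟨l, hp⟩ := perm_cons_of_mem hy
      exact .node hy (ih y hy (h1.perm ((hp.cons (N xs)).trans (List.Perm.swap _ _ _))) hy')
    · push Not at hy
      match ys, hl, h1, hy with
      | [a, b], _, _, hy =>
        obtain rfl : a = leaf := hy a (by simp)
        obtain rfl : b = leaf := hy b (by simp)
        exact .fork
      | a :: b :: c :: l, _, h1, hy =>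
        obtain rfl : a = leaf := hy a (by simp)
        obtain rfl : b = leaf := hy b (by simp)
        obtain rfl : c = leaf := hy c (by simp)
        exact (Rep.not_three_leaves (h1.perm (List.perm_middle (l₁ := [_, _, _])).symm) hG).elim

lemma Rep.hasFork (hG : Adm G) {x : RT} {xs : List RT} (h : Rep G false (x :: xs))
    (hx : x ≠ leaf) : HasFork x :=
  Rep.hasFork_of_bushy hG (h.bushy_all hG x (by simp)) h hx

/-- Exchanging the nontrivial `a` with a leaf here bounds a number above 1/3 + 1 + 1/2 by 3/4 + 1.
-/
lemma Rep.not_two_leaves_of_hasSmall {x q : RT} (h : Rep G false [x, leaf, leaf, q]) (hG : Adm G)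
    (hx : HasSmall x) : False := by
  obtain ⟨p, a, b, ha, h2⟩ := hx.exists_path
  have h3 := (h2 (Rep.rotatable hG) _ h).symm hG
  have hB := h3.bushy_all hG
  have ba := hB a (by simp)
  have bb := hB b (by simp)
  have bu := hB _ (List.mem_cons_self ..)
  have bq := (Bushy.of_N (bushy_of_up bu).2).2 q (by simp)
  have h4 := (h3.perm (List.Perm.swap _ _ _)).rho_add_le_of_lt hG
    ((ba.lt_one ha).trans_eq rho_leaf.symm)
  rw [List.reverse_reverse] at h4
  have b0 := ((h2 (Rep.rotatable hG) _ h).bushy_all hG) _ (List.mem_cons_self ..)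
  have h5 := third_lt_rho_up b0 (Sa_N_singleton_pos bb) (by
    have := bb.half_lt
    rw [rho_N_singleton bb, lt_div_iff₀ (by linarith)]
    linarith)
  obtain ⟨ts, hts⟩ := exists_up_reverse p [leaf, leaf, q]
  have h6 : rho (up p.reverse (N [leaf, leaf, q])) ≤ 3 / 4 := by
    rw [hts] at h3 ⊢
    exact h3.rho_le_three_quarters hG (N_ne_leaf _)
  have bN : Bushy (N [leaf, q]) := .node (by simp) (by simp [Bushy.leaf, bq])
  have h7 := rho_up_le bu bN.pos.1 (bushy_of_up bu).2.pos.1 (rho_N_mono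
    (by simp [Bushy.leaf, bq]) (by simp [Bushy.leaf, bq]) (by simp))
  have := bq.half_lt
  have := rho_le_one b
  simp at h4
  linarith

/-- The branches at a vertex of type B, in a tree containing a vertex of type B of degree three
with at most one leaf. -/
def SRep (G : SimpleGraph V) (xs : List RT) : Prop := Rep G false xs ∧ SmallAt xs

lemma SRep.rotatable (hG : Adm G) : Rotatable (SRep G) :=
  ⟨fun h hp => ⟨h.1.perm hp, smallAt_rotatable.perm h.2 hp⟩,
    fun h => ⟨h.1.rotN hG, smallAt_rotatable.rotN h.2⟩⟩

lemma SRep.perm {xs ys : List RT} (h : SRep G xs) (hp : xs.Perm ys) : SRep G ys :=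
  ⟨h.1.perm hp, smallAt_rotatable.perm h.2 hp⟩

lemma SRep.not_two_leaves {p q : RT} (h : SRep G [leaf, leaf, p, q]) (hG : Adm G) : False := by
  obtain ⟨x, hx, hs⟩ := h.2.exists_hasSmall
  have := hs.ne_leaf
  simp only [List.mem_cons, List.not_mem_nil, or_false, this, false_or] at hx
  rcases hx with rfl | rfl
  · exact (h.1.perm (List.perm_middle (l₁ := [_, _]))).not_two_leaves_of_hasSmall hG hs
  · exact (h.1.perm (List.perm_middle (l₁ := [_, _, _]))).not_two_leaves_of_hasSmall hG hs

/-- Three branches with sum above 5/2 would include two leaves at a vertex of degree four, which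
`SRep.not_two_leaves` excludes; then 5/7 is s/(1+s) at s = 5/2. -/
lemma SRep.rho_le {x : RT} {xs : List RT} (h : SRep G (x :: xs)) (hG : Adm G) (hx : x ≠ leaf) :
    rho x ≤ 5 / 7 := by
  obtain ⟨ys, rfl, -, hy⟩ := (h.1.bushy_all hG x (by simp)).exists_N hx
  refine (rho_N_le (c := 5 / 2) (fun y hyy => (hy y hyy).pos.1) ?_).trans (by norm_num)
  match ys, h.1.length_of_N hG, h with
  | [a, b], _, h =>
    simp
    linarith [rho_le_one a, rho_le_one b]
  | [a, b, c], _, h =>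
    by_contra! hc
    obtain ⟨z, hz⟩ := h.1.exists_perm_of_sg hG hc
    have h1 := (((SRep.rotatable hG).rotN h).perm ((hz.trans (List.perm_append_comm (l₁ := [z]))).cons _))
    exact SRep.not_two_leaves (h1.perm (List.perm_append_comm (l₁ := [_]) (l₂ := [_, _, z]))) hG

/-- The branch `a` contains a fork; exchanging `b` with one of its leaves is profitable when `c` is
nontrivial. On a nonempty path the contradiction is 5/11 + 1 > 5/7 + 5/7. -/
lemma SRep.exists_leaf {a b c : RT} (h : SRep G [a, b, c]) (hG : Adm G) (ha : a ≠ leaf)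
    (hb : b ≠ leaf) : c = leaf := by
  by_contra hc
  have hf := h.1.hasFork hG ha
  obtain ⟨p, -, h2⟩ := hf.exists_path
  have h3 := h2 (SRep.rotatable hG) _ h
  have hB := h3.1.bushy_all hG
  have bb := hB b (by simp)
  have bc := hB c (by simp)
  have bu := hB _ (List.mem_cons_self ..)
  have hc' : rho c ≤ 5 / 7 := (h3.perm (List.perm_middle (l₁ := [_, _]))).rho_le hG hc
  have h4 := (h3.1.perm (List.Perm.swap _ _ _)).rho_add_le_of_lt (zs := [leaf]) (r' := leaf) hG
    ((bb.lt_one hb).trans_eq rho_leaf.symm)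
  have b0 := ((SRep.rotatable hG).symm (zs := [leaf, leaf]) h3).1.bushy_all hG _ (List.mem_cons_self ..)
  have hu : rho (up p RT.fork) ≤ 5 / 7 := by
    refine h3.rho_le hG ?_
    cases p <;> exact N_ne_leaf _
  have h7 := rho_up_le bu (Sa_N_singleton_pos Bushy.leaf) (bushy_of_up bu).2.pos.1 (by
    rw [rho_N_singleton .leaf]; norm_num)
  have hc2 := bc.half_lt
  have hN : rho (N [c]) = rho c / (1 + rho c) := rho_N_singleton bc
  have hN3 : 1 / 3 < rho (N [c]) := by
    rw [hN, lt_div_iff₀ (by linarith)]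
    linarith
  simp at h4
  cases hr : p.reverse with
  | nil =>
    obtain rfl : p = [] := by simpa using hr
    simp only [up, List.reverse_nil] at h4
    rw [rho_N_singleton .leaf, hN] at h4
    have : rho c * (1 + rho c) = rho c + rho c ^ 2 := by ring
    have h9 : rho c / (1 + rho c) ≥ (1 / 2) * rho c := by
      rw [ge_iff_le, le_div_iff₀ (by linarith)]
      nlinarith
    norm_num at h4
    linarith
  | cons s q =>
    rw [hr] at h4 b0
    have b1 := (Bushy.of_N b0).2 _ (List.mem_cons_self ..)
    have h8 := lt_rho_up_cons b0 (Sa_N_singleton_pos bc)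
      (third_lt_rho_up b1 (Sa_N_singleton_pos bc) hN3).le (by norm_num)
    norm_num at h8
    linarith

/-- The bound reproduces itself: a leaf and a ratio 8/13, the worst case, sum to 21/13, and 21/34 ≥
8/13. -/
lemma SRep.le_rho_of_bushy (hG : Adm G) {x : RT} (hx : Bushy x) : ∀ {xs : List RT},
    SRep G (x :: xs) → 8 / 13 ≤ rho x := by
  induction hx with
  | leaf => exact fun _ => by norm_num
  | @node ys hl hb ih =>
    intro xs h
    have h1 := (SRep.rotatable hG).rotN h
    have hy : ∀ y ∈ ys, 8 / 13 ≤ rho y := by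
      intro y hy
      obtain ⟨l, hp⟩ := perm_cons_of_mem hy
      exact ih y hy (h1.perm ((hp.cons (N xs)).trans (List.Perm.swap _ _ _)))
    have h2 : 21 / 13 ≤ sg ys := by
      match ys, hl, h1, hy with
      | [a, b], _, h1, hy =>
        simp at hy ⊢
        by_cases ha : a = leaf
        · subst ha; norm_num; linarith
        · obtain rfl := h1.exists_leaf hG (N_ne_leaf _) ha
          norm_num; linarith
      | a :: b :: c :: l, _, _, hy =>
        have := sg_nonneg l
        simp at hy ⊢
        linarith
    exact le_trans (by norm_num) (le_rho_N (fun y hy => (hb y hy).pos.1) h2 (by norm_num))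

/-- The small vertex carries a leaf by `SRep.exists_leaf`; exchanging its other branch with the leaf
here is profitable, as 1/2 + 2 · 8/13 > 5/7 + 1. -/
lemma SRep.not_one_leaf_of_hasSmall {x q s : RT} (h : SRep G [x, leaf, q, s]) (hG : Adm G)
    (hx : HasSmall x) : False := by
  obtain ⟨p, a, b, ha, h2⟩ := hx.exists_path
  have h3 := (SRep.rotatable hG).symm (h2 (SRep.rotatable hG) _ h)
  obtain ⟨ts, hts⟩ := exists_up_reverse p [leaf, q, s]
  have hne : up p.reverse (N [leaf, q, s]) ≠ leaf := by rw [hts]; exact N_ne_leaf _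
  obtain rfl := h3.exists_leaf hG hne ha
  have hB := h3.1.bushy_all hG
  have ba := hB a (by simp)
  have bu := hB _ (List.mem_cons_self ..)
  have bqs := (Bushy.of_N (bushy_of_up bu).2).2
  have bq := bqs q (by simp)
  have bs := bqs s (by simp)
  have h4 := (h3.1.perm (List.Perm.swap _ _ _)).rho_add_le_of_lt hG
    ((ba.lt_one ha).trans_eq rho_leaf.symm)
  rw [List.reverse_reverse] at h4
  have b0 := ((h2 (SRep.rotatable hG) _ h).1.bushy_all hG) _ (List.mem_cons_self ..)
  have h5 := half_le_rho_up b0 (Sa_N_singleton_pos Bushy.leaf) (by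
    rw [rho_N_singleton .leaf]; norm_num)
  have h6 := h3.rho_le hG hne
  have bN : Bushy (N [q, s]) := .node (by simp) (by simp [bq, bs])
  have h7 := rho_up_le bu bN.pos.1 (bushy_of_up bu).2.pos.1 (rho_N_mono
    (by simp [bq, bs]) (by simp [Bushy.leaf, bq, bs]) (by simp))
  have h8 := SRep.le_rho_of_bushy hG bq (h.perm (List.perm_middle (l₁ := [_, _])))
  have h9 := SRep.le_rho_of_bushy hG bs (h.perm (List.perm_middle (l₁ := [_, _, _])))
  simp at h4
  linarith

lemma SRep.not_leaf {b c d : RT} (h : SRep G [leaf, b, c, d]) (hG : Adm G) : False := by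
  obtain ⟨x, hx, hs⟩ := h.2.exists_hasSmall
  have := hs.ne_leaf
  simp only [List.mem_cons, List.not_mem_nil, or_false, this, false_or] at hx
  rcases hx with rfl | rfl | rfl
  · exact (h.perm (List.perm_middle (l₁ := [_]))).not_one_leaf_of_hasSmall hG hs
  · exact (h.perm (List.perm_middle (l₁ := [_, _]))).not_one_leaf_of_hasSmall hG hs
  · exact (h.perm (List.perm_middle (l₁ := [_, _, _]))).not_one_leaf_of_hasSmall hG hs

end

end OptimalTree

namespace OptimalTree

open RT

-- Upper bounds and explicit competitors for trees with a small vertex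

namespace RT

/-- A chain with `n` vertices of type B on top of a ternary branch. -/
def tower : ℕ → ℕ → RT
  | 0, j => ternary j
  | n + 1, j => N [tower n j, RT.leaf, RT.leaf]

lemma tower_succ (n j : ℕ) : Sa (tower (n + 1) j) = 3 * Sa (tower n j) + Za (tower n j) ∧
    Za (tower (n + 1) j) = 2 * Sa (tower n j) + Za (tower n j) ∧
    size (tower (n + 1) j) = size (tower n j) + 4 :=
  Chain.node_values (.refl _)

/-- Three chain steps use 12 vertices, as many as four vertices of type B with one leaf, and
multiply the lower bounds by more than (8/3)⁴ = 4096/81. -/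
lemma tower_three_mul (k j : ℕ) : 3 * ((8 / 3) ^ (4 * k) * 27 ^ j) ≤ Sa (tower (3 * k) j) ∧
    2 * ((8 / 3) ^ (4 * k) * 27 ^ j) ≤ Za (tower (3 * k) j) ∧
    size (tower (3 * k) j) = 4 + 12 * k + 10 * j := by
  induction k with
  | zero =>
    obtain ⟨h1, h2, h3⟩ := ternary_values j
    simp [tower, h1, h2, h3]
  | succ k ih =>
    obtain ⟨i1, i2, i3⟩ := ih
    obtain ⟨a1, a2, a3⟩ := tower_succ (3 * k) j
    obtain ⟨b1, b2, b3⟩ := tower_succ (3 * k + 1) j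
    obtain ⟨c1, c2, c3⟩ := tower_succ (3 * k + 2) j
    have e : 3 * (k + 1) = 3 * k + 2 + 1 := by ring
    have e' : (8 / 3 : ℚ) ^ (4 * (k + 1)) = (8 / 3) ^ (4 * k) * (4096 / 81) := by
      rw [mul_add, pow_add]; norm_num
    have hp : (0 : ℚ) < (8 / 3) ^ (4 * k) * 27 ^ j := by positivity
    rw [e, e', c1, c2, c3, b1, b2, b3, a1, a2, a3, i3]
    refine ⟨?_, ?_, by ring⟩ <;> linarith

/-- A list of branches of the required order with a large value. -/
lemma exists_large_of_two_le {i : ℕ} (hi : 2 ≤ i) (j : ℕ) : ∃ ys : List RT,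
    size (mk ys) = 10 + 3 * i + 10 * j ∧ 21 * ((8 / 3) ^ i * 27 ^ j) ≤ Sb (mk ys) := by
  -- Blocks of four are absorbed by the tower; the residues 2, 3, 4, 5 are realised by small
  -- branches around it.
  obtain ⟨k, r, hr, rfl⟩ : ∃ k r, r < 4 ∧ i = 4 * k + (r + 2) :=
    ⟨(i - 2) / 4, (i - 2) % 4, Nat.mod_lt _ (by norm_num), by omega⟩
  obtain ⟨h1, h2, h3⟩ := tower_three_mul k j
  generalize tower (3 * k) j = Y at *
  have hp : (0 : ℚ) < (8 / 3) ^ (4 * k) * 27 ^ j := by positivity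
  rw [pow_add, mul_right_comm]
  generalize (8 / 3 : ℚ) ^ (4 * k) * 27 ^ j = l at *
  interval_cases r
  · refine ⟨[Y, leaf, leaf, spine 2], ?_, ?_⟩
    · simp [size_mk, spine, size_N, h3]; ring
    · simp [Sb_cons, Zb_cons, spine, Sa_N, Za_N]
      linarith
  · refine ⟨[leaf, leaf, N [N [Y, leaf, leaf], leaf, leaf], fork], ?_, ?_⟩
    · simp [size_mk, size_N, h3]; ring
    · simp [Sb_cons, Zb_cons, Sa_N, Za_N]
      linarith
  · refine ⟨[Y, leaf, N [fork, leaf, leaf], N [fork, leaf, leaf]], ?_, ?_⟩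
    · simp [size_mk, size_N, h3]; ring
    · simp [Sb_cons, Zb_cons, Sa_N, Za_N]
      linarith
  · refine ⟨[Y, fork, leaf, N [N [fork, leaf, leaf], fork, leaf]], ?_, ?_⟩
    · simp [size_mk, size_N, h3]; ring
    · simp [Sb_cons, Zb_cons, Sa_N, Za_N]
      linarith

/-- Strictness is needed only for `i = 0`: otherwise the upper bound for the given tree is itself
strict. -/
lemma exists_large {i j : ℕ} (hij : i ≠ 0 ∨ j ≠ 0) : ∃ ys : List RT,
    size (mk ys) = 10 + 3 * i + 10 * j ∧ 21 * ((8 / 3) ^ i * 27 ^ j) ≤ Sb (mk ys) ∧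
      (i = 0 → 21 * ((8 / 3) ^ i * 27 ^ j) < Sb (mk ys)) := by
  match i, j, hij with
  | i + 2, j, _ =>
    obtain ⟨ys, h1, h2⟩ := exists_large_of_two_le (Nat.le_add_left 2 i) j
    exact ⟨ys, h1, h2, by simp⟩
  | 0, 0, h => simp at h
  | 0, j + 1, _ =>
    obtain ⟨h1, h2, h3⟩ := ternary_values j
    have hp : (0 : ℚ) < 27 ^ j := by positivity
    have : 21 * ((8 / 3) ^ 0 * 27 ^ (j + 1)) < Sb (mk [ternary j, leaf, leaf, spine 3]) := by
      simp [Sb_cons, Zb_cons, h1, h2, spine, Sa_N, Za_N, pow_succ]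
      linarith
    refine ⟨_, ?_, this.le, fun _ => this⟩
    simp [size_mk, spine, size_N, h3]; ring
  | 1, 0, _ =>
    refine ⟨[leaf, leaf, leaf, spine 2], rfl, ?_, by simp⟩
    simp [Sb_cons, Zb_cons, spine, Sa_N, Za_N]
    norm_num
  | 1, j + 1, _ =>
    obtain ⟨h1, h2, h3⟩ := ternary_values j
    have hp : (0 : ℚ) < 27 ^ j := by positivity
    refine ⟨[fork, leaf, leaf, N [N [N [ternary j, leaf, leaf], leaf, leaf], leaf, leaf]], ?_, ?_, by simp⟩
    · simp [size_mk, size_N, h3]; ring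
    · simp [Sb_cons, Zb_cons, h1, h2, Sa_N, Za_N, pow_succ]
      linarith

end RT

section

variable {V : Type*} [Fintype V] {G : SimpleGraph V}

/-- By `SRep.exists_leaf` and `SRep.not_leaf`, the vertices of type B in a branch are of three
kinds: forks, vertices of degree three with one leaf (counted by `i`), and vertices of degree four
without leaves (counted by `j`). One of the second kind adds 3 vertices and a factor at most 8/3;
one of the third adds 10 vertices and a factor at most 27. -/
lemma SRep.bound_of_bushy (hG : Adm G) {x : RT} (hx : Bushy x) : ∀ {xs : List RT},
    SRep G (x :: xs) → x ≠ leaf → ∃ i j : ℕ, size x = 4 + 3 * i + 10 * j ∧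
      Sa x ≤ 3 * ((8 / 3) ^ i * 27 ^ j) ∧ rho x ≤ 2 / 3 ∧ (i ≠ 0 → rho x < 2 / 3) ∧
      (i = 0 → j = 0 → x = fork) := by
  induction hx with
  | leaf => exact fun _ h => absurd rfl h
  | @node ys hl hb ih =>
    intro xs h _
    have h1 := (SRep.rotatable hG).rotN h
    have pos : ∀ y ∈ ys, 0 < Sa y := fun y hy => (hb y hy).pos.1
    have ih' : ∀ y ∈ ys, y ≠ leaf → ∃ i j : ℕ, size y = 4 + 3 * i + 10 * j ∧
        Sa y ≤ 3 * ((8 / 3) ^ i * 27 ^ j) ∧ rho y ≤ 2 / 3 ∧ (i ≠ 0 → rho y < 2 / 3) := by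
      intro y hy hyl
      obtain ⟨l, hp⟩ := perm_cons_of_mem hy
      obtain ⟨i, j, a, b, c, d, -⟩ :=
        ih y hy (h1.perm ((hp.cons (N xs)).trans (List.Perm.swap _ _ _))) hyl
      exact ⟨i, j, a, b, c, d⟩
    have hlen := h.1.length_of_N hG
    have key : ∀ y, y ≠ leaf → ys.Perm [leaf, y] → ∃ i j : ℕ, size (N ys) = 4 + 3 * i + 10 * j ∧
        Sa (N ys) ≤ 3 * ((8 / 3) ^ i * 27 ^ j) ∧ rho (N ys) ≤ 2 / 3 ∧ (i ≠ 0 → rho (N ys) < 2 / 3) ∧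
        (i = 0 → j = 0 → N ys = fork) := by
      intro y hyl hp
      have hy : y ∈ ys := hp.mem_iff.2 (by simp)
      obtain ⟨i, j, a, b, c, d⟩ := ih' y hy hyl
      have hr := rho_nonneg y
      have hsg : sg ys = 1 + rho y := by simp [sg_perm hp]
      have hrho : rho (N ys) < 2 / 3 := by
        refine lt_of_le_of_lt (rho_N_le (c := 5 / 3) pos ?_) (by norm_num)
        rw [hsg]; linarith
      refine ⟨i + 1, j, ?_, ?_, hrho.le, fun _ => hrho, by simp⟩
      · rw [size_N, size_perm hp]
        simp [size_mk, a]; ring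
      · rw [Sa_N_eq pos, hsg, Zb_perm hp, pow_succ]
        simp only [Zb_cons, Zb_nil, Sa_leaf, one_mul, mul_one]
        have := mul_le_mul b (show 1 + (1 + rho y) ≤ 8 / 3 by linarith) (by linarith) (by positivity)
        linarith
    match ys, hlen, h1, ih', pos, key with
    | [a, b], _, h1, ih', pos, key =>
      by_cases ha : a = leaf
      · by_cases hb0 : b = leaf
        · subst ha hb0
          exact ⟨0, 0, rfl, by simp [Sa_N, Sb_cons, Zb_cons]; norm_num, rho_fork.le, by simp,
            fun _ _ => rfl⟩
        · subst ha
          exact key b hb0 (.refl _)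
      · obtain rfl := h1.exists_leaf hG (N_ne_leaf _) ha
        exact key a ha (List.Perm.swap _ _ _)
    | [a, b, c], _, h1, ih', pos, _ =>
      have ha : a ≠ leaf := by
        rintro rfl
        exact SRep.not_leaf (h1.perm (List.perm_middle (l₁ := [_]))) hG
      have hb : b ≠ leaf := by
        rintro rfl
        exact SRep.not_leaf (h1.perm (List.perm_middle (l₁ := [_, _]))) hG
      have hc : c ≠ leaf := by
        rintro rfl
        exact SRep.not_leaf (h1.perm (List.perm_middle (l₁ := [_, _, _]))) hG
      obtain ⟨i, j, a1, a2, a3, a4⟩ := ih' a (by simp) ha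
      obtain ⟨k, l, b1, b2, b3, b4⟩ := ih' b (by simp) hb
      obtain ⟨m, n, c1, c2, c3, c4⟩ := ih' c (by simp) hc
      have ra := rho_nonneg a
      have rb := rho_nonneg b
      have rc := rho_nonneg c
      have hsg : sg [a, b, c] ≤ 2 := by simp; linarith
      refine ⟨i + k + m, j + l + n + 1, ?_, ?_, (rho_N_le pos hsg).trans (by norm_num), ?_, by simp⟩
      · simp [size_N, size_mk, a1, b1, c1]; ring
      · rw [Sa_N_eq pos]
        simp only [Zb_cons, Zb_nil, one_mul]
        have pa := pos a (by simp)
        have pb := pos b (by simp)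
        have pc := pos c (by simp)
        have s0 := sg_nonneg [a, b, c]
        have := mul_le_mul (mul_le_mul (mul_le_mul c2 b2 pb.le (by positivity)) a2 pa.le
          (by positivity)) (show 1 + sg [a, b, c] ≤ 3 by linarith) (by linarith) (by positivity)
        refine this.trans (le_of_eq ?_)
        rw [pow_add, pow_add, pow_add, pow_add, pow_add]
        ring
      · intro hne
        have hlt : sg [a, b, c] < 2 := by
          simp
          by_cases hi : i = 0
          · by_cases hk : k = 0
            · have := c4 (by omega)
              linarith
            · linarith [b4 hk]
          · linarith [a4 hi]
        rw [rho_N pos, div_lt_div_iff₀ (by linarith [sg_nonneg [a, b, c]]) (by norm_num)]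
        linarith

/-- In an optimal tree, a vertex of type B of degree three has at least two leaves. -/
lemma Rep.not_small {p q t : RT} (h : Rep G false [p, q, t]) (hG : Adm G) (hp : p ≠ leaf)
    (hq : q ≠ leaf) : False := by
  have hS : SRep G [p, q, t] := ⟨h, .inr ⟨p, q, t, hp, hq, .refl _⟩⟩
  obtain rfl := hS.exists_leaf hG hp hq
  have hB := h.bushy_all hG
  have bp := hB p (by simp)
  have bq := hB q (by simp)
  obtain ⟨i, j, a1, a2, a3, a4, a5⟩ := SRep.bound_of_bushy hG bp hS hp
  obtain ⟨k, l, b1, b2, b3, b4, b5⟩ := SRep.bound_of_bushy hG bq (hS.perm (List.Perm.swap _ _ _)) hq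
  have rp := rho_nonneg p
  have rq := rho_nonneg q
  have hval : Sb (mk [p, q, leaf]) = Sa p * Sa q * (1 + rho p + rho q) := by
    simp [Sb_cons, Zb_cons]
    rw [Za_eq bp.pos.1, Za_eq bq.pos.1]
    ring
  have hpq := mul_pos bp.pos.1 bq.pos.1
  have hmul : Sa p * Sa q * (7 / 3) ≤ 21 * ((8 / 3) ^ (i + k) * 27 ^ (j + l)) := by
    have := mul_le_mul a2 b2 bq.pos.1.le (by positivity)
    rw [pow_add, pow_add]
    linarith
  have hle : Sb (mk [p, q, leaf]) ≤ Sa p * Sa q * (7 / 3) := by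
    rw [hval]
    exact mul_le_mul_of_nonneg_left (by linarith) hpq.le
  by_cases h0 : i + k = 0 ∧ j + l = 0
  · obtain rfl := a5 (by omega) (by omega)
    obtain rfl := b5 (by omega) (by omega)
    have h1 : Rep G false (N [fork, leaf] :: [leaf, leaf]) := Rep.rotN (ys := [leaf, leaf]) h hG
    have h2 := (Rep.rotatable hG).perm_path (p := []) h1 (List.Perm.swap _ _ _)
    exact hG.not_exc (h2.perm (List.perm_append_comm (l₁ := [_]))).isExceptional_T10
  · obtain ⟨ys, h1, h2, h3⟩ := exists_large (i := i + k) (j := j + l) (by omega)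
    have := h.le_of_size hG (ys := ys) (by
      rw [h1]
      simp [size_mk, a1, b1]; ring)
    by_cases hi : i + k = 0
    · linarith [h3 hi]
    · have hlt : Sb (mk [p, q, leaf]) < Sa p * Sa q * (7 / 3) := by
        rw [hval]
        refine mul_lt_mul_of_pos_left ?_ hpq
        by_cases hi' : i = 0
        · linarith [b4 (by omega)]
        · linarith [a4 hi']
      linarith

end

end OptimalTree

namespace OptimalTree

open RT

-- Translation to degrees and numbers of leaves, and the theorem

lemma isLeaf_iff {x : RT} : isLeaf x = true ↔ x = leaf := by
  cases x <;> simp [isLeaf]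

variable {V : Type*} [Fintype V]

lemma degree_eq_valency (G : SimpleGraph V) [DecidableRel G.Adj] (v : V) :
    G.degree v = valency G v := by
  rw [valency, Set.ncard_eq_toFinset_card']
  rfl

lemma numAdjacentLeaves_eq_leafValency (G : SimpleGraph V) [DecidableRel G.Adj] (v : V) :
    numAdjacentLeaves G v = leafValency G v := by
  rw [leafValency, numAdjacentLeaves, ← Set.ncard_coe_finset]
  congr 1
  ext w
  simp [degree_eq_valency]

lemma adm_of_not_isExceptional {G : SimpleGraph V} (hopt : IsOptimalTree G)
    (h1 : Fintype.card V ≠ 1) (h4 : Fintype.card V ≠ 4) (hexc : ¬ IsExceptional G) : Adm G where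
  opt := hopt
  card_ne_one := h1
  card_ne_four := h4
  not_exc := hexc
  card_ne_two h := by
    obtain ⟨v⟩ := hopt.1.1.nonempty
    obtain ⟨us, hus⟩ := exists_repAt hopt.1 v
    have hs := hus.card
    rw [h, size_mk] at hs
    have hpos : ∀ x : RT, 1 ≤ size x := fun x => by
      rw [← mk_branches x, size_mk]
      omega
    match us, hus, hs with
    | [x], hus, hs =>
      have hx : size x = 1 := by
        simp at hs
        omega
      obtain ⟨ws, rfl⟩ := exists_eq_mk x
      cases ws with
      | nil =>
        by_cases hA : IsTypeA G v
        · exact hexc (Rep.isExceptional_T2 (c := true) ⟨v, hus, by simpa using hA⟩)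
        · exact hexc (Rep.isExceptional_T2 (c := false) ⟨v, hus, by simpa using hA⟩)
      | cons w ws =>
        rw [size_mk] at hx
        have := hpos w
        simp at hx
        omega
    | [], _, hs => simp at hs
    | x :: y :: l, _, hs =>
      have := hpos x
      have := hpos y
      simp at hs
      omega

lemma Rep.countP_isLeaf_lt {us : List RT} {G : SimpleGraph V} (h : Rep G false us) (hG : Adm G) :
    us.countP isLeaf < 3 := by
  by_contra! hc
  have hp := List.filter_append_perm isLeaf us
  have he : us.filter isLeaf = List.replicate (us.countP isLeaf) leaf := by
    rw [List.countP_eq_length_filter]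
    exact List.eq_replicate_of_mem fun x hx => isLeaf_iff.1 (List.mem_filter.1 hx).2
  have h1 := h.perm hp.symm
  rw [he] at h1
  obtain ⟨k, hk⟩ := Nat.exists_eq_add_of_le' hc
  rw [hk] at h1
  exact Rep.not_three_leaves (xs := List.replicate k leaf ++ _) h1 hG

lemma Rep.two_le_countP_isLeaf {us : List RT} {G : SimpleGraph V} (h : Rep G false us) (hG : Adm G)
    (hl : us.length = 3) : 2 ≤ us.countP isLeaf := by
  match us, hl, h with
  | [a, b, c], _, h =>
    by_contra! hc
    have h1 : ∀ x : RT, x ≠ leaf → isLeaf x = false := fun x hx => by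
      rw [← Bool.not_eq_true, isLeaf_iff]; exact hx
    have h2 : isLeaf leaf = true := isLeaf_iff.2 rfl
    by_cases ha : a = leaf <;> by_cases hb : b = leaf
    · subst ha hb
      simp [List.countP_cons, h2] at hc
    · by_cases hc0 : c = leaf
      · subst ha hc0
        simp [List.countP_cons, h2] at hc
      · exact Rep.not_small (h.perm (List.perm_append_comm (l₁ := [a]))) hG hb hc0
    · by_cases hc0 : c = leaf
      · subst hb hc0
        simp [h1 a ha, h2] at hc
      · exact Rep.not_small (h.perm ((List.Perm.swap _ _ _).cons _)) hG ha hc0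
    · exact Rep.not_small h hG ha hb

end OptimalTree

theorem theorem4 {V : Type*} [Fintype V] (G : SimpleGraph V) [DecidableRel G.Adj]
    (hopt : OptimalTree.IsOptimalTree G)
    (hcard1 : Fintype.card V ≠ 1) (hcard4 : Fintype.card V ≠ 4)
    (hexc : ¬ OptimalTree.IsExceptional G) :
    OptimalTree.LocalConditions G := by
  have hG := OptimalTree.adm_of_not_isExceptional hopt hcard1 hcard4 hexc
  have key : ∀ v, ∃ us : List OptimalTree.RT, G.degree v = us.length ∧
      OptimalTree.numAdjacentLeaves G v = us.countP OptimalTree.RT.isLeaf ∧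
      (OptimalTree.IsTypeA G v → OptimalTree.Rep G true us) ∧
      (OptimalTree.IsTypeB G v → OptimalTree.Rep G false us) := by
    intro v
    obtain ⟨us, hus⟩ := OptimalTree.exists_repAt hopt.1 v
    refine ⟨us, ?_, ?_, fun h => ⟨v, hus, by simpa using h⟩, fun h => ⟨v, hus, by simpa [OptimalTree.IsTypeB] using h⟩⟩
    · rw [OptimalTree.degree_eq_valency, hus.valency]
    · rw [OptimalTree.numAdjacentLeaves_eq_leafValency, hus.leafValency]
  have lc2 : ∀ v, OptimalTree.IsTypeA G v → G.degree v = 1 ∨ G.degree v = 2 := by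
    intro v hv
    obtain ⟨us, hd, -, hA, -⟩ := key v
    have h1 := (hA hv).length_le_two hG
    have h2 := List.length_pos_of_ne_nil ((hA hv).ne_nil hG)
    omega
  refine ⟨OptimalTree.bipartitionCondition hopt hG.card_ne_two, lc2, fun v hv => ?_, fun v hv => ?_,
    fun v => ?_, fun v hv => ?_⟩
  · obtain ⟨us, hd, -, -, hB⟩ := key v
    rw [hd]
    exact (hB hv).three_le_length hG
  · obtain ⟨us, hd, hl, -, hB⟩ := key v
    have hv' : OptimalTree.IsTypeB G v := fun h => by
      have := lc2 v h
      omega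
    rw [hl]
    exact (hB hv').two_le_countP_isLeaf hG (hd ▸ hv)
  · by_cases hv : OptimalTree.IsTypeA G v
    · have := lc2 v hv
      omega
    · obtain ⟨us, hd, -, -, hB⟩ := key v
      rw [hd]
      exact (hB hv).length_le_four hG
  · obtain ⟨us, hd, hl, hA, hB⟩ := key v
    rw [hl] at hv
    by_cases hv' : OptimalTree.IsTypeA G v
    · have h1 := (hA hv').length_le_two hG
      have h2 := us.countP_le_length (p := OptimalTree.RT.isLeaf)
      omega
    · exact absurd hv (not_le.2 ((hB hv').countP_isLeaf_lt hG))
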